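/- Let $\alpha,\varepsilon,\lambda,l>0$ be constants. For $n\ge 1$ put $$\gamma_n=\frac{n\pi}{l},\quad b_n=\gamma_n^2+\frac{\lambda^2}{4},\quad g_n=\tfrac12(\alpha+\varepsilon b_n),\quad \omega_n=\sqrt{g_n^2-b_n},\quad G_n(t)=\frac{1}{\omega_n}e^{-g_nt}\sinh(\omega_nt),$$ where $\omega_n$ may be imaginary (then $\sinh(\omega_nt)/\omega_n=\sin(|\omega_n|t)/|\omega_n|$) and $\sinh(\omega_nt)/\omega_n$ means $t$ if $\omega_n=0$. Let $$G(x,\xi,t)=\frac2l\,e^{\frac{\lambda}{2}(x-\xi)}\sum_{n=1}^{\infty}G_n(t)\sin(\gamma_n\xi)\sin(\gamma_nx),$$ $$a_\lambda=\alpha+\frac{\varepsilon\lambda^2}{4},\qquad p_\lambda=\frac{\pi^2}{\varepsilon\pi^2+a_\lambda l^2},\qquad q_\lambda=\frac{a_\lambda+\varepsilon(\pi/l)^2}{2},\qquad \delta=\min(p_\lambda,q_\lambda).$$ The series converges absolutely for all real $x,\xi$ and all $t\ge0$. Moreover there is a constant $C>0$, depending only on $\alpha,\varepsilon,\lambda,l$,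 with the following property. Let $T>0$, $\Omega_T=\{(x,t):0<x<l,\ 0<t\le T\}$, and let $f$ be a bounded continuous function on $\Omega_T$ whose partial derivative $\partial_xf$ exists and is continuous on $\Omega_T$. Then, for $0\le x\le l$ and $0\le t\le T$, the integral $$u_f(x,t)=-\int_0^t\!\int_0^l f(\xi,\tau)\,G(x,\xi,t-\tau)\,d\xi\,d\tau$$ converges absolutely, and $u_f$ is a solution of $$\begin{cases}(\partial_{xx}-\lambda\partial_x)(\varepsilon u_t+u)-\partial_t(u_t+\alpha u)=f(x,t), & (x,t)\in\Omega_T,\\ u(x,0)=0,\quad u_t(x,0)=0, & 0\le x\le l,\\ u(0,t)=u(l,t)=0, & 0<t\le T,\end{cases}$$ in the following sense: $u$ and $u_t$ exist and are continuous on $[0,l]\times[0,T]$; $u_{tt}$, $\partial_x(\varepsilon u_t+u)$ and $\partial_{xx}(\varepsilon u_t+u)$ exist and are continuous on $\Omega_T$; and the equation and all the initial and boundary conditions hold (time derivatives at $t=0$ and $t=T$ are one-sided). Furthermore, for every $K$ with $|f|\le K$ on $\Omega_T$ and with $B=CK$, $$|u_f(x,t)|\le B\,(1-e^{-\delta t}),\qquad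 |\partial_tu_f(x,t)|\le B\,(1-e^{-\delta t})\qquad(0\le x\le l,\ 0\le t\le T).$$ -/

import Mathlib

noncomputable section

namespace Strip

/-- The domain `Ω_T = {(x,t) : 0 < x < l, 0 < t ≤ T}`. -/
def Omega (l T : ℝ) : Set (ℝ × ℝ) := Set.Ioo 0 l ×ˢ Set.Ioc 0 T

/-- The closed rectangle `[0,l] × [0,T]`. -/
def closedOmega (l T : ℝ) : Set (ℝ × ℝ) := Set.Icc 0 l ×ˢ Set.Icc 0 T

/-- `γ_n = n π / l`. -/
def gam (l : ℝ) (n : ℕ) : ℝ := n * Real.pi / l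

/-- `b_n = γ_n² + λ²/4`. -/
def bn (lam l : ℝ) (n : ℕ) : ℝ := gam l n ^ 2 + lam ^ 2 / 4

/-- `g_n = (α + ε b_n) / 2`. -/
def gn (α ε lam l : ℝ) (n : ℕ) : ℝ := (α + ε * bn lam l n) / 2

/-- The discriminant `ω_n² = g_n² - b_n`, of either sign. -/
def disc (α ε lam l : ℝ) (n : ℕ) : ℝ := gn α ε lam l n ^ 2 - bn lam l n

/-- `G_n(t) = e^{-g_n t} sinh(ω_n t) / ω_n` with `ω_n = √(g_n² - b_n)`, written out in real form:
hyperbolic for `ω_n² > 0`; circular for `ω_n² < 0`, where `ω_n = i √(b_n - g_n²)` and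
`sinh(ω_n t) / ω_n = sin(|ω_n| t) / |ω_n|`; and the limit value `t e^{-g_n t}` for `ω_n = 0`. -/
def Gn (α ε lam l : ℝ) (n : ℕ) (t : ℝ) : ℝ :=
  Real.exp (-(gn α ε lam l n) * t) *
    (if 0 < disc α ε lam l n then
      Real.sinh (√(disc α ε lam l n) * t) / √(disc α ε lam l n)
    else if disc α ε lam l n < 0 then
      Real.sin (√(-disc α ε lam l n) * t) / √(-disc α ε lam l n)
    else t)

/-- The `n`-th term `G_n(t) sin(γ_n ξ) sin(γ_n x)` of the Fourier series of the Green function. -/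
def greenTerm (α ε lam l x ξ t : ℝ) (n : ℕ) : ℝ :=
  Gn α ε lam l n t * Real.sin (gam l n * ξ) * Real.sin (gam l n * x)

/-- The Green function of the strip problem,
`G(x,ξ,t) = (2/l) e^{λ(x-ξ)/2} ∑_{n ≥ 1} G_n(t) sin(γ_n ξ) sin(γ_n x)`. -/
def green (α ε lam l x ξ t : ℝ) : ℝ :=
  2 / l * Real.exp (lam / 2 * (x - ξ)) * ∑' n : ℕ, greenTerm α ε lam l x ξ t (n + 1)

/-- The Duhamel integral `u_f(x,t) = -∫_0^t ∫_0^l f(ξ,τ) G(x,ξ,t-τ) dξ dτ`. -/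
def duhamel (α ε lam l : ℝ) (f : ℝ → ℝ → ℝ) (x t : ℝ) : ℝ :=
  -∫ τ in (0 : ℝ)..t, ∫ ξ in (0 : ℝ)..l, f ξ τ * green α ε lam l x ξ (t - τ)

/-- `p_λ = π² / (ε π² + a_λ l²)` with `a_λ = α + ε λ²/4`. -/
def pRate (α ε lam l : ℝ) : ℝ :=
  Real.pi ^ 2 / (ε * Real.pi ^ 2 + (α + ε * lam ^ 2 / 4) * l ^ 2)

/-- `q_λ = (a_λ + ε (π/l)²) / 2` with `a_λ = α + ε λ²/4`. -/
def qRate (α ε lam l : ℝ) : ℝ := ((α + ε * lam ^ 2 / 4) + ε * (Real.pi / l) ^ 2) / 2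

/-- The decay rate `δ = min(p_λ, q_λ)`. -/
def rate (α ε lam l : ℝ) : ℝ := min (pRate α ε lam l) (qRate α ε lam l)

/-- `∂_t u (x,t)`, for `u` regarded as a function on the time interval `[0,T]`
(one-sided at `t = 0` and `t = T`). -/
def dt (T : ℝ) (u : ℝ → ℝ → ℝ) (x t : ℝ) : ℝ := derivWithin (u x) (Set.Icc 0 T) t

/-- `∂_x u (x,t)`. -/
def dx (u : ℝ → ℝ → ℝ) (x t : ℝ) : ℝ := deriv (fun y => u y t) x

/-- The operator
`L_ε u = (∂_xx - λ ∂_x)(ε u_t + u) - ∂_t(u_t + α u)`, with `w` standing for `ε u_t + u`. -/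
def opL (α ε lam T : ℝ) (u : ℝ → ℝ → ℝ) (x t : ℝ) : ℝ :=
  let w : ℝ → ℝ → ℝ := fun y s => ε * dt T u y s + u y s
  (dx (dx w) x t - lam * dx w x t) - dt T (fun y s => dt T u y s + α * u y s) x t

/-- `u` is a (classical) solution of the linear strip problem `L_ε u = f` in `Ω_T`, with
`u(x,0) = h₀(x)`, `u_t(x,0) = h₁(x)` for `0 ≤ x ≤ l` and `u(0,t) = u(l,t) = 0` for `0 < t ≤ T`.
The functions `u` and `u_t` exist and are continuous up to the boundary, so that the data are
attained continuously; `u_tt`, `∂_x(ε u_t + u)` and `∂_xx(ε u_t + u)` exist and are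
continuous in `Ω_T`. -/
structure IsSolution (α ε lam l T : ℝ) (f : ℝ → ℝ → ℝ) (h₀ h₁ : ℝ → ℝ) (u : ℝ → ℝ → ℝ) :
    Prop where
  continuous_u : ContinuousOn (Function.uncurry u) (closedOmega l T)
  exists_ut : ∀ x ∈ Set.Icc 0 l, ∀ t ∈ Set.Icc 0 T,
    DifferentiableWithinAt ℝ (u x) (Set.Icc 0 T) t
  continuous_ut : ContinuousOn (Function.uncurry (dt T u)) (closedOmega l T)
  exists_utt : ∀ x ∈ Set.Ioo 0 l, ∀ t ∈ Set.Ioc 0 T,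
    DifferentiableWithinAt ℝ (dt T u x) (Set.Icc 0 T) t
  continuous_utt : ContinuousOn (Function.uncurry (dt T (dt T u))) (Omega l T)
  exists_wx : ∀ x ∈ Set.Ioo 0 l, ∀ t ∈ Set.Ioc 0 T,
    DifferentiableAt ℝ (fun y => ε * dt T u y t + u y t) x
  continuous_wx :
    ContinuousOn (Function.uncurry (dx (fun y s => ε * dt T u y s + u y s))) (Omega l T)
  exists_wxx : ∀ x ∈ Set.Ioo 0 l, ∀ t ∈ Set.Ioc 0 T,
    DifferentiableAt ℝ (fun y => dx (fun z s => ε * dt T u z s + u z s) y t) x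
  continuous_wxx :
    ContinuousOn (Function.uncurry (dx (dx (fun y s => ε * dt T u y s + u y s)))) (Omega l T)
  equation : ∀ x ∈ Set.Ioo 0 l, ∀ t ∈ Set.Ioc 0 T, opL α ε lam T u x t = f x t
  initial_u : ∀ x ∈ Set.Icc 0 l, u x 0 = h₀ x
  initial_ut : ∀ x ∈ Set.Icc 0 l, dt T u x 0 = h₁ x
  boundary : ∀ t ∈ Set.Ioc 0 T, u 0 t = 0 ∧ u l t = 0

end Strip

end

/-! Conjugating by e^{λx/2} replaces the drift -λ∂_x by the constant λ²/4, and a sine expansion then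
decouples the problem into damped oscillators U_n'' + (α + εb_n)U_n' + b_nU_n = -F_n, where F_n is
the sine coefficient of e^{-λx/2}f. Since G_n is the fundamental solution, U_n is minus the causal
convolution of G_n with F_n. Series run over ℤ, so that multiplication by a function of x becomes
convolution of coefficients; the terms n and -n of the solution agree, which turns the prefactor 2/l
into 1/l.

Size. The kernels G_n and G_n' have L¹ norm O(1/b_n) in time (`exists_Gn_bounds`), although G_n'(0)
= 1. Hence U_n and U_n' are O(K n⁻²) uniformly in time (`exists_mode_bound`), so u and u_t are
continuous up to the boundary and bounded by a multiple of K. This does not yet allow two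
x-derivatives.

Regularity. The combination w = εu_t + u solves a heat equation, w_t = ε(w_xx - λw_x) + (1 - εα)u_t
- εf, that is, W_n' = -εb_nW_n + R_n. On ℓ¹ with weight (1 + |n|)^σ the heat flow gains 15/8 powers
of n (`exists_smoothing`). A bounded f gives R_n in ℓ² only, hence weight -5/8, and W_n gets weight
5/4. As f need not vanish at the ends and f_x need not be bounded near them, the second gain is
local (`exists_local_series`): multiply by a cutoff φ, i.e. convolve with its cosine coefficients.
The localized source is C¹ with compact support in x, the commutator costs one derivative, and both
have weight 1/4. A second smoothing gives 17/8 > 2, so w_xx exists and is continuous in the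
interior; u_tt then follows from the equation.

Estimate. For t ≥ 1 the uniform bounds suffice. For t ≤ 1, integrating u_t gives |u| ≤ CKt, and the
maximum principle for the heat equation of w (`le_mul_of_heat`) gives |w| ≤ C'Kt; then u_t = (w -
u)/ε is also O(Kt). Finally min(t,1) ≤ (1 - e^{-δt})/(1 - e^{-δ}) by convexity of exp. Of δ only its
positivity enters. -/

open Filter Topology

noncomputable section

namespace Strip

/-! ### Weighted ℓ¹ bounds for sequences of functions -/

/-- The Fourier weight `1 + |n|`. -/
def wt (n : ℤ) : ℝ := 1 + |(n : ℝ)|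

/-- `γ_n = n π / l` for integers `n`. -/
def gamZ (l : ℝ) (n : ℤ) : ℝ := n * Real.pi / l

lemma one_le_wt (n : ℤ) : 1 ≤ wt n := by
  have := abs_nonneg (n : ℝ)
  unfold wt; linarith

lemma wt_pos (n : ℤ) : 0 < wt n := lt_of_lt_of_le one_pos (one_le_wt n)

/-- The triangle inequality for |n|. Submultiplicativity is what makes the weighted ℓ¹ spaces stable
under convolution. -/
lemma wt_le_mul (n m : ℤ) : wt n ≤ wt (n - m) * wt m := by
  have h : |(n : ℝ)| ≤ |((n - m : ℤ) : ℝ)| + |(m : ℝ)| := by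
    have := abs_add_le ((n - m : ℤ) : ℝ) (m : ℝ)
    have e : (n : ℝ) = ((n - m : ℤ) : ℝ) + m := by push_cast; ring
    rwa [← e] at this
  have := mul_nonneg (abs_nonneg ((n - m : ℤ) : ℝ)) (abs_nonneg (m : ℝ))
  unfold wt; nlinarith

lemma wt_rpow_nonneg (n : ℤ) (σ : ℝ) : 0 ≤ wt n ^ σ := Real.rpow_nonneg (wt_pos n).le σ

lemma wt_rpow_le_mul {σ : ℝ} (hσ : 0 ≤ σ) (n m : ℤ) :
    wt n ^ σ ≤ wt (n - m) ^ σ * wt m ^ σ := by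
  rw [← Real.mul_rpow (wt_pos _).le (wt_pos _).le]
  exact Real.rpow_le_rpow (wt_pos _).le (wt_le_mul n m) hσ

lemma one_le_wt_rpow {σ : ℝ} (hσ : 0 ≤ σ) (n : ℤ) : 1 ≤ wt n ^ σ :=
  Real.one_le_rpow (one_le_wt n) hσ

lemma summable_wt_rpow {b : ℝ} (hb : 1 < b) : Summable (fun n : ℤ => wt n ^ (-b)) := by
  refine Summable.of_norm_bounded_eventually (Real.summable_abs_int_rpow hb) ?_
  have : ({0}ᶜ : Set ℤ) ∈ cofinite :=
    (Set.finite_singleton (0 : ℤ)).compl_mem_cofinite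
  filter_upwards [this] with n hn
  have hn' : (0 : ℝ) < |(n : ℝ)| := abs_pos.mpr (by exact_mod_cast hn)
  rw [Real.norm_of_nonneg (wt_rpow_nonneg _ _)]
  exact Real.rpow_le_rpow_of_nonpos hn' (by unfold wt; linarith) (by linarith)

/-- The sequence `g` of functions has weighted `ℓ¹` norms `∑ (1 + |n|)^σ |g n p|` that are bounded
uniformly for `p ∈ S`. -/
def WeightedBdd {X : Type*} (σ : ℝ) (g : ℤ → X → ℝ) (S : Set X) : Prop :=
  ∃ C : ℝ, 0 ≤ C ∧ ∀ p ∈ S, ∀ s : Finset ℤ, ∑ n ∈ s, wt n ^ σ * |g n p| ≤ C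

namespace WeightedBdd

variable {X Y : Type*} {σ : ℝ} {g h : ℤ → X → ℝ} {S : Set X}

lemma summable_weighted (hg : WeightedBdd σ g S) {p : X} (hp : p ∈ S) :
    Summable (fun n => wt n ^ σ * |g n p|) := by
  obtain ⟨C, -, hC⟩ := hg
  exact summable_of_sum_le (fun n => mul_nonneg (wt_rpow_nonneg _ _) (abs_nonneg _)) (hC p hp)

lemma exists_tsum_le (hg : WeightedBdd σ g S) :
    ∃ C : ℝ, 0 ≤ C ∧ ∀ p ∈ S, ∑' n, wt n ^ σ * |g n p| ≤ C := by
  obtain ⟨C, h0, hC⟩ := hg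
  exact ⟨C, h0, fun p hp => Real.tsum_le_of_sum_le
    (fun n => mul_nonneg (wt_rpow_nonneg _ _) (abs_nonneg _)) (hC p hp)⟩

/-- Bookkeeping of derivatives: multiplying coefficients by γ_n^j costs j units of weight. The map π
lets the parameter change at the same time, for instance from t to (x, t) when a bounded
trigonometric factor is attached. -/
lemma of_le (C₀ δ : ℝ) (hC₀ : 0 ≤ C₀) (hg : WeightedBdd (σ + δ) g S) {h : ℤ → Y → ℝ} {S' : Set Y}
    (π : Y → X) (hπ : ∀ y ∈ S', π y ∈ S)
    (hle : ∀ n, ∀ y ∈ S', |h n y| ≤ C₀ * wt n ^ δ * |g n (π y)|) : WeightedBdd σ h S' := by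
  obtain ⟨C, h0, hC⟩ := hg
  refine ⟨C₀ * C, mul_nonneg hC₀ h0, fun p hp s => ?_⟩
  calc ∑ n ∈ s, wt n ^ σ * |h n p| ≤ ∑ n ∈ s, C₀ * (wt n ^ (σ + δ) * |g n (π p)|) := by
        refine Finset.sum_le_sum fun n _ => ?_
        rw [Real.rpow_add (wt_pos n)]
        calc wt n ^ σ * |h n p| ≤ wt n ^ σ * (C₀ * wt n ^ δ * |g n (π p)|) :=
              mul_le_mul_of_nonneg_left (hle n p hp) (wt_rpow_nonneg _ _)
          _ = _ := by ring
    _ = C₀ * ∑ n ∈ s, wt n ^ (σ + δ) * |g n (π p)| := by rw [Finset.mul_sum]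
    _ ≤ C₀ * C := mul_le_mul_of_nonneg_left (hC _ (hπ p hp) s) hC₀

lemma of_le_one (hg : WeightedBdd σ g S) {h : ℤ → Y → ℝ} {S' : Set Y} (π : Y → X)
    (hπ : ∀ y ∈ S', π y ∈ S) (hle : ∀ n, ∀ y ∈ S', |h n y| ≤ |g n (π y)|) :
    WeightedBdd σ h S' := by
  refine of_le 1 0 zero_le_one (by simpa using hg) π hπ fun n y hy => ?_
  simpa using hle n y hy

lemma mono {S' : Set X} (hg : WeightedBdd σ g S) (h : S' ⊆ S) : WeightedBdd σ g S' :=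
  hg.of_le_one id h fun _ _ _ => le_rfl

lemma mono_exp {σ' : ℝ} (hg : WeightedBdd σ g S) (h : σ' ≤ σ) : WeightedBdd σ' g S := by
  obtain ⟨C, h0, hC⟩ := hg
  refine ⟨C, h0, fun p hp s => (Finset.sum_le_sum fun n _ => ?_).trans (hC p hp s)⟩
  exact mul_le_mul_of_nonneg_right (Real.rpow_le_rpow_of_exponent_le (one_le_wt n) h)
    (abs_nonneg _)

lemma add (hg : WeightedBdd σ g S) (hh : WeightedBdd σ h S) :
    WeightedBdd σ (fun n p => g n p + h n p) S := by
  obtain ⟨C, h0, hC⟩ := hg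
  obtain ⟨D, h0', hD⟩ := hh
  refine ⟨C + D, add_nonneg h0 h0', fun p hp s => ?_⟩
  refine le_trans ?_ (add_le_add (hC p hp s) (hD p hp s))
  rw [← Finset.sum_add_distrib]
  refine Finset.sum_le_sum fun n _ => ?_
  rw [← mul_add]
  exact mul_le_mul_of_nonneg_left (abs_add_le _ _) (wt_rpow_nonneg _ _)

lemma const_mul (c : ℝ) (hg : WeightedBdd σ g S) : WeightedBdd σ (fun n p => c * g n p) S :=
  of_le |c| 0 (abs_nonneg c) (by simpa using hg) id (fun _ h => h)
    fun n y _ => by simp [abs_mul]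

lemma of_decay {C b : ℝ} (hC : 0 ≤ C) (hb : σ + 1 < b)
    (hle : ∀ n, ∀ p ∈ S, |g n p| ≤ C * wt n ^ (-b)) : WeightedBdd σ g S := by
  have hs := summable_wt_rpow (show 1 < b - σ by linarith)
  refine ⟨C * ∑' n, wt n ^ (-(b - σ)), mul_nonneg hC (tsum_nonneg fun n => wt_rpow_nonneg _ _),
    fun p hp s => ?_⟩
  refine le_trans ?_ (mul_le_mul_of_nonneg_left
    (hs.sum_le_tsum s fun n _ => wt_rpow_nonneg _ _) hC)
  rw [Finset.mul_sum]
  refine Finset.sum_le_sum fun n _ => ?_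
  have e : -(b - σ) = σ + -b := by ring
  rw [e, Real.rpow_add (wt_pos n)]
  calc wt n ^ σ * |g n p| ≤ wt n ^ σ * (C * wt n ^ (-b)) :=
        mul_le_mul_of_nonneg_left (hle n p hp) (wt_rpow_nonneg _ _)
    _ = _ := by ring

/-- A bound in `ℓ²` with weight `τ` gives one in `ℓ¹` with any weight below `τ - 1/2`. -/
lemma of_sq {C τ : ℝ} (hτ : σ + 1 / 2 < τ)
    (hle : ∀ p ∈ S, ∀ s : Finset ℤ, ∑ n ∈ s, (wt n ^ τ * |g n p|) ^ 2 ≤ C) :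
    WeightedBdd σ g S := by
  have hs := summable_wt_rpow (show 1 < 2 * (τ - σ) by linarith)
  have h1 : ∀ p ∈ S, ∀ s : Finset ℤ, ∑ n ∈ s, wt n ^ σ * |g n p| ≤
      (∑' n, wt n ^ (-(2 * (τ - σ)))) + |C| := by
    intro p hp s
    refine le_trans ?_ (add_le_add (hs.sum_le_tsum s fun n _ => wt_rpow_nonneg _ _)
      ((hle p hp s).trans (le_abs_self C)))
    rw [← Finset.sum_add_distrib]
    refine Finset.sum_le_sum fun n _ => ?_
    have e1 : wt n ^ σ = wt n ^ (-(τ - σ)) * wt n ^ τ := by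
      rw [← Real.rpow_add (wt_pos n)]; congr 1; ring
    have e2 : wt n ^ (-(2 * (τ - σ))) = (wt n ^ (-(τ - σ))) ^ 2 := by
      rw [sq, ← Real.rpow_add (wt_pos n)]; congr 1; ring
    -- ab ≤ a² + b² with a = wt^{σ-τ}; the squares of a are summable because 2(τ - σ) > 1.
    rw [e1, e2, mul_assoc]
    nlinarith [sq_nonneg (wt n ^ (-(τ - σ)) - wt n ^ τ * |g n p|),
      sq_nonneg (wt n ^ (-(τ - σ)))]
  exact ⟨_, add_nonneg (tsum_nonneg fun n => wt_rpow_nonneg _ _) (abs_nonneg C), h1⟩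

lemma summable (hσ : 0 ≤ σ) (hg : WeightedBdd σ g S) {p : X} (hp : p ∈ S) :
    Summable (fun n => g n p) := by
  refine Summable.of_norm_bounded (hg.summable_weighted hp) fun n => ?_
  rw [Real.norm_eq_abs]
  exact le_mul_of_one_le_left (abs_nonneg _) (one_le_wt_rpow hσ n)

lemma exists_abs_le (hσ : 0 ≤ σ) (hg : WeightedBdd σ g S) :
    ∃ C : ℝ, 0 ≤ C ∧ ∀ n, ∀ p ∈ S, |g n p| ≤ C := by
  obtain ⟨C, h0, hC⟩ := hg
  refine ⟨C, h0, fun n p hp => le_trans ?_ (by simpa using hC p hp {n})⟩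
  exact le_mul_of_one_le_left (abs_nonneg _) (one_le_wt_rpow hσ n)

/-- Beyond |n| ≤ N the weight is at least (N + 1)^σ, so the tail is at most C (N + 1)^{-σ}. This
replaces the Weierstrass test: the bound is on weighted sums at each parameter, and no single
summable majorant is needed. -/
lemma tendstoUniformlyOn (hσ : 0 < σ) (hg : WeightedBdd σ g S) :
    TendstoUniformlyOn (fun (s : Finset ℤ) p => ∑ n ∈ s, g n p) (fun p => ∑' n, g n p)
      atTop S := by
  obtain ⟨C, h0, hC⟩ := hg.exists_tsum_le
  rw [Metric.tendstoUniformlyOn_iff]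
  intro ε hε
  obtain ⟨N, hN⟩ : ∃ N : ℕ, C * ((N : ℝ) + 1) ^ (-σ) < ε := by
    have h1 : Tendsto (fun N : ℕ => C * ((N : ℝ) + 1) ^ (-σ)) atTop (𝓝 (C * 0)) :=
      ((tendsto_rpow_neg_atTop hσ).comp
        (tendsto_atTop_add_const_right _ 1 tendsto_natCast_atTop_atTop)).const_mul C
    rw [mul_zero] at h1
    exact (h1.eventually (gt_mem_nhds hε)).exists
  filter_upwards [eventually_ge_atTop (Finset.Icc (-(N : ℤ)) N)] with s hs p hp
  have hsum := hg.summable hσ.le hp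
  rw [dist_comm, Real.dist_eq, abs_sub_comm, ← hsum.sum_add_tsum_compl (s := s), add_sub_cancel_left]
  refine lt_of_le_of_lt ?_ hN
  have hw := hg.summable_weighted hp
  have hq : (0 : ℝ) ≤ ((N : ℝ) + 1) ^ (-σ) := by positivity
  have hb : ∀ n : ((s : Set ℤ)ᶜ : Set ℤ),
      ‖g n p‖ ≤ ((N : ℝ) + 1) ^ (-σ) * (wt n ^ σ * |g n p|) := by
    intro n
    have hn : (n : ℤ) ∉ s := n.2
    have h3 : (N : ℝ) + 1 ≤ wt n := by
      have h4 : (n : ℤ) ∉ Finset.Icc (-(N : ℤ)) N := fun h => hn (hs h)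
      have h5 : (N : ℤ) < |(n : ℤ)| := by
        by_contra hcon
        exact h4 (Finset.mem_Icc.mpr (abs_le.mp (not_lt.mp hcon)))
      have h6 : (N : ℝ) < |((n : ℤ) : ℝ)| := by exact_mod_cast h5
      unfold wt; linarith
    rw [Real.norm_eq_abs, ← mul_assoc]
    refine le_mul_of_one_le_left (abs_nonneg _) ?_
    have h7 : ((N : ℝ) + 1) ^ σ ≤ wt n ^ σ := Real.rpow_le_rpow (by positivity) h3 hσ.le
    calc (1 : ℝ) = ((N : ℝ) + 1) ^ (-σ) * ((N : ℝ) + 1) ^ σ := by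
          rw [← Real.rpow_add (by positivity)]; simp
      _ ≤ _ := mul_le_mul_of_nonneg_left h7 hq
  have hw' := hw.subtype ((s : Set ℤ)ᶜ)
  rw [← Real.norm_eq_abs]
  refine (tsum_of_norm_bounded (hw'.mul_left (((N : ℝ) + 1) ^ (-σ))).hasSum hb).trans ?_
  rw [tsum_mul_left, mul_comm C]
  refine mul_le_mul_of_nonneg_left (le_trans ?_ (hC p hp)) hq
  exact hw.tsum_subtype_le _ _ (fun n => mul_nonneg (wt_rpow_nonneg _ _) (abs_nonneg _))

lemma continuousOn_tsum [TopologicalSpace X] (hσ : 0 < σ) (hg : WeightedBdd σ g S)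
    (hc : ∀ n, ContinuousOn (g n) S) : ContinuousOn (fun p => ∑' n, g n p) S :=
  (hg.tendstoUniformlyOn hσ).continuousOn
    (Frequently.of_forall fun s => continuousOn_finsetSum s fun n _ => hc n)

lemma hasDerivAt_tsum {g g' : ℤ → ℝ → ℝ} {S : Set ℝ} (hσ : 0 < σ) (hS : IsOpen S)
    (hg : WeightedBdd σ g' S) (hd : ∀ n, ∀ x ∈ S, HasDerivAt (g n) (g' n x) x)
    (hs : ∀ x ∈ S, Summable (fun n => g n x)) {x : ℝ} (hx : x ∈ S) :
    HasDerivAt (fun y => ∑' n, g n y) (∑' n, g' n x) x := by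
  refine hasDerivAt_of_tendstoUniformlyOn hS (hg.tendstoUniformlyOn hσ)
    (f := fun (s : Finset ℤ) y => ∑ n ∈ s, g n y)
    (Eventually.of_forall fun s y hy => ?_) (fun y hy => (hs y hy).hasSum) hx
  exact HasDerivAt.fun_sum fun n _ => hd n y hy

end WeightedBdd

/-! ### Convolution of coefficients and products of trigonometric series -/

/-- Convolution of sequences on `ℤ`. -/
def conv (p q : ℤ → ℝ) (n : ℤ) : ℝ := ∑' m, p (n - m) * q m

lemma summable_shift {p : ℤ → ℝ} (hp : Summable p) (n : ℤ) : Summable (fun m => p (n - m)) :=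
  (Equiv.subLeft n).summable_iff.mpr hp

lemma tsum_shift (p : ℤ → ℝ) (n : ℤ) : ∑' m, p (n - m) = ∑' m, p m :=
  (Equiv.subLeft n).tsum_eq p

lemma summable_conv_term {p q : ℤ → ℝ} {C : ℝ} (hp : Summable (fun n => |p n|))
    (hq : ∀ n, |q n| ≤ C) (n : ℤ) : Summable (fun m => p (n - m) * q m) := by
  refine Summable.of_norm_bounded ((summable_shift hp n).mul_right C) fun m => ?_
  rw [norm_mul, Real.norm_eq_abs, Real.norm_eq_abs]
  exact mul_le_mul_of_nonneg_left (hq m) (abs_nonneg _)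

/-- Young's inequality ℓ¹ * ℓ¹ ⊆ ℓ¹, with the weight split between the factors by
submultiplicativity. -/
lemma WeightedBdd.conv {X : Type*} {σ : ℝ} {g : ℤ → X → ℝ} {S : Set X} (hσ : 0 ≤ σ)
    {p : ℤ → ℝ} (hp : Summable (fun n => wt n ^ σ * |p n|)) (hg : WeightedBdd σ g S) :
    WeightedBdd σ (fun n x => Strip.conv p (fun m => g m x) n) S := by
  obtain ⟨C, h0, hC⟩ := hg.exists_tsum_le
  set P := ∑' n, wt n ^ σ * |p n| with hP
  have hP0 : 0 ≤ P := tsum_nonneg fun n => mul_nonneg (wt_rpow_nonneg _ _) (abs_nonneg _)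
  have hp1 : Summable (fun n => |p n|) := Summable.of_nonneg_of_le (fun n => abs_nonneg _)
    (fun n => le_mul_of_one_le_left (abs_nonneg _) (one_le_wt_rpow hσ n)) hp
  refine ⟨P * C, mul_nonneg hP0 h0, fun x hx s => ?_⟩
  have hw := hg.summable_weighted hx
  obtain ⟨D, hD0, hD⟩ := hg.exists_abs_le hσ
  have hA : ∀ n, Summable (fun m => wt (n - m) ^ σ * |p (n - m)| * (wt m ^ σ * |g m x|)) := by
    intro n
    refine Summable.of_nonneg_of_le (fun m => by
        have := wt_rpow_nonneg (n - m) σ; have := wt_rpow_nonneg m σ; positivity) (fun m => ?_)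
      (hw.mul_left P)
    refine mul_le_mul_of_nonneg_right ?_ (mul_nonneg (wt_rpow_nonneg _ _) (abs_nonneg _))
    exact hp.le_tsum (n - m) fun k _ => mul_nonneg (wt_rpow_nonneg _ _) (abs_nonneg _)
  calc ∑ n ∈ s, wt n ^ σ * |Strip.conv p (fun m => g m x) n|
      ≤ ∑ n ∈ s, ∑' m, wt (n - m) ^ σ * |p (n - m)| * (wt m ^ σ * |g m x|) := by
        refine Finset.sum_le_sum fun n _ => ?_
        have hab := (summable_conv_term hp1 (fun m => hD m x hx) n).abs
        calc wt n ^ σ * |Strip.conv p (fun m => g m x) n|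
            ≤ wt n ^ σ * ∑' m, |p (n - m) * g m x| := by
              refine mul_le_mul_of_nonneg_left ?_ (wt_rpow_nonneg _ _)
              have := norm_tsum_le_tsum_norm (f := fun m => p (n - m) * g m x) (by
                simpa [Real.norm_eq_abs] using hab)
              simpa [Real.norm_eq_abs, Strip.conv] using this
          _ = ∑' m, wt n ^ σ * |p (n - m) * g m x| := tsum_mul_left.symm
          _ ≤ _ := by
              refine Summable.tsum_le_tsum (fun m => ?_) (hab.mul_left _) (hA n)
              rw [abs_mul]
              calc wt n ^ σ * (|p (n - m)| * |g m x|)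
                  ≤ (wt (n - m) ^ σ * wt m ^ σ) * (|p (n - m)| * |g m x|) :=
                    mul_le_mul_of_nonneg_right (wt_rpow_le_mul hσ n m) (by positivity)
                _ = _ := by ring
    _ = ∑' m, ∑ n ∈ s, wt (n - m) ^ σ * |p (n - m)| * (wt m ^ σ * |g m x|) :=
        (Summable.tsum_finsetSum fun n _ => hA n).symm
    _ ≤ ∑' m, P * (wt m ^ σ * |g m x|) := by
        refine Summable.tsum_le_tsum (fun m => ?_) (summable_sum fun n _ => hA n) (hw.mul_left P)
        rw [← Finset.sum_mul]
        refine mul_le_mul_of_nonneg_right ?_ (mul_nonneg (wt_rpow_nonneg _ _) (abs_nonneg _))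
        have h2 : Summable (fun n => wt (n - m) ^ σ * |p (n - m)|) :=
          (Equiv.subRight m).summable_iff.mpr hp
        refine (h2.sum_le_tsum s fun n _ => mul_nonneg (wt_rpow_nonneg _ _) (abs_nonneg _)).trans ?_
        exact ((Equiv.subRight m).tsum_eq (fun n => wt n ^ σ * |p n|)).le
    _ = P * ∑' m, wt m ^ σ * |g m x| := tsum_mul_left
    _ ≤ P * C := mul_le_mul_of_nonneg_left (hC x hx) hP0

lemma continuousOn_conv {X : Type*} [TopologicalSpace X] {S : Set X} {p : ℤ → ℝ}
    {g : ℤ → X → ℝ} {C : ℝ} (hp : Summable (fun n => |p n|)) (hc : ∀ m, ContinuousOn (g m) S)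
    (hb : ∀ m, ∀ x ∈ S, |g m x| ≤ C) (n : ℤ) :
    ContinuousOn (fun x => conv p (fun m => g m x) n) S := by
  refine _root_.continuousOn_tsum (fun m => continuousOn_const.mul (hc m))
    ((summable_shift hp n).mul_right C) fun m x hx => ?_
  rw [norm_mul, Real.norm_eq_abs, Real.norm_eq_abs]
  exact mul_le_mul_of_nonneg_left (hb m x hx) (abs_nonneg _)

lemma hasDerivAt_conv {S : Set ℝ} {p : ℤ → ℝ} {g g' : ℤ → ℝ → ℝ} {C D : ℝ}
    (hp : Summable (fun n => |p n|)) (hS : IsOpen S) (hS' : IsPreconnected S)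
    (hd : ∀ m, ∀ x ∈ S, HasDerivAt (g m) (g' m x) x)
    (hb : ∀ m, ∀ x ∈ S, |g m x| ≤ C) (hb' : ∀ m, ∀ x ∈ S, |g' m x| ≤ D) (n : ℤ) {x : ℝ}
    (hx : x ∈ S) :
    HasDerivAt (fun y => conv p (fun m => g m y) n) (conv p (fun m => g' m x) n) x := by
  refine hasDerivAt_tsum_of_isPreconnected (u := fun m => |p (n - m)| * D)
    ((summable_shift hp n).mul_right D) hS hS' (fun m y hy => (hd m y hy).const_mul _)
    (fun m y hy => ?_) hx (summable_conv_term hp (fun m => hb m x hx) n) hx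
  rw [norm_mul, Real.norm_eq_abs, Real.norm_eq_abs]
  exact mul_le_mul_of_nonneg_left (hb' m y hy) (abs_nonneg _)

lemma gamZ_sub (l : ℝ) (m n : ℤ) : gamZ l (m - n) = gamZ l m - gamZ l n := by
  simp only [gamZ, Int.cast_sub]; ring

lemma gamZ_neg (l : ℝ) (n : ℤ) : gamZ l (-n) = -gamZ l n := by
  simp only [gamZ, Int.cast_neg]; ring

lemma abs_gamZ_le {l : ℝ} (hl : 0 < l) (n : ℤ) : |gamZ l n| ≤ Real.pi / l * wt n := by
  have hp := Real.pi_pos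
  have : |gamZ l n| = Real.pi / l * |(n : ℝ)| := by
    simp only [gamZ, abs_div, abs_mul, abs_of_pos hp, abs_of_pos hl]; ring
  rw [this]
  refine mul_le_mul_of_nonneg_left ?_ (by positivity)
  unfold wt; linarith

lemma summable_mul_of_abs_le_one {q e : ℤ → ℝ} (hq : Summable (fun n => |q n|))
    (he : ∀ n, |e n| ≤ 1) : Summable (fun n => |q n * e n|) := by
  refine Summable.of_nonneg_of_le (fun n => abs_nonneg _) (fun n => ?_) hq
  rw [abs_mul]; exact mul_le_of_le_one_right (abs_nonneg _) (he n)

/-- The product of trigonometric series, in terms of the convolution of the coefficients. -/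
lemma hasSum_conv_mul_sin (l x : ℝ) {p q : ℤ → ℝ} (hp : Summable (fun n => |p n|))
    (hq : Summable (fun n => |q n|)) :
    HasSum (fun n => conv p q n * Real.sin (gamZ l n * x))
      ((∑' k, p k * Real.cos (gamZ l k * x)) * (∑' m, q m * Real.sin (gamZ l m * x)) +
       (∑' k, p k * Real.sin (gamZ l k * x)) * (∑' m, q m * Real.cos (gamZ l m * x))) := by
  have mk : ∀ a b : ℤ → ℝ, Summable (fun n => |a n|) → Summable (fun n => |b n|) →
      HasSum (fun z : ℤ × ℤ => a z.1 * b z.2) ((∑' k, a k) * ∑' m, b m) := fun a b ha hb =>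
    ha.of_abs.hasSum.mul hb.of_abs.hasSum
      (summable_mul_of_summable_norm (by simpa using ha) (by simpa using hb))
  have hs := fun (r : ℤ → ℝ) (hr : Summable fun n => |r n|) =>
    summable_mul_of_abs_le_one hr fun n => Real.abs_sin_le_one (gamZ l n * x)
  have hc := fun (r : ℤ → ℝ) (hr : Summable fun n => |r n|) =>
    summable_mul_of_abs_le_one hr fun n => Real.abs_cos_le_one (gamZ l n * x)
  have h1 := (mk _ _ (hc p hp) (hs q hq)).add (mk _ _ (hs p hp) (hc q hq))
  -- Reindexing the double sum over (k, m) by n = k + m makes the addition formula for sin collect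
  -- the n-th convolution coefficient on each fibre.
  let E : ℤ × ℤ ≃ ℤ × ℤ :=
    { toFun := fun z => (z.1 - z.2, z.2)
      invFun := fun z => (z.1 + z.2, z.2)
      left_inv := fun z => by simp
      right_inv := fun z => by simp }
  have h2 := E.hasSum_iff.mpr h1
  refine h2.prod_fiberwise fun n => ?_
  obtain ⟨C, hC⟩ : ∃ C, ∀ n, |q n| ≤ C :=
    ⟨_, fun n => hq.le_tsum n fun _ _ => abs_nonneg _⟩
  have h3 := (summable_conv_term hp hC n).hasSum.mul_right (Real.sin (gamZ l n * x))
  refine h3.congr_fun fun m => ?_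
  simp only [E, Function.comp, Equiv.coe_fn_mk]
  have e : gamZ l n * x = gamZ l (n - m) * x + gamZ l m * x := by rw [gamZ_sub]; ring
  rw [e, Real.sin_add]; ring

/-! ### Half-range Fourier coefficients -/

/-- The sine coefficient `∫_0^l g(x) sin(γ_n x) dx`. -/
def sinCoeff (l : ℝ) (g : ℝ → ℝ) (n : ℤ) : ℝ := ∫ x in (0 : ℝ)..l, g x * Real.sin (gamZ l n * x)

/-- The cosine coefficient `∫_0^l g(x) cos(γ_n x) dx`. -/
def cosCoeff (l : ℝ) (g : ℝ → ℝ) (n : ℤ) : ℝ := ∫ x in (0 : ℝ)..l, g x * Real.cos (gamZ l n * x)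

lemma fourier_apply_gamZ {l : ℝ} {T : ℝ} (hT : T = 2 * l) (n : ℤ) (x : ℝ) :
    (fourier n (x : AddCircle T) : ℂ) =
      (Real.cos (gamZ l n * x) : ℂ) + (Real.sin (gamZ l n * x) : ℂ) * Complex.I := by
  subst hT
  rw [fourier_coe_apply]
  have : 2 * (Real.pi : ℂ) * Complex.I * n * x / ((2 * l : ℝ) : ℂ) =
      ((gamZ l n * x : ℝ) : ℂ) * Complex.I := by
    simp only [gamZ]; push_cast
    rw [mul_assoc 2, mul_assoc 2, mul_assoc 2, mul_div_mul_left _ _ two_ne_zero]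
    ring
  rw [this, Complex.exp_mul_I, Complex.ofReal_cos, Complex.ofReal_sin]

/-- Extending g by zero to (-l, l) puts both half-range coefficients into one complex coefficient of
period 2l: cosine as real part, sine as minus the imaginary part. -/
lemma fourierCoeffOn_eq {l : ℝ} (hl : 0 < l) (hab : -l < l) {g : ℝ → ℝ}
    (hg : IntervalIntegrable g MeasureTheory.volume 0 l) (h0 : ∀ x, x ∉ Set.Ioo 0 l → g x = 0)
    (n : ℤ) : fourierCoeffOn hab (fun x => (g x : ℂ)) n =
      (1 / (2 * l) : ℝ) * ((cosCoeff l g n : ℂ) - (sinCoeff l g n : ℂ) * Complex.I) := by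
  rw [fourierCoeffOn_eq_integral]
  have hT : l - -l = 2 * l := by ring
  have h1 : ∀ x : ℝ, (fourier (-n) (x : AddCircle (l - -l)) : ℂ) • (g x : ℂ) =
      ((g x * Real.cos (gamZ l n * x) : ℝ) : ℂ) -
        ((g x * Real.sin (gamZ l n * x) : ℝ) : ℂ) * Complex.I := by
    intro x
    rw [fourier_apply_gamZ hT, gamZ_neg, neg_mul, Real.cos_neg, Real.sin_neg, smul_eq_mul]
    push_cast; ring
  simp_rw [h1]
  have hz : ∀ x ∈ Set.uIcc (-l) 0, ((g x * Real.cos (gamZ l n * x) : ℝ) : ℂ) -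
        ((g x * Real.sin (gamZ l n * x) : ℝ) : ℂ) * Complex.I = 0 := by
    intro x hx
    rw [Set.uIcc_of_le (by linarith)] at hx
    rw [h0 x (fun h => by have := h.1; have := hx.2; linarith)]
    simp
  have hc : IntervalIntegrable (fun x => g x * Real.cos (gamZ l n * x)) MeasureTheory.volume 0 l :=
    hg.mul_continuousOn (by fun_prop)
  have hs : IntervalIntegrable (fun x => g x * Real.sin (gamZ l n * x)) MeasureTheory.volume 0 l :=
    hg.mul_continuousOn (by fun_prop)
  have hc' : IntervalIntegrable (fun x => ((g x * Real.cos (gamZ l n * x) : ℝ) : ℂ))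
    MeasureTheory.volume 0 l := ⟨hc.1.ofReal, hc.2.ofReal⟩
  have hs' : IntervalIntegrable (fun x => ((g x * Real.sin (gamZ l n * x) : ℝ) : ℂ) * Complex.I)
    MeasureTheory.volume 0 l := ⟨hs.1.ofReal.mul_const _, hs.2.ofReal.mul_const _⟩
  have e0 := intervalIntegral.integral_congr (μ := MeasureTheory.volume) hz
  have i0 : IntervalIntegrable (fun x => ((g x * Real.cos (gamZ l n * x) : ℝ) : ℂ) -
        ((g x * Real.sin (gamZ l n * x) : ℝ) : ℂ) * Complex.I) MeasureTheory.volume (-l) 0 :=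
    (IntervalIntegrable.zero (μ := MeasureTheory.volume) (a := -l) (b := 0) (E := ℂ)).congr
      (fun x hx => (hz x (Set.uIoc_subset_uIcc hx)).symm)
  rw [← intervalIntegral.integral_add_adjacent_intervals i0 (hc'.sub hs'), e0,
    intervalIntegral.integral_sub hc' hs', intervalIntegral.integral_mul_const,
    intervalIntegral.integral_ofReal, intervalIntegral.integral_ofReal]
  simp only [intervalIntegral.integral_zero, zero_add, hT]
  rfl

/-- Bessel's inequality for the sine and cosine coefficients together. -/
lemma sum_sq_coeff_le {l K : ℝ} (hl : 0 < l) {h : ℝ → ℝ} (hc : ContinuousOn h (Set.Ioo 0 l))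
    (hK : ∀ x ∈ Set.Ioo 0 l, |h x| ≤ K) (s : Finset ℤ) :
    ∑ n ∈ s, (cosCoeff l h n ^ 2 + sinCoeff l h n ^ 2) ≤ 2 * l ^ 2 * K ^ 2 := by
  -- Nothing is known about h outside the open interval, and the coefficients do not see it there;
  -- the zero extension is bounded and measurable on the whole line.
  set g : ℝ → ℝ := (Set.Ioo 0 l).indicator h with hgdef
  have hmeas : MeasureTheory.AEStronglyMeasurable g MeasureTheory.volume :=
    (aestronglyMeasurable_indicator_iff measurableSet_Ioo).mpr
      (hc.aestronglyMeasurable measurableSet_Ioo)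
  have hgK : ∀ x, |g x| ≤ |K| := by
    intro x
    by_cases hx : x ∈ Set.Ioo 0 l
    · rw [hgdef, Set.indicator_of_mem hx]; exact (hK x hx).trans (le_abs_self K)
    · rw [hgdef, Set.indicator_of_notMem hx]; simp
  have hgi : IntervalIntegrable g MeasureTheory.volume 0 l := by
    rw [intervalIntegrable_iff_integrableOn_Ioc_of_le hl.le]
    exact MeasureTheory.Measure.integrableOn_of_bounded (M := |K|) (by simp) hmeas
      (Eventually.of_forall hgK)
  have h0 : ∀ x, x ∉ Set.Ioo 0 l → g x = 0 := fun x hx => Set.indicator_of_notMem hx h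
  have hco : ∀ n, cosCoeff l h n = cosCoeff l g n := fun n =>
    intervalIntegral.integral_congr_Ioo_of_le hl.le fun x hx => by
      simp only [hgdef, Set.indicator_of_mem hx]
  have hsi : ∀ n, sinCoeff l h n = sinCoeff l g n := fun n =>
    intervalIntegral.integral_congr_Ioo_of_le hl.le fun x hx => by
      simp only [hgdef, Set.indicator_of_mem hx]
  have hab : -l < l := by linarith
  have hL2 : MeasureTheory.MemLp (fun x => (g x : ℂ)) 2
      (MeasureTheory.volume.restrict (Set.Ioc (-l) l)) := by
    refine MeasureTheory.MemLp.of_bound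
      (Complex.continuous_ofReal.comp_aestronglyMeasurable hmeas.restrict) |K|
      (Eventually.of_forall fun x => ?_)
    simpa using hgK x
  have hB := hasSum_sq_fourierCoeffOn hab hL2
  have h1 := sum_le_hasSum s (fun n _ => by positivity) hB
  have h2 : ∀ n, ‖fourierCoeffOn hab (fun x => (g x : ℂ)) n‖ ^ 2 =
      (1 / (2 * l)) ^ 2 * (cosCoeff l g n ^ 2 + sinCoeff l g n ^ 2) := by
    intro n
    rw [fourierCoeffOn_eq hl hab hgi h0, ← Complex.normSq_eq_norm_sq, Complex.normSq_mul,
      Complex.normSq_ofReal, Complex.normSq_apply]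
    simp; ring
  simp_rw [h2] at h1
  rw [← Finset.mul_sum] at h1
  have h3 : ∫ x in (-l)..l, ‖(g x : ℂ)‖ ^ 2 ≤ l * K ^ 2 := by
    have hsplit : ∫ x in (-l)..l, ‖(g x : ℂ)‖ ^ 2 =
        ∫ x in Set.Ioo 0 l, ‖(g x : ℂ)‖ ^ 2 := by
      rw [intervalIntegral.integral_of_le hab.le,
        ← MeasureTheory.integral_indicator measurableSet_Ioc,
        ← MeasureTheory.integral_indicator measurableSet_Ioo]
      congr 1; ext x
      by_cases hx : x ∈ Set.Ioo 0 l
      · rw [Set.indicator_of_mem hx, Set.indicator_of_mem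
          (show x ∈ Set.Ioc (-l) l from ⟨by linarith [hx.1], hx.2.le⟩)]
      · rw [Set.indicator_of_notMem hx]
        by_cases hx' : x ∈ Set.Ioc (-l) l
        · rw [Set.indicator_of_mem hx', h0 x hx]; simp
        · rw [Set.indicator_of_notMem hx']
    rw [hsplit]
    have := MeasureTheory.norm_setIntegral_le_of_norm_le_const (μ := MeasureTheory.volume)
      (s := Set.Ioo 0 l) (f := fun x => ‖(g x : ℂ)‖ ^ 2) (C := K ^ 2) (by simp)
      (fun x _ => by
        rw [norm_pow, norm_norm, Complex.norm_real, Real.norm_eq_abs, ← sq_abs K]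
        exact pow_le_pow_left₀ (abs_nonneg _) (hgK x) 2)
    refine (le_abs_self _).trans (this.trans_eq ?_)
    rw [MeasureTheory.measureReal_def, Real.volume_Ioo, sub_zero, ENNReal.toReal_ofReal hl.le]
    ring
  have h4 : (l - -l)⁻¹ • ∫ x in (-l)..l, ‖(g x : ℂ)‖ ^ 2 ≤ (l - -l)⁻¹ * (l * K ^ 2) :=
    mul_le_mul_of_nonneg_left h3 (by rw [inv_nonneg]; linarith)
  have h5 := h1.trans h4
  simp_rw [hco, hsi]
  have e : (l - -l)⁻¹ * (l * K ^ 2) = (1 / (2 * l)) ^ 2 * (2 * l ^ 2 * K ^ 2) := by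
    field_simp; ring
  rw [e] at h5
  exact le_of_mul_le_mul_left h5 (by positivity)

/-- Pointwise convergence of the half-range sine and cosine series. -/
lemma hasSum_half_range {l : ℝ} (hl : 0 < l) {g : ℝ → ℝ} (hg : Continuous g)
    (h0 : ∀ x, x ∉ Set.Ioo 0 l → g x = 0) (hC : Summable (fun n => cosCoeff l g n))
    (hS : Summable (fun n => sinCoeff l g n)) {x : ℝ} (hx : x ∈ Set.Ioo 0 l) :
    HasSum (fun n => cosCoeff l g n * Real.cos (gamZ l n * x)) (l * g x) ∧
    HasSum (fun n => sinCoeff l g n * Real.sin (gamZ l n * x)) (l * g x) := by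
  have : Fact (0 < 2 * l) := ⟨by linarith⟩
  have hab : -l < l := by linarith
  have e1 : -l + 2 * l = l := by ring
  -- The zero extension takes the value 0 at both ends of [-l, l], so it closes up to a continuous
  -- function on the circle.
  let G : C(AddCircle (2 * l), ℂ) := ⟨AddCircle.liftIco (2 * l) (-l) (fun x => (g x : ℂ)),
    AddCircle.liftIco_continuous (by
      rw [e1, h0 (-l) (fun h => by linarith [h.1]), h0 l (fun h => lt_irrefl _ h.2)])
      (by fun_prop)⟩
  have hcoef : ∀ n, fourierCoeff G n =
      (1 / (2 * l) : ℝ) * ((cosCoeff l g n : ℂ) - (sinCoeff l g n : ℂ) * Complex.I) := by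
    intro n
    have := fourierCoeff_liftIco_eq (T := 2 * l) (a := -l) (fun x => (g x : ℂ)) n
    refine this.trans ?_
    rw [← fourierCoeffOn_eq hl hab (hg.intervalIntegrable _ _) h0]
    congr 1
  have hsum : Summable (fourierCoeff G) := by
    have : Summable (fun n => ((1 / (2 * l) : ℝ) : ℂ) *
        ((cosCoeff l g n : ℂ) - (sinCoeff l g n : ℂ) * Complex.I)) := by
      refine Summable.mul_left _ (Summable.sub ?_ (Summable.mul_right _ ?_))
      · exact_mod_cast hC
      · exact_mod_cast hS
    exact this.congr fun n => (hcoef n).symm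
  have key : ∀ y ∈ Set.Ico (-l) l, HasSum (fun n => (1 / (2 * l)) *
      (cosCoeff l g n * Real.cos (gamZ l n * y) + sinCoeff l g n * Real.sin (gamZ l n * y)))
      (g y) := by
    intro y hy
    have h1 := has_pointwise_sum_fourier_series_of_summable hsum (y : AddCircle (2 * l))
    have h2 : G (y : AddCircle (2 * l)) = (g y : ℂ) :=
      AddCircle.liftIco_coe_apply (f := fun x => (g x : ℂ)) (by rwa [e1])
    rw [h2] at h1
    have h3 := Complex.hasSum_re h1
    refine h3.congr_fun fun n => ?_
    rw [hcoef, smul_eq_mul, fourier_apply_gamZ rfl, mul_assoc, Complex.re_ofReal_mul]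
    simp only [Complex.mul_re, Complex.mul_im, Complex.sub_re, Complex.sub_im, Complex.add_re,
      Complex.add_im, Complex.ofReal_re, Complex.ofReal_im, Complex.I_re, Complex.I_im]
    ring
  -- The full series sums to g(x) at x and to 0 at -x. Sum and difference of the two isolate the
  -- cosine and the sine part, each carrying the whole of g(x).
  have k1 := key x ⟨by linarith [hx.1], hx.2⟩
  have k2 := key (-x) ⟨by linarith [hx.2], by linarith [hx.1]⟩
  rw [h0 (-x) (fun h => by linarith [h.1, hx.1])] at k2
  simp only [mul_neg, Real.cos_neg, Real.sin_neg] at k2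
  have hl' : l ≠ 0 := hl.ne'
  constructor
  · have := (k1.add k2).mul_left l
    rw [add_zero] at this
    refine this.congr_fun fun n => ?_
    field_simp; ring
  · have := (k1.sub k2).mul_left l
    rw [sub_zero] at this
    refine this.congr_fun fun n => ?_
    field_simp; ring

/-- Integration by parts; the boundary terms vanish with g. -/
lemma gamZ_mul_sinCoeff {l : ℝ} {g g' : ℝ → ℝ} (hg : ∀ x, HasDerivAt g (g' x) x)
    (hg' : Continuous g') (h0 : g 0 = 0) (hl : g l = 0) (n : ℤ) :
    gamZ l n * sinCoeff l g n = cosCoeff l g' n := by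
  have := intervalIntegral.integral_mul_deriv_eq_deriv_mul (a := 0) (b := l)
    (u := g) (u' := g') (v := fun x => Real.cos (gamZ l n * x))
    (v' := fun x => -Real.sin (gamZ l n * x) * (gamZ l n)) (fun x _ => hg x)
    (fun x _ => by simpa using ((hasDerivAt_id x).const_mul (gamZ l n)).cos)
    (hg'.intervalIntegrable _ _) ((by fun_prop : Continuous _).intervalIntegrable _ _)
  rw [h0, hl] at this
  have e : ∀ x, g x * (-Real.sin (gamZ l n * x) * gamZ l n) =
    -(gamZ l n * (g x * Real.sin (gamZ l n * x))) := fun x => by ring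
  simp_rw [e] at this
  rw [intervalIntegral.integral_neg, intervalIntegral.integral_const_mul] at this
  unfold sinCoeff cosCoeff
  linarith

lemma gamZ_mul_cosCoeff {l : ℝ} {g g' : ℝ → ℝ} (hg : ∀ x, HasDerivAt g (g' x) x)
    (hg' : Continuous g') (h0 : g 0 = 0) (hl : g l = 0) (n : ℤ) :
    gamZ l n * cosCoeff l g n = -sinCoeff l g' n := by
  have := intervalIntegral.integral_mul_deriv_eq_deriv_mul (a := 0) (b := l)
    (u := g) (u' := g') (v := fun x => Real.sin (gamZ l n * x))
    (v' := fun x => Real.cos (gamZ l n * x) * (gamZ l n)) (fun x _ => hg x)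
    (fun x _ => by simpa using ((hasDerivAt_id x).const_mul (gamZ l n)).sin)
    (hg'.intervalIntegrable _ _) ((by fun_prop : Continuous _).intervalIntegrable _ _)
  rw [h0, hl] at this
  have e : ∀ x, g x * (Real.cos (gamZ l n * x) * gamZ l n) =
    (gamZ l n * (g x * Real.cos (gamZ l n * x))) := fun x => by ring
  simp_rw [e] at this
  rw [intervalIntegral.integral_const_mul] at this
  unfold sinCoeff cosCoeff
  linarith

lemma abs_coeff_le {l K : ℝ} (hl : 0 < l) {g : ℝ → ℝ} (hK : ∀ x ∈ Set.Ioo 0 l, |g x| ≤ K)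
    (n : ℤ) : |cosCoeff l g n| ≤ K * l ∧ |sinCoeff l g n| ≤ K * l := by
  have key : ∀ e : ℝ → ℝ, (∀ x, |e x| ≤ 1) → |∫ x in (0 : ℝ)..l, g x * e x| ≤ K * l := by
    intro e he
    rw [intervalIntegral.integral_of_le hl.le, MeasureTheory.integral_Ioc_eq_integral_Ioo]
    have := MeasureTheory.norm_setIntegral_le_of_norm_le_const (μ := MeasureTheory.volume)
      (s := Set.Ioo 0 l) (f := fun x => g x * e x) (C := K) (by simp)
      (fun x hx => by
        rw [norm_mul, Real.norm_eq_abs, Real.norm_eq_abs]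
        exact (mul_le_of_le_one_right (abs_nonneg _) (he x)).trans (hK x hx))
    rwa [MeasureTheory.measureReal_def, Real.volume_Ioo, sub_zero, ENNReal.toReal_ofReal hl.le]
      at this
  exact ⟨key _ fun x => Real.abs_cos_le_one _, key _ fun x => Real.abs_sin_le_one _⟩

/-- Each integration by parts trades a factor γ_n for a derivative of ψ and swaps sine and cosine,
so the induction must carry both. All derivatives of ψ keep support inside (0, l), which removes
every boundary term. -/
lemma exists_gamZ_pow_mul_coeff_le {l : ℝ} (hl : 0 < l) (N : ℕ) :
    ∀ ψ : ℝ → ℝ, ContDiff ℝ (⊤ : ℕ∞) ψ → tsupport ψ ⊆ Set.Ioo 0 l →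
    ∃ C, ∀ n, |gamZ l n| ^ N * |cosCoeff l ψ n| ≤ C ∧ |gamZ l n| ^ N * |sinCoeff l ψ n| ≤ C := by
  induction N with
  | zero =>
    intro ψ hψ _
    obtain ⟨K, hK⟩ := isCompact_Icc.exists_bound_of_continuousOn (s := Set.Icc 0 l)
      hψ.continuous.continuousOn
    refine ⟨K * l, fun n => ?_⟩
    simpa using abs_coeff_le hl (fun x hx => hK x (Set.Ioo_subset_Icc_self hx)) n
  | succ N ih =>
    intro ψ hψ hs
    have hd : ContDiff ℝ (⊤ : ℕ∞) (deriv ψ) := (contDiff_infty_iff_deriv.mp hψ).2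
    obtain ⟨C, hC⟩ := ih (deriv ψ) hd (tsupport_deriv_subset.trans hs)
    have hz : ∀ x, x ∉ Set.Ioo 0 l → ψ x = 0 := fun x hx =>
      image_eq_zero_of_notMem_tsupport fun h => hx (hs h)
    have hD : ∀ x, HasDerivAt ψ (deriv ψ x) x := fun x =>
      (hψ.differentiable (by simp)).differentiableAt.hasDerivAt
    have z0 := hz 0 fun h => lt_irrefl _ h.1
    have zl := hz l fun h => lt_irrefl _ h.2
    refine ⟨C, fun n => ⟨?_, ?_⟩⟩
    · rw [pow_succ, mul_assoc, ← abs_mul, gamZ_mul_cosCoeff hD hd.continuous z0 zl, abs_neg]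
      exact (hC n).2
    · rw [pow_succ, mul_assoc, ← abs_mul, gamZ_mul_sinCoeff hD hd.continuous z0 zl]
      exact (hC n).1

lemma wt_le_add_gamZ {l : ℝ} (hl : 0 < l) (n : ℤ) :
    wt n = 1 + l / Real.pi * |gamZ l n| := by
  have hp := Real.pi_pos
  have : |gamZ l n| = Real.pi / l * |(n : ℝ)| := by
    simp only [gamZ, abs_div, abs_mul, abs_of_pos hp, abs_of_pos hl]; ring
  rw [this]; unfold wt; field_simp

/-- Fourth order decay suffices: the cutoff series will be differentiated twice and must stay
summable with some weight left, which needs an exponent above 3. -/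
lemma exists_cosCoeff_decay {l : ℝ} (hl : 0 < l) {ψ : ℝ → ℝ} (hψ : ContDiff ℝ (⊤ : ℕ∞) ψ)
    (hs : tsupport ψ ⊆ Set.Ioo 0 l) :
    ∃ C, 0 ≤ C ∧ ∀ n, |cosCoeff l ψ n| ≤ C * wt n ^ (-4 : ℝ) ∧
      |sinCoeff l ψ n| ≤ C * wt n ^ (-4 : ℝ) := by
  obtain ⟨C, hC⟩ := exists_gamZ_pow_mul_coeff_le hl 4 ψ hψ hs
  obtain ⟨D, hD⟩ := exists_gamZ_pow_mul_coeff_le hl 0 ψ hψ hs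
  have hC0 : 0 ≤ C := le_trans (by positivity) (hC 0).1
  have hD0 : 0 ≤ D := le_trans (by positivity) (hD 0).1
  have hp := Real.pi_pos
  refine ⟨8 * (D + (l / Real.pi) ^ 4 * C), by positivity, fun n => ?_⟩
  -- (1 + a)⁴ ≤ 8(1 + a⁴), the power mean inequality.
  have h4 : wt n ^ 4 ≤ 8 * (1 + (l / Real.pi) ^ 4 * |gamZ l n| ^ 4) := by
    rw [wt_le_add_gamZ hl n]
    set a := l / Real.pi * |gamZ l n| with ha
    have : 0 ≤ a := by positivity
    have e : (l / Real.pi) ^ 4 * |gamZ l n| ^ 4 = a ^ 4 := by rw [ha, mul_pow]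
    rw [e]
    nlinarith [sq_nonneg (a - 1), sq_nonneg (a ^ 2 - 1), sq_nonneg (a ^ 2 - a)]
  have key : ∀ c : ℝ, |gamZ l n| ^ 4 * |c| ≤ C → |gamZ l n| ^ 0 * |c| ≤ D →
      |c| ≤ 8 * (D + (l / Real.pi) ^ 4 * C) * wt n ^ (-4 : ℝ) := by
    intro c h1 h2
    rw [pow_zero, one_mul] at h2
    have e : wt n ^ (-4 : ℝ) = (wt n ^ 4)⁻¹ := by
      rw [Real.rpow_neg (wt_pos n).le]; norm_cast
    have hw : 0 < wt n ^ 4 := pow_pos (wt_pos n) 4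
    rw [e, ← div_eq_mul_inv, le_div_iff₀ hw]
    have h5 : 0 ≤ (l / Real.pi) ^ 4 := by positivity
    calc |c| * wt n ^ 4 ≤ |c| * (8 * (1 + (l / Real.pi) ^ 4 * |gamZ l n| ^ 4)) :=
          mul_le_mul_of_nonneg_left h4 (abs_nonneg c)
      _ = 8 * (|c| + (l / Real.pi) ^ 4 * (|gamZ l n| ^ 4 * |c|)) := by ring
      _ ≤ _ := by
          have := mul_le_mul_of_nonneg_left h1 h5
          linarith
  exact ⟨key _ (hC n).1 (hD n).1, key _ (hC n).2 (hD n).2⟩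

/-- A bounded family of `C¹` functions that vanish outside `(0,l)` has sine and cosine
coefficients that are uniformly summable, with a weight to spare. -/
lemma weightedBdd_coeff {X : Type*} {S : Set X} {l K : ℝ} (hl : 0 < l) {g g' : X → ℝ → ℝ}
    (hg : ∀ p ∈ S, ∀ x, HasDerivAt (g p) (g' p x) x) (hg' : ∀ p ∈ S, Continuous (g' p))
    (h0 : ∀ p ∈ S, g p 0 = 0 ∧ g p l = 0) (hK : ∀ p ∈ S, ∀ x ∈ Set.Ioo 0 l, |g p x| ≤ K)
    (hK' : ∀ p ∈ S, ∀ x ∈ Set.Ioo 0 l, |g' p x| ≤ K) :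
    WeightedBdd (1 / 4) (fun n p => cosCoeff l (g p) n) S ∧
    WeightedBdd (1 / 4) (fun n p => sinCoeff l (g p) n) S := by
  have hb : ∀ p ∈ S, ∀ s : Finset ℤ, ∑ n ∈ s,
      2 * (cosCoeff l (g p) n ^ 2 + sinCoeff l (g p) n ^ 2 + (l / Real.pi) ^ 2 *
        (cosCoeff l (g' p) n ^ 2 + sinCoeff l (g' p) n ^ 2)) ≤
      2 * (2 * l ^ 2 * K ^ 2 + (l / Real.pi) ^ 2 * (2 * l ^ 2 * K ^ 2)) := by
    intro p hp s
    have hcont : Continuous (g p) :=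
      continuous_iff_continuousAt.mpr fun x => (hg p hp x).continuousAt
    have h1 := sum_sq_coeff_le hl hcont.continuousOn (hK p hp) s
    have h2 := sum_sq_coeff_le hl (hg' p hp).continuousOn (hK' p hp) s
    rw [← Finset.mul_sum, Finset.sum_add_distrib, ← Finset.mul_sum]
    have : 0 ≤ (l / Real.pi) ^ 2 := by positivity
    have := mul_le_mul_of_nonneg_left h2 this
    linarith
  -- Bessel's inequality for g and g' bounds the coefficients in ℓ² with weight 1. Passing to ℓ¹
  -- loses slightly more than 1/2, which leaves room for 1/4.
  have aux : ∀ n (c d : ℝ), (gamZ l n * c) ^ 2 = d ^ 2 →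
      (wt n ^ (1 : ℝ) * |c|) ^ 2 ≤ 2 * (c ^ 2 + (l / Real.pi) ^ 2 * d ^ 2) := by
    intro n c d h
    rw [Real.rpow_one, mul_pow, sq_abs, wt_le_add_gamZ hl n, ← h, mul_pow, ← sq_abs (gamZ l n)]
    have : (1 + l / Real.pi * |gamZ l n|) ^ 2 ≤ 2 * (1 + (l / Real.pi) ^ 2 * |gamZ l n| ^ 2) := by
      nlinarith [sq_nonneg (1 - l / Real.pi * |gamZ l n|)]
    nlinarith [mul_le_mul_of_nonneg_right this (sq_nonneg c)]
  constructor
  · refine WeightedBdd.of_sq (τ := 1) (by norm_num) fun p hp s =>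
      (Finset.sum_le_sum fun n _ => ?_).trans (hb p hp s)
    refine (aux n _ (sinCoeff l (g' p) n) ?_).trans ?_
    · rw [gamZ_mul_cosCoeff (hg p hp) (hg' p hp) (h0 p hp).1 (h0 p hp).2, neg_sq]
    · nlinarith [sq_nonneg (sinCoeff l (g p) n), mul_nonneg (sq_nonneg (l / Real.pi))
        (sq_nonneg (cosCoeff l (g' p) n))]
  · refine WeightedBdd.of_sq (τ := 1) (by norm_num) fun p hp s =>
      (Finset.sum_le_sum fun n _ => ?_).trans (hb p hp s)
    refine (aux n _ (cosCoeff l (g' p) n) ?_).trans ?_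
    · rw [gamZ_mul_sinCoeff (hg p hp) (hg' p hp) (h0 p hp).1 (h0 p hp).2]
    · nlinarith [sq_nonneg (cosCoeff l (g p) n), mul_nonneg (sq_nonneg (l / Real.pi))
        (sq_nonneg (sinCoeff l (g' p) n))]

/-! ### The damped oscillator kernels and their decay -/

/-- `sinh(√D t)/√D`, continued analytically to `D ≤ 0`. -/
def hypS (D t : ℝ) : ℝ :=
  if 0 < D then Real.sinh (√D * t) / √D else if D < 0 then Real.sin (√(-D) * t) / √(-D) else t

/-- `cosh(√D t)`, continued analytically to `D ≤ 0`. -/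
def hypC (D t : ℝ) : ℝ :=
  if 0 < D then Real.cosh (√D * t) else if D < 0 then Real.cos (√(-D) * t) else 1

lemma hypS_zero (D : ℝ) : hypS D 0 = 0 := by simp [hypS]

lemma hypC_zero (D : ℝ) : hypC D 0 = 1 := by simp [hypC]

lemma hasDerivAt_hypS (D t : ℝ) : HasDerivAt (hypS D) (hypC D t) t := by
  unfold hypS hypC
  rcases lt_trichotomy 0 D with h | h | h
  · have hs : √D ≠ 0 := (Real.sqrt_pos.mpr h).ne'
    simp only [h, if_true]
    refine ((((hasDerivAt_id t).const_mul (√D)).sinh).div_const (√D)).congr_deriv ?_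
    simp [hs]
  · subst h; simpa using hasDerivAt_id' t
  · have hs : √(-D) ≠ 0 := (Real.sqrt_pos.mpr (by linarith)).ne'
    simp only [h, not_lt.mpr h.le, if_true, if_false]
    refine ((((hasDerivAt_id t).const_mul (√(-D))).sin).div_const (√(-D))).congr_deriv ?_
    simp [hs]

lemma hasDerivAt_hypC (D t : ℝ) : HasDerivAt (hypC D) (D * hypS D t) t := by
  unfold hypS hypC
  rcases lt_trichotomy 0 D with h | h | h
  · have hs : √D ≠ 0 := (Real.sqrt_pos.mpr h).ne'
    simp only [h, if_true]
    refine (((hasDerivAt_id t).const_mul (√D)).cosh).congr_deriv ?_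
    have := Real.mul_self_sqrt h.le
    simp only [id]
    field_simp
    rw [← this]; ring_nf
    simp
  · subst h; simpa using hasDerivAt_const t (1 : ℝ)
  · have hs : √(-D) ≠ 0 := (Real.sqrt_pos.mpr (by linarith)).ne'
    simp only [h, not_lt.mpr h.le, if_true, if_false]
    refine (((hasDerivAt_id t).const_mul (√(-D))).cos).congr_deriv ?_
    have := Real.mul_self_sqrt (show 0 ≤ -D by linarith)
    simp only [id]
    field_simp
    linear_combination -(Real.sin (√(-D) * t)) * this

/-- For D > 0 use sinh y ≤ y e^y, which is 1 - 2y ≤ e^{-2y}; for D < 0 use |sin y| ≤ y and |cos y| ≤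
1. The factor t in place of 1/√D keeps the bound uniform as the two characteristic roots collide. -/
lemma abs_hypS_hypC_le {D ω t : ℝ} (hω : 0 ≤ ω) (hD : D ≤ ω ^ 2) (ht : 0 ≤ t) :
    |hypS D t| ≤ t * Real.exp (ω * t) ∧ |hypC D t| ≤ Real.exp (ω * t) := by
  have h1 : 1 ≤ Real.exp (ω * t) := Real.one_le_exp (by positivity)
  unfold hypS hypC
  rcases lt_trichotomy 0 D with h | h | h
  · simp only [h, if_true]
    have hs : 0 < √D := Real.sqrt_pos.mpr h
    have hle : √D ≤ ω := by
      rw [show ω = √(ω ^ 2) by rw [Real.sqrt_sq hω]]; exact Real.sqrt_le_sqrt hD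
    set y := √D * t with hy
    have hy0 : 0 ≤ y := by positivity
    have hexp : Real.exp y ≤ Real.exp (ω * t) :=
      Real.exp_le_exp.mpr (mul_le_mul_of_nonneg_right hle ht)
    have hpos : 0 < Real.exp y := Real.exp_pos y
    have hneg : Real.exp (-y) ≤ 1 := Real.exp_le_one_iff.mpr (by linarith)
    have hneg0 : 0 < Real.exp (-y) := Real.exp_pos _
    constructor
    · rw [abs_div, abs_of_pos hs, div_le_iff₀ hs, abs_of_nonneg (Real.sinh_nonneg_iff.mpr hy0),
        Real.sinh_eq]
      have h2 : 1 - 2 * y ≤ Real.exp (-y) * Real.exp (-y) := by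
        rw [← Real.exp_add]
        have := Real.add_one_le_exp (-y + -y)
        linarith
      have h3 : Real.exp (-y) * Real.exp y = 1 := by rw [← Real.exp_add]; simp
      have h4 : Real.exp y - Real.exp (-y) ≤ 2 * y * Real.exp y := by
        have := mul_le_mul_of_nonneg_right h2 hpos.le
        rw [mul_assoc, h3] at this
        linarith
      have h5 : y * Real.exp y ≤ y * Real.exp (ω * t) := mul_le_mul_of_nonneg_left hexp hy0
      have h6 : t * Real.exp (ω * t) * √D = y * Real.exp (ω * t) := by rw [hy]; ring
      linarith
    · rw [abs_of_pos (Real.cosh_pos y), Real.cosh_eq]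
      have := Real.one_le_exp hy0
      linarith
  · subst h
    simp only [lt_irrefl, if_false, abs_one, abs_of_nonneg ht]
    exact ⟨le_mul_of_one_le_right ht h1, h1⟩
  · simp only [h, not_lt.mpr h.le, if_true, if_false]
    have hs : 0 < √(-D) := Real.sqrt_pos.mpr (by linarith)
    constructor
    · rw [abs_div, abs_of_pos hs, div_le_iff₀ hs]
      refine Real.abs_sin_le_abs.trans ?_
      rw [abs_of_nonneg (by positivity)]
      nlinarith [mul_nonneg (mul_nonneg hs.le ht) (sub_nonneg.mpr h1)]
    · exact (Real.abs_cos_le_one _).trans h1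

/-- The time derivative `G_n'`. -/
def dGn (α ε lam l : ℝ) (n : ℕ) (t : ℝ) : ℝ :=
  Real.exp (-(gn α ε lam l n) * t) *
    (hypC (disc α ε lam l n) t - gn α ε lam l n * hypS (disc α ε lam l n) t)

lemma Gn_eq (α ε lam l : ℝ) (n : ℕ) (t : ℝ) :
    Gn α ε lam l n t = Real.exp (-(gn α ε lam l n) * t) * hypS (disc α ε lam l n) t := rfl

lemma hasDerivAt_exp_mul (c t : ℝ) :
    HasDerivAt (fun t => Real.exp (c * t)) (c * Real.exp (c * t)) t := by
  simpa [mul_comm] using ((hasDerivAt_id t).const_mul c).exp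

lemma hasDerivAt_Gn (α ε lam l : ℝ) (n : ℕ) (t : ℝ) :
    HasDerivAt (Gn α ε lam l n) (dGn α ε lam l n t) t := by
  refine ((hasDerivAt_exp_mul (-(gn α ε lam l n)) t).mul
    (hasDerivAt_hypS (disc α ε lam l n) t)).congr_deriv ?_
  unfold dGn; ring

/-- The oscillator equation G'' + 2gG' + bG = 0, in the sign-independent form ω² = g² - b. -/
lemma hasDerivAt_dGn (α ε lam l : ℝ) (n : ℕ) (t : ℝ) :
    HasDerivAt (dGn α ε lam l n)
      (-(2 * gn α ε lam l n) * dGn α ε lam l n t - bn lam l n * Gn α ε lam l n t) t := by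
  refine ((hasDerivAt_exp_mul (-(gn α ε lam l n)) t).mul
    ((hasDerivAt_hypC (disc α ε lam l n) t).sub
      ((hasDerivAt_hypS (disc α ε lam l n) t).const_mul (gn α ε lam l n)))).congr_deriv ?_
  rw [Gn_eq, dGn]
  have : bn lam l n = gn α ε lam l n ^ 2 - disc α ε lam l n := by unfold disc; ring
  rw [this]; simp only [Pi.sub_apply]; ring

lemma Gn_zero (α ε lam l : ℝ) (n : ℕ) : Gn α ε lam l n 0 = 0 := by rw [Gn_eq, hypS_zero, mul_zero]

lemma dGn_zero (α ε lam l : ℝ) (n : ℕ) : dGn α ε lam l n 0 = 1 := by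
  rw [dGn, hypS_zero, hypC_zero]; simp

lemma le_bn (lam l : ℝ) (n : ℕ) : lam ^ 2 / 4 ≤ bn lam l n := by
  unfold bn; nlinarith [sq_nonneg (gam l n)]

/-- Half of the decay rate is spent on absorbing the factor t. -/
lemma mul_exp_neg_le {r t : ℝ} (hr : 0 < r) :
    t * Real.exp (-r * t) ≤ 2 / r * Real.exp (-(r / 2) * t) := by
  have h1 : Real.exp (-r * t) = Real.exp (-(r / 2) * t) * Real.exp (-(r / 2) * t) := by
    rw [← Real.exp_add]; congr 1; ring
  have h2 : r / 2 * t * Real.exp (-(r / 2) * t) ≤ 1 := by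
    have := Real.add_one_le_exp (r / 2 * t)
    have h3 : Real.exp (-(r / 2) * t) * Real.exp (r / 2 * t) = 1 := by
      rw [← Real.exp_add]; simp
    have := mul_le_mul_of_nonneg_left this (Real.exp_pos (-(r / 2) * t)).le
    nlinarith [Real.exp_pos (-(r / 2) * t)]
  have h4 := mul_le_mul_of_nonneg_right h2 (Real.exp_pos (-(r / 2) * t)).le
  rw [h1]
  have e : t * (Real.exp (-(r / 2) * t) * Real.exp (-(r / 2) * t)) =
      2 / r * (r / 2 * t * Real.exp (-(r / 2) * t) * Real.exp (-(r / 2) * t)) := by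
    field_simp
  rw [e]
  exact mul_le_mul_of_nonneg_left (by linarith) (by positivity)

/-- A spectral gap uniform in n: the slower root g - ω stays above r. It is enough that 2gr ≤ b,
i.e. r ≤ b/(α + εb); the right side increases with b, so b = λ²/4 is the worst case. The bound r ≤
α/2 gives r ≤ g. -/
lemma exists_rate_lower {α ε lam : ℝ} (hα : 0 < α) (hε : 0 < ε) (hlam : 0 < lam) :
    ∃ r > 0, ∀ (l : ℝ) (n : ℕ), r ≤ gn α ε lam l n ∧
      disc α ε lam l n ≤ (gn α ε lam l n - r) ^ 2 := by
  set β := lam ^ 2 / 4 with hβ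
  have hβ0 : 0 < β := by positivity
  refine ⟨min (β / (α + ε * β)) (α / 2), by positivity, fun l n => ?_⟩
  set r := min (β / (α + ε * β)) (α / 2)
  have hb : β ≤ bn lam l n := le_bn lam l n
  have hr : 0 < r := by positivity
  have h1 : r * (α + ε * β) ≤ β := by
    rw [← le_div_iff₀ (by positivity)]; exact min_le_left _ _
  have h2 : r ≤ α / 2 := min_le_right _ _
  have hrε : r * ε ≤ 1 := by
    by_contra hc
    push Not at hc
    nlinarith [mul_pos hr hα]
  have h3 : 2 * gn α ε lam l n * r ≤ bn lam l n := by
    unfold gn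
    nlinarith [mul_nonneg (sub_nonneg.mpr hb) (sub_nonneg.mpr hrε)]
  refine ⟨?_, ?_⟩
  · unfold gn
    have : 0 ≤ ε * bn lam l n := mul_nonneg hε.le (hβ0.le.trans hb)
    linarith
  · unfold disc; nlinarith [sq_nonneg r]

/-- Kernels dominated by a sum of two normalized exponential densities of total mass `2 A`. -/
def ExpDominated (A : ℝ) (k : ℝ → ℝ) : Prop :=
  ∃ r s : ℝ, 0 < r ∧ 0 < s ∧
    ∀ t, 0 ≤ t → |k t| ≤ A * (r * Real.exp (-r * t) + s * Real.exp (-s * t))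

set_option maxHeartbeats 800000 in
/-- The modes `G_n` and their derivatives are of size `O(1 / b_n)`, uniformly in `n`. -/
lemma exists_Gn_bounds {α ε lam : ℝ} (l : ℝ) (hα : 0 < α) (hε : 0 < ε) (hlam : 0 < lam) :
    ∃ C > 0, ∀ n : ℕ, (∀ t, 0 ≤ t → |Gn α ε lam l n t| ≤ C / bn lam l n) ∧
      ExpDominated (C / bn lam l n) (Gn α ε lam l n) ∧
      ExpDominated (C / bn lam l n) (dGn α ε lam l n) := by
  obtain ⟨r, hr, hrn⟩ := exists_rate_lower hα hε hlam
  -- For b > B one has 3ε²b²/16 ≥ b, hence g² - b ≥ (εb/4)².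
  set B := 16 / (3 * ε ^ 2) with hB
  have hB0 : 0 < B := by positivity
  set C₁ := 2 / r * B with hC₁
  set C₂ := 2 / r * (1 + (α + ε * B) / r) * B with hC₂
  set C₃ := 2 / ε with hC₃
  have hC₁0 : 0 < C₁ := by positivity
  have hC₂0 : 0 < C₂ := by positivity
  have hC₃0 : 0 < C₃ := by positivity
  -- The factor 1 + 1/r pays for rewriting e^{-rt} as a multiple of the density r e^{-rt}.
  set M := (C₁ + C₂ + C₃) * (1 + 1 / r) with hM
  have hM0 : 0 < M := by positivity
  have hMC : ∀ c, 0 ≤ c → c ≤ C₁ + C₂ + C₃ → c ≤ M ∧ c / r ≤ M := by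
    intro c hc0 hc
    have h2 : c * (1 / r) ≤ (C₁ + C₂ + C₃) * (1 / r) :=
      mul_le_mul_of_nonneg_right hc (by positivity)
    have h3 : 0 ≤ c * (1 / r) := by positivity
    have e : c / r = c * (1 / r) := by ring
    rw [e, hM, mul_add, mul_one]
    constructor <;> linarith
  refine ⟨2 * M, by positivity, fun n => ?_⟩
  set b := bn lam l n with hb
  set g := gn α ε lam l n with hg
  set D := disc α ε lam l n with hD
  have hb0 : 0 < b := lt_of_lt_of_le (by positivity) (le_bn lam l n)
  obtain ⟨hrg, hDr⟩ := hrn l n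
  have hg0 : 0 < g := lt_of_lt_of_le hr hrg
  -- Low modes may be oscillating or critically damped: only t e^{-rt} is available, and the factor
  -- 1/b is inserted at the cost of B/b ≥ 1. High modes are overdamped with ω ≥ εb/4, so the partial
  -- fraction prefactor 1/(2ω) is already O(1/b).
  by_cases hcase : b ≤ B
  · have hBb : 1 ≤ B / b := by rwa [le_div_iff₀ hb0, one_mul]
    have hgB : 2 * g ≤ α + ε * B := by
      have : ε * b ≤ ε * B := mul_le_mul_of_nonneg_left hcase hε.le
      rw [hg]; unfold gn; linarith
    have hexp : ∀ t, Real.exp (-g * t) * Real.exp ((g - r) * t) = Real.exp (-r * t) := by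
      intro t; rw [← Real.exp_add]; congr 1; ring
    have hG : ∀ t, 0 ≤ t → |Gn α ε lam l n t| ≤ C₁ / b * Real.exp (-(r / 2) * t) := by
      intro t ht
      have h1 := (abs_hypS_hypC_le (sub_nonneg.mpr hrg) hDr ht).1
      rw [Gn_eq, abs_mul, abs_of_pos (Real.exp_pos _)]
      calc Real.exp (-g * t) * |hypS D t|
          ≤ Real.exp (-g * t) * (t * Real.exp ((g - r) * t)) :=
            mul_le_mul_of_nonneg_left h1 (Real.exp_pos _).le
        _ = t * Real.exp (-r * t) := by rw [← hexp t]; ring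
        _ ≤ 2 / r * Real.exp (-(r / 2) * t) := mul_exp_neg_le hr
        _ ≤ (2 / r * Real.exp (-(r / 2) * t)) * (B / b) :=
            le_mul_of_one_le_right (by positivity) hBb
        _ = _ := by rw [hC₁]; ring
    have hdG : ∀ t, 0 ≤ t → |dGn α ε lam l n t| ≤
        C₂ / b * (r / 2 * Real.exp (-(r / 2) * t)) := by
      intro t ht
      obtain ⟨h1, h2⟩ := abs_hypS_hypC_le (sub_nonneg.mpr hrg) hDr ht
      rw [dGn, abs_mul, abs_of_pos (Real.exp_pos _)]
      have h3 : |hypC D t - g * hypS D t| ≤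
          Real.exp ((g - r) * t) + g * (t * Real.exp ((g - r) * t)) := by
        refine (abs_sub _ _).trans (add_le_add h2 ?_)
        rw [abs_mul, abs_of_pos hg0]
        exact mul_le_mul_of_nonneg_left h1 hg0.le
      have h4 : Real.exp (-r * t) ≤ Real.exp (-(r / 2) * t) :=
        Real.exp_le_exp.mpr (by nlinarith)
      have h5 := mul_le_mul_of_nonneg_left (mul_exp_neg_le (t := t) hr) hg0.le
      have h6 : g * (2 / r) ≤ (α + ε * B) / r := by
        rw [mul_div_assoc', div_le_div_iff_of_pos_right hr]; linarith
      have h7 := mul_le_mul_of_nonneg_right h6 (Real.exp_pos (-(r / 2) * t)).le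
      calc Real.exp (-g * t) * |hypC D t - g * hypS D t|
          ≤ Real.exp (-g * t) * (Real.exp ((g - r) * t) + g * (t * Real.exp ((g - r) * t))) :=
            mul_le_mul_of_nonneg_left h3 (Real.exp_pos _).le
        _ = Real.exp (-r * t) + g * (t * Real.exp (-r * t)) := by rw [← hexp t]; ring
        _ ≤ (1 + (α + ε * B) / r) * Real.exp (-(r / 2) * t) := by nlinarith
        _ ≤ ((1 + (α + ε * B) / r) * Real.exp (-(r / 2) * t)) * (B / b) :=
            le_mul_of_one_le_right (by positivity) hBb
        _ = _ := by rw [hC₂]; field_simp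
    obtain ⟨m1, m1'⟩ := hMC C₁ hC₁0.le (by linarith)
    obtain ⟨m2, -⟩ := hMC C₂ hC₂0.le (by linarith)
    refine ⟨fun t ht => (hG t ht).trans ?_, ⟨r / 2, r / 2, by positivity, by positivity,
      fun t ht => (hG t ht).trans ?_⟩, ⟨r / 2, r / 2, by positivity, by positivity,
      fun t ht => (hdG t ht).trans ?_⟩⟩
    · have : Real.exp (-(r / 2) * t) ≤ 1 := Real.exp_le_one_iff.mpr (by nlinarith)
      calc C₁ / b * Real.exp (-(r / 2) * t) ≤ C₁ / b * 1 :=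
            mul_le_mul_of_nonneg_left this (by positivity)
        _ ≤ 2 * M / b := by rw [mul_one, div_le_div_iff_of_pos_right hb0]; linarith
    · have e : 2 * M / b * (r / 2 * Real.exp (-(r / 2) * t) + r / 2 * Real.exp (-(r / 2) * t)) =
          (2 * M * r) / b * Real.exp (-(r / 2) * t) := by ring
      rw [e]
      refine mul_le_mul_of_nonneg_right ?_ (Real.exp_pos _).le
      rw [div_le_div_iff_of_pos_right hb0]
      rw [div_le_iff₀ hr] at m1'
      nlinarith
    · have e : 2 * M / b * (r / 2 * Real.exp (-(r / 2) * t) + r / 2 * Real.exp (-(r / 2) * t)) =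
          (4 * M) / b * (r / 2 * Real.exp (-(r / 2) * t)) := by ring
      rw [e]
      refine mul_le_mul_of_nonneg_right ?_ (by positivity)
      rw [div_le_div_iff_of_pos_right hb0]
      linarith
  · push Not at hcase
    have hDb : (ε * b / 4) ^ 2 ≤ D := by
      have h1 : 16 ≤ 3 * ε ^ 2 * b := by
        rw [hB, div_lt_iff₀ (by positivity)] at hcase; linarith
      have h2 : D = ((α + ε * b) / 2) ^ 2 - b := rfl
      rw [h2]
      nlinarith [mul_le_mul_of_nonneg_right h1 hb0.le, mul_pos hα (mul_pos hε hb0), sq_nonneg α]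
    have hD0 : 0 < D := lt_of_lt_of_le (by positivity) hDb
    set ω := √D with hω
    have hωb : ε * b / 4 ≤ ω := Real.le_sqrt_of_sq_le hDb
    have hω0 : 0 < ω := Real.sqrt_pos.mpr hD0
    have hωr : ω ≤ g - r := by
      rw [show g - r = √((g - r) ^ 2) by rw [Real.sqrt_sq (sub_nonneg.mpr hrg)]]
      exact Real.sqrt_le_sqrt hDr
    have hA : 1 / (2 * ω) ≤ C₃ / b := by
      rw [hC₃, div_div, div_le_div_iff₀ (by positivity) (by positivity)]; linarith
    have hGe : ∀ t, Gn α ε lam l n t =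
        1 / (2 * ω) * (Real.exp (-(g - ω) * t) - Real.exp (-(g + ω) * t)) := by
      intro t
      change Real.exp (-g * t) * hypS D t = _
      rw [hypS, if_pos hD0, Real.sinh_eq, ← hω]
      have e1 : Real.exp (-(g - ω) * t) = Real.exp (-g * t) * Real.exp (ω * t) := by
        rw [← Real.exp_add]; congr 1; ring
      have e2 : Real.exp (-(g + ω) * t) = Real.exp (-g * t) * Real.exp (-(ω * t)) := by
        rw [← Real.exp_add]; congr 1; ring
      rw [e1, e2]; field_simp
    have hdGe : ∀ t, dGn α ε lam l n t = 1 / (2 * ω) *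
        ((g + ω) * Real.exp (-(g + ω) * t) - (g - ω) * Real.exp (-(g - ω) * t)) := by
      intro t
      change Real.exp (-g * t) * (hypC D t - g * hypS D t) = _
      rw [hypS, hypC, if_pos hD0, if_pos hD0, Real.sinh_eq, Real.cosh_eq, ← hω]
      have e1 : Real.exp (-(g - ω) * t) = Real.exp (-g * t) * Real.exp (ω * t) := by
        rw [← Real.exp_add]; congr 1; ring
      have e2 : Real.exp (-(g + ω) * t) = Real.exp (-g * t) * Real.exp (-(ω * t)) := by
        rw [← Real.exp_add]; congr 1; ring
      rw [e1, e2]; field_simp; ring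
    have hG : ∀ t, 0 ≤ t → |Gn α ε lam l n t| ≤ C₃ / b * Real.exp (-r * t) := by
      intro t ht
      rw [hGe, abs_mul, abs_of_pos (by positivity)]
      have h1 : Real.exp (-(g + ω) * t) ≤ Real.exp (-(g - ω) * t) :=
        Real.exp_le_exp.mpr (mul_le_mul_of_nonneg_right (by linarith) ht)
      have h2 : Real.exp (-(g - ω) * t) ≤ Real.exp (-r * t) :=
        Real.exp_le_exp.mpr (mul_le_mul_of_nonneg_right (by linarith) ht)
      rw [abs_of_nonneg (by linarith)]
      have := Real.exp_pos (-(g + ω) * t)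
      exact mul_le_mul hA (by linarith) (by linarith) (by positivity)
    obtain ⟨m3, m3'⟩ := hMC C₃ hC₃0.le (by linarith)
    refine ⟨fun t ht => (hG t ht).trans ?_, ⟨r, r, hr, hr, fun t ht => (hG t ht).trans ?_⟩,
      ⟨g - ω, g + ω, by linarith, by linarith, fun t ht => ?_⟩⟩
    · have : Real.exp (-r * t) ≤ 1 := Real.exp_le_one_iff.mpr (by nlinarith)
      calc C₃ / b * Real.exp (-r * t) ≤ C₃ / b * 1 :=
            mul_le_mul_of_nonneg_left this (by positivity)
        _ ≤ 2 * M / b := by rw [mul_one, div_le_div_iff_of_pos_right hb0]; linarith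
    · have e : 2 * M / b * (r * Real.exp (-r * t) + r * Real.exp (-r * t)) =
          (4 * M * r) / b * Real.exp (-r * t) := by ring
      rw [e]
      refine mul_le_mul_of_nonneg_right ?_ (Real.exp_pos _).le
      rw [div_le_div_iff_of_pos_right hb0]
      rw [div_le_iff₀ hr] at m3'
      nlinarith
    -- 2ωG' is a difference of the densities with rates g + ω and g - ω. The fast rate grows with n,
    -- so G' is not O(1/b) pointwise, while its integral is; this is why `ExpDominated` allows two
    -- free rates.
    · have p1 : 0 ≤ (g - ω) * Real.exp (-(g - ω) * t) :=
        mul_nonneg (by linarith) (Real.exp_pos _).le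
      have p2 : 0 ≤ (g + ω) * Real.exp (-(g + ω) * t) :=
        mul_nonneg (by linarith) (Real.exp_pos _).le
      rw [hdGe, abs_mul, abs_of_pos (by positivity)]
      refine mul_le_mul (hA.trans ?_) ?_ (abs_nonneg _) (by positivity)
      · rw [div_le_div_iff_of_pos_right hb0]; linarith
      · rw [abs_le]; constructor <;> linarith

/-! ### Causal convolution in time -/

/-- The causal convolution `∫_0^t k(t - τ) h(τ) dτ`. -/
def duh (k h : ℝ → ℝ) (t : ℝ) : ℝ := ∫ τ in (0 : ℝ)..t, k (t - τ) * h τ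

lemma duh_zero (k h : ℝ → ℝ) : duh k h 0 = 0 := intervalIntegral.integral_same

lemma intervalIntegrable_of_bounded {h : ℝ → ℝ} {K a b : ℝ} (ha : 0 ≤ a) (hb : 0 ≤ b)
    (hc : ContinuousOn h (Set.Ioi 0)) (hK : ∀ t, 0 < t → |h t| ≤ K) :
    IntervalIntegrable h MeasureTheory.volume a b := by
  have hsub : Set.uIoc a b ⊆ Set.Ioi 0 := fun x hx => lt_of_le_of_lt (le_min ha hb) hx.1
  rw [intervalIntegrable_iff]
  exact MeasureTheory.IntegrableOn.of_bound (by simp)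
    ((hc.mono hsub).aestronglyMeasurable measurableSet_uIoc) K
    ((MeasureTheory.ae_restrict_iff' measurableSet_uIoc).mpr
      (Eventually.of_forall fun x hx => hK x (hsub hx)))

/-- Leibniz's rule when h is only bounded and continuous for positive times. The integral up to y
splits into three: over [0, t] with y in the integrand only, over [t, y] with kernel k(y - τ) -
k(0), and k(0) times the integral of h over [t, y]. -/
lemma hasDerivAt_duh {k k' h : ℝ → ℝ} {K : ℝ} (hk : ∀ t, HasDerivAt k (k' t) t)
    (hk' : Continuous k') (hc : ContinuousOn h (Set.Ioi 0)) (hK : ∀ t, 0 < t → |h t| ≤ K)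
    {t : ℝ} (ht : 0 < t) : HasDerivAt (duh k h) (k 0 * h t + duh k' h t) t := by
  have hkc : Continuous k := continuous_iff_continuousAt.mpr fun x => (hk x).continuousAt
  have hint : ∀ {a b : ℝ}, 0 ≤ a → 0 ≤ b → IntervalIntegrable h MeasureTheory.volume a b :=
    fun ha hb => intervalIntegrable_of_bounded ha hb hc hK
  have hint2 : ∀ {a b : ℝ} (q : ℝ → ℝ), Continuous q → 0 ≤ a → 0 ≤ b →
      IntervalIntegrable (fun τ => q τ * h τ) MeasureTheory.volume a b :=
    fun q hq ha hb => (hint ha hb).continuousOn_mul hq.continuousOn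
  obtain ⟨M, hM⟩ := isCompact_Icc.exists_bound_of_continuousOn (s := Set.Icc (-(t + 1)) (t + 1))
    hk'.continuousOn
  have hM0 : 0 ≤ M := (norm_nonneg _).trans (hM 0 ⟨by linarith, by linarith⟩)
  have hK0 : 0 ≤ K := (abs_nonneg _).trans (hK t ht)
  have D1 : HasDerivAt (fun y => ∫ τ in (0 : ℝ)..t, k (y - τ) * h τ) (duh k' h t) t := by
    refine (intervalIntegral.hasDerivAt_integral_of_dominated_loc_of_deriv_le
      (F := fun y τ => k (y - τ) * h τ) (F' := fun y τ => k' (y - τ) * h τ)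
      (s := Metric.ball t 1) (bound := fun _ => M * K) (Metric.ball_mem_nhds t one_pos)
      (Eventually.of_forall fun y => ?_) (hint2 _ (by fun_prop) le_rfl ht.le)
      ?_ (Eventually.of_forall fun τ hτ y hy => ?_) intervalIntegrable_const
      (Eventually.of_forall fun τ _ y _ => ?_)).2
    · exact (intervalIntegrable_iff.mp (hint2 _ (by fun_prop) le_rfl ht.le)).aestronglyMeasurable
    · exact (intervalIntegrable_iff.mp (hint2 (fun τ => k' (t - τ)) (by fun_prop)
        le_rfl ht.le)).aestronglyMeasurable
    · rw [Set.uIoc_of_le ht.le] at hτ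
      rw [Metric.mem_ball, Real.dist_eq, abs_lt] at hy
      rw [norm_mul]
      exact mul_le_mul (hM _ ⟨by linarith [hτ.2], by linarith [hτ.1]⟩) (hK τ hτ.1)
        (norm_nonneg _) hM0
    · have := (hk (y - τ)).comp y ((hasDerivAt_id y).sub_const τ)
      simpa using this.mul_const (h τ)
  -- Integrand and length of the interval are both O(|y - t|), so this piece is quadratically small.
  have D2 : HasDerivAt (fun y => ∫ τ in t..y, (k (y - τ) - k 0) * h τ) 0 t := by
    have hO : (fun y => ∫ τ in t..y, (k (y - τ) - k 0) * h τ) =O[𝓝 t]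
        fun y => ‖y - t‖ ^ 2 := by
      refine Asymptotics.IsBigO.of_bound (M * K) ?_
      filter_upwards [Metric.ball_mem_nhds t (show 0 < min t 1 by positivity)] with y hy
      rw [Metric.mem_ball, Real.dist_eq] at hy
      have hy1 := (abs_lt.mp (hy.trans_le (min_le_right _ _)))
      have hy0 := (abs_lt.mp (hy.trans_le (min_le_left _ _)))
      have hb : ∀ τ ∈ Set.uIoc t y, ‖(k (y - τ) - k 0) * h τ‖ ≤ M * |y - t| * K := by
        intro τ hτ
        have hτ' := Set.uIoc_subset_uIcc hτ
        have hτt : |y - τ| ≤ |y - t| := by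
          rcases Set.mem_uIcc.mp hτ' with h' | h'
          · rw [abs_of_nonneg (by linarith), abs_of_nonneg (by linarith)]; linarith
          · rw [abs_of_nonpos (by linarith), abs_of_nonpos (by linarith)]; linarith
        have hτ0 : 0 < τ := lt_of_lt_of_le (lt_min ht (by linarith)) hτ'.1
        rw [norm_mul]
        refine mul_le_mul ?_ (hK τ hτ0) (norm_nonneg _) (by positivity)
        have hy2 : |y - τ| ≤ 1 := hτt.trans (abs_le.mpr ⟨by linarith, by linarith⟩)
        have hy3 := abs_le.mp hy2
        have := (convex_Icc (-(t + 1)) (t + 1)).norm_image_sub_le_of_norm_hasDerivWithin_le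
          (f := k) (f' := k') (C := M) (fun x _ => (hk x).hasDerivWithinAt) hM
          (x := 0) (y := y - τ) ⟨by linarith, by linarith⟩ ⟨by linarith, by linarith⟩
        refine this.trans ?_
        rw [sub_zero, Real.norm_eq_abs]
        exact mul_le_mul_of_nonneg_left hτt hM0
      refine (intervalIntegral.norm_integral_le_of_norm_le_const hb).trans_eq ?_
      rw [norm_pow, norm_norm, Real.norm_eq_abs]; ring
    have := (hO.hasFDerivAt (𝕜 := ℝ) (by norm_num)).hasDerivAt
    simpa using this
  have D3 : HasDerivAt (fun y => ∫ τ in t..y, h τ) (h t) t :=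
    intervalIntegral.integral_hasDerivAt_right (by simp)
      (hc.stronglyMeasurableAtFilter isOpen_Ioi t ht) (hc.continuousAt (Ioi_mem_nhds ht))
  have D := (D1.add D2).add (D3.const_mul (k 0))
  have e : duh k' h t + 0 + k 0 * h t = k 0 * h t + duh k' h t := by ring
  rw [e] at D
  refine D.congr_of_eventuallyEq ?_
  filter_upwards [Ioi_mem_nhds ht] with y hy
  have hy' : (0 : ℝ) < y := hy
  simp only [Pi.add_apply]
  rw [duh, ← intervalIntegral.integral_add_adjacent_intervals
    (hint2 (fun τ => k (y - τ)) (by fun_prop) le_rfl ht.le)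
    (hint2 (fun τ => k (y - τ)) (by fun_prop) ht.le hy'.le), add_assoc]
  congr 1
  rw [← intervalIntegral.integral_const_mul, ← intervalIntegral.integral_add
    (hint2 (fun τ => k (y - τ) - k 0) (by fun_prop) ht.le hy'.le)
    ((hint ht.le hy'.le).const_mul _)]
  refine intervalIntegral.integral_congr fun τ _ => ?_
  ring

lemma continuousOn_duh {k k' h : ℝ → ℝ} {K : ℝ} (hk : ∀ t, HasDerivAt k (k' t) t)
    (hk' : Continuous k') (hc : ContinuousOn h (Set.Ioi 0)) (hK : ∀ t, 0 < t → |h t| ≤ K) :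
    ContinuousOn (duh k h) (Set.Ici 0) := by
  intro t ht
  rcases eq_or_lt_of_le (show (0 : ℝ) ≤ t from ht) with h0 | h0
  · subst h0
    have hkc : Continuous k := continuous_iff_continuousAt.mpr fun x => (hk x).continuousAt
    obtain ⟨M, hM⟩ := isCompact_Icc.exists_bound_of_continuousOn (s := Set.Icc 0 1)
      hkc.continuousOn
    have hK0 : 0 ≤ K := (abs_nonneg _).trans (hK 1 one_pos)
    have hM0 : 0 ≤ M := (norm_nonneg _).trans (hM 0 ⟨le_rfl, zero_le_one⟩)
    rw [ContinuousWithinAt, duh_zero]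
    have hlim : Tendsto (fun y : ℝ => M * K * |y|) (𝓝[Set.Ici 0] 0) (𝓝 0) := by
      have : Continuous (fun y : ℝ => M * K * |y|) := by fun_prop
      simpa using this.tendsto 0 |>.mono_left nhdsWithin_le_nhds
    refine squeeze_zero_norm' ?_ hlim
    have hm : Set.Iio (1 : ℝ) ∈ 𝓝[Set.Ici 0] (0 : ℝ) :=
      mem_nhdsWithin_of_mem_nhds (Iio_mem_nhds one_pos)
    filter_upwards [hm, self_mem_nhdsWithin] with y hy1 hy0
    have hy0' : (0 : ℝ) ≤ y := hy0
    have hy1' : y < 1 := hy1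
    have := intervalIntegral.norm_integral_le_of_norm_le_const (a := 0) (b := y)
      (f := fun τ => k (y - τ) * h τ) (C := M * K) (fun τ hτ => by
        rw [Set.uIoc_of_le hy0'] at hτ
        rw [norm_mul]
        exact mul_le_mul (hM _ ⟨by linarith [hτ.2], by linarith [hτ.1]⟩) (hK τ hτ.1)
          (norm_nonneg _) hM0)
    simpa [duh] using this
  · exact (hasDerivAt_duh hk hk' hc hK h0).continuousAt.continuousWithinAt

lemma integral_exp_density_le (r t : ℝ) :
    ∫ τ in (0 : ℝ)..t, r * Real.exp (-r * (t - τ)) ≤ 1 := by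
  have h1 : ∀ τ ∈ Set.uIcc 0 t, HasDerivAt (fun τ => Real.exp (-r * (t - τ)))
      (r * Real.exp (-r * (t - τ))) τ := by
    intro τ _
    have := (((hasDerivAt_id τ).const_sub t).const_mul (-r)).exp
    simpa [mul_comm] using this
  rw [intervalIntegral.integral_eq_sub_of_hasDerivAt h1
    ((by fun_prop : Continuous _).intervalIntegrable _ _)]
  have := Real.exp_pos (-r * (t - 0))
  simp only [sub_self, mul_zero, Real.exp_zero]
  linarith

/-- Each normalized exponential density has mass at most 1 on [0, t], whatever its rate, so the
bound is uniform in time and in the rates. -/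
lemma abs_duh_le {A K t : ℝ} {k h : ℝ → ℝ} (hA : 0 ≤ A) (hk : ExpDominated A k)
    (hK : ∀ t, 0 < t → |h t| ≤ K) (ht : 0 ≤ t) : |duh k h t| ≤ 2 * A * K := by
  obtain ⟨r, s, hr, hs, hrs⟩ := hk
  have hK0 : 0 ≤ K := (abs_nonneg _).trans (hK 1 one_pos)
  have i1 : ∀ r : ℝ, IntervalIntegrable (fun τ => r * Real.exp (-r * (t - τ)))
      MeasureTheory.volume 0 t := fun r =>
    ((by fun_prop : Continuous _).intervalIntegrable _ _)
  have h1 : ‖duh k h t‖ ≤ ∫ τ in (0 : ℝ)..t,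
      A * K * (r * Real.exp (-r * (t - τ)) + s * Real.exp (-s * (t - τ))) := by
    refine intervalIntegral.norm_integral_le_of_norm_le ht (Eventually.of_forall fun τ hτ => ?_)
      (((i1 r).add (i1 s)).const_mul _)
    rw [norm_mul]
    have h2 := hrs (t - τ) (by linarith [hτ.2])
    have h3 := mul_le_mul h2 (hK τ hτ.1) (abs_nonneg _) ((abs_nonneg _).trans h2)
    exact h3.trans_eq (by ring)
  rw [intervalIntegral.integral_const_mul, intervalIntegral.integral_add (i1 r) (i1 s)] at h1
  have h4 := add_le_add (integral_exp_density_le r t) (integral_exp_density_le s t)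
  have h5 := mul_le_mul_of_nonneg_left h4 (mul_nonneg hA hK0)
  rw [Real.norm_eq_abs] at h1
  linarith

/-! ### Parabolic smoothing for the modes -/

/-- The variation of constants formula, as an estimate. -/
lemma abs_le_of_hasDerivAt {β t₁ t : ℝ} {y R : ℝ → ℝ} {K : ℝ} (ht : t₁ < t)
    (hy : ContinuousOn y (Set.Icc t₁ t))
    (hd : ∀ τ ∈ Set.Ioo t₁ t, HasDerivAt y (-β * y τ + R τ) τ)
    (hR : ContinuousOn R (Set.Ioc t₁ t)) (hK : ∀ τ ∈ Set.Ioc t₁ t, |R τ| ≤ K) :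
    IntervalIntegrable (fun τ => Real.exp (-β * (t - τ)) * |R τ|) MeasureTheory.volume t₁ t ∧
    |y t| ≤ Real.exp (-β * (t - t₁)) * |y t₁| +
      ∫ τ in t₁..t, Real.exp (-β * (t - τ)) * |R τ| := by
  have hRi : IntervalIntegrable R MeasureTheory.volume t₁ t := by
    rw [intervalIntegrable_iff, Set.uIoc_of_le ht.le]
    exact MeasureTheory.IntegrableOn.of_bound (by simp) (hR.aestronglyMeasurable measurableSet_Ioc)
      K ((MeasureTheory.ae_restrict_iff' measurableSet_Ioc).mpr (Eventually.of_forall hK))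
  have hcont : Continuous (fun τ => Real.exp (-β * (t - τ))) := by fun_prop
  have hi : IntervalIntegrable (fun τ => Real.exp (-β * (t - τ)) * R τ) MeasureTheory.volume t₁ t :=
    hRi.continuousOn_mul hcont.continuousOn
  have hi' : IntervalIntegrable (fun τ => Real.exp (-β * (t - τ)) * |R τ|)
      MeasureTheory.volume t₁ t := hRi.abs.continuousOn_mul hcont.continuousOn
  refine ⟨hi', ?_⟩
  -- Integrating factor. Continuity of y up to t₁ and integrability of the right side are enough, so
  -- R may be discontinuous at the initial time.
  have hD : ∀ τ ∈ Set.Ioo t₁ t, HasDerivAt (fun τ => Real.exp (-β * (t - τ)) * y τ)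
      (Real.exp (-β * (t - τ)) * R τ) τ := by
    intro τ hτ
    have h1 : HasDerivAt (fun τ => Real.exp (-β * (t - τ))) (Real.exp (-β * (t - τ)) * β) τ := by
      simpa using (((hasDerivAt_id τ).const_sub t).const_mul (-β)).exp
    refine (h1.mul (hd τ hτ)).congr_deriv ?_
    ring
  have hF : ∫ τ in t₁..t, Real.exp (-β * (t - τ)) * R τ =
      Real.exp (-β * (t - t)) * y t - Real.exp (-β * (t - t₁)) * y t₁ :=
    intervalIntegral.integral_eq_sub_of_hasDerivAt_of_le ht.le
      (hcont.continuousOn.mul hy) hD hi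
  simp only [sub_self, mul_zero, Real.exp_zero, one_mul] at hF
  have : y t = Real.exp (-β * (t - t₁)) * y t₁ + ∫ τ in t₁..t, Real.exp (-β * (t - τ)) * R τ := by
    linarith
  rw [this]
  refine (abs_add_le _ _).trans (add_le_add ?_ ?_)
  · rw [abs_mul, abs_of_pos (Real.exp_pos _)]
  · refine (intervalIntegral.abs_integral_le_integral_abs ht.le).trans_eq ?_
    refine intervalIntegral.integral_congr fun τ _ => ?_
    simp only [abs_mul, abs_of_pos (Real.exp_pos _)]

/-- X^{15/16} e^{-X} ≤ 1 with X = c wt² s. The exponent 15/16 lies below 1 so that the price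
s^{-15/16} is integrable in time, and close to 1 so that the gain 15/8 is almost two derivatives. -/
lemma wt_rpow_mul_exp_le {σ c b s : ℝ} (hc : 0 < c) (hs : 0 < s) (n : ℤ)
    (hb : c * wt n ^ 2 ≤ b) :
    wt n ^ (σ + 15 / 8) * Real.exp (-b * s) ≤
      c ^ (-(15 / 16) : ℝ) * s ^ (-(15 / 16) : ℝ) * wt n ^ σ := by
  have hw := wt_pos n
  set X := c * wt n ^ 2 * s with hX
  have hX0 : 0 < X := by positivity
  have h1 : X ^ (15 / 16 : ℝ) ≤ Real.exp X := by
    have h2 : X ≤ Real.exp X := by linarith [Real.add_one_le_exp X]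
    have h3 : 1 ≤ Real.exp X := Real.one_le_exp hX0.le
    calc X ^ (15 / 16 : ℝ) ≤ Real.exp X ^ (15 / 16 : ℝ) :=
          Real.rpow_le_rpow hX0.le h2 (by norm_num)
      _ ≤ Real.exp X ^ (1 : ℝ) := Real.rpow_le_rpow_of_exponent_le h3 (by norm_num)
      _ = _ := Real.rpow_one _
  have h4 : Real.exp (-b * s) ≤ Real.exp (-X) :=
    Real.exp_le_exp.mpr (by rw [hX]; nlinarith)
  have h5 : X ^ (15 / 16 : ℝ) * Real.exp (-X) ≤ 1 := by
    have := mul_le_mul_of_nonneg_right h1 (Real.exp_pos (-X)).le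
    rwa [← Real.exp_add, add_neg_cancel, Real.exp_zero] at this
  have e1 : wt n ^ (15 / 8 : ℝ) =
      c ^ (-(15 / 16) : ℝ) * s ^ (-(15 / 16) : ℝ) * X ^ (15 / 16 : ℝ) := by
    rw [hX, Real.mul_rpow (by positivity) hs.le, Real.mul_rpow hc.le (by positivity),
      Real.rpow_neg hc.le, Real.rpow_neg hs.le]
    have e2 : (wt n ^ 2) ^ (15 / 16 : ℝ) = wt n ^ (15 / 8 : ℝ) := by
      rw [← Real.rpow_natCast, ← Real.rpow_mul hw.le]; norm_num
    rw [e2]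
    have := (Real.rpow_pos_of_pos hc (15 / 16)).ne'
    have := (Real.rpow_pos_of_pos hs (15 / 16)).ne'
    field_simp
  rw [Real.rpow_add hw, e1]
  have p1 := (Real.rpow_pos_of_pos hc (-(15 / 16))).le
  have p2 := (Real.rpow_pos_of_pos hs (-(15 / 16))).le
  have p3 := wt_rpow_nonneg n σ
  calc wt n ^ σ * (c ^ (-(15 / 16) : ℝ) * s ^ (-(15 / 16) : ℝ) * X ^ (15 / 16 : ℝ)) *
        Real.exp (-b * s)
      ≤ wt n ^ σ * (c ^ (-(15 / 16) : ℝ) * s ^ (-(15 / 16) : ℝ) * X ^ (15 / 16 : ℝ)) *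
        Real.exp (-X) := mul_le_mul_of_nonneg_left h4 (by positivity)
    _ = c ^ (-(15 / 16) : ℝ) * s ^ (-(15 / 16) : ℝ) * wt n ^ σ *
        (X ^ (15 / 16 : ℝ) * Real.exp (-X)) := by ring
    _ ≤ _ := mul_le_of_le_one_right (by positivity) h5

lemma integral_sub_rpow {t₁ t : ℝ} :
    IntervalIntegrable (fun τ => (t - τ) ^ (-(15 / 16) : ℝ)) MeasureTheory.volume t₁ t ∧
    ∫ τ in t₁..t, (t - τ) ^ (-(15 / 16) : ℝ) = 16 * (t - t₁) ^ (1 / 16 : ℝ) := by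
  constructor
  · have := (intervalIntegral.intervalIntegrable_rpow' (a := t - t₁) (b := 0)
      (r := -(15 / 16)) (by norm_num)).comp_sub_left t
    simpa using this
  · rw [intervalIntegral.integral_comp_sub_left (fun s => s ^ (-(15 / 16) : ℝ)) t, sub_self,
      integral_rpow (Or.inl (by norm_num))]
    norm_num
    ring

/-- Parabolic smoothing: the solution of `y_n' = -b_n y_n + R_n` with `b_n ≥ c (1 + |n|)²` gains
`15/8` derivatives over `R_n`. -/
lemma exists_smoothing {σ c t₁ T C₀ : ℝ} {b : ℤ → ℝ} {y R : ℤ → ℝ → ℝ} (hc : 0 < c)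
    (hb : ∀ n, c * wt n ^ 2 ≤ b n) (hy : ∀ n, ContinuousOn (y n) (Set.Icc t₁ T))
    (hd : ∀ n, ∀ τ ∈ Set.Ioo t₁ T, HasDerivAt (y n) (-b n * y n τ + R n τ) τ)
    (hR : ∀ n, ContinuousOn (R n) (Set.Ioc t₁ T)) (hRb : WeightedBdd σ R (Set.Ioc t₁ T))
    (h0 : ∀ s : Finset ℤ, ∑ n ∈ s, wt n ^ σ * |y n t₁| ≤ C₀) :
    ∃ A B : ℝ, 0 ≤ A ∧ 0 ≤ B ∧ ∀ t ∈ Set.Ioc t₁ T, ∀ s : Finset ℤ,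
      ∑ n ∈ s, wt n ^ (σ + 15 / 8) * |y n t| ≤ A * C₀ * (t - t₁) ^ (-(15 / 16) : ℝ) + B := by
  obtain ⟨C₁, hC₁0, hC₁⟩ := hRb
  set κ := c ^ (-(15 / 16) : ℝ) with hκ
  have hκ0 : 0 ≤ κ := (Real.rpow_pos_of_pos hc _).le
  -- A is the factor from the pointwise kernel bound; B is that factor times C₁ and the integral of
  -- (t - τ)^{-15/16}, which is 16 (t - t₁)^{1/16}.
  refine ⟨κ, κ * C₁ * (16 * |T - t₁| ^ (1 / 16 : ℝ)), hκ0, by positivity, fun t ht s => ?_⟩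
  have hRn : ∀ n, ∀ τ ∈ Set.Ioc t₁ t, |R n τ| ≤ C₁ / wt n ^ σ := by
    intro n τ hτ
    rw [le_div_iff₀ (Real.rpow_pos_of_pos (wt_pos n) σ), mul_comm]
    simpa using hC₁ τ ⟨hτ.1, hτ.2.trans ht.2⟩ {n}
  have key := fun n => abs_le_of_hasDerivAt (β := b n) ht.1
    ((hy n).mono (Set.Icc_subset_Icc_right ht.2))
    (fun τ hτ => hd n τ ⟨hτ.1, hτ.2.trans_le ht.2⟩)
    ((hR n).mono (Set.Ioc_subset_Ioc_right ht.2)) (hRn n)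
  have hst : 0 < t - t₁ := by linarith [ht.1]
  calc ∑ n ∈ s, wt n ^ (σ + 15 / 8) * |y n t|
      ≤ ∑ n ∈ s, (κ * (t - t₁) ^ (-(15 / 16) : ℝ) * (wt n ^ σ * |y n t₁|) +
          ∫ τ in t₁..t, wt n ^ (σ + 15 / 8) * (Real.exp (-b n * (t - τ)) * |R n τ|)) := by
        refine Finset.sum_le_sum fun n _ => ?_
        refine (mul_le_mul_of_nonneg_left (key n).2 (wt_rpow_nonneg _ _)).trans ?_
        rw [mul_add, intervalIntegral.integral_const_mul, ← mul_assoc, ← mul_assoc]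
        exact add_le_add_left (mul_le_mul_of_nonneg_right
          (wt_rpow_mul_exp_le hc hst n (hb n)) (abs_nonneg _)) _
    _ = κ * (t - t₁) ^ (-(15 / 16) : ℝ) * ∑ n ∈ s, wt n ^ σ * |y n t₁| +
          ∫ τ in t₁..t, ∑ n ∈ s, wt n ^ (σ + 15 / 8) *
            (Real.exp (-b n * (t - τ)) * |R n τ|) := by
        rw [Finset.sum_add_distrib, ← Finset.mul_sum, intervalIntegral.integral_finsetSum]
        exact fun n _ => (key n).1.const_mul _
    _ ≤ κ * (t - t₁) ^ (-(15 / 16) : ℝ) * C₀ +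
          ∫ τ in t₁..t, κ * C₁ * (t - τ) ^ (-(15 / 16) : ℝ) := by
        refine add_le_add (mul_le_mul_of_nonneg_left (h0 s) (by positivity)) ?_
        refine intervalIntegral.integral_mono_on_of_le_Ioo ht.1.le ?_
          (integral_sub_rpow.1.const_mul _) fun τ hτ => ?_
        · exact (IntervalIntegrable.sum s fun n _ =>
            (key n).1.const_mul (wt n ^ (σ + 15 / 8))).congr (fun τ _ => by simp)
        · have hτt : 0 < t - τ := by linarith [hτ.2]
          calc ∑ n ∈ s, wt n ^ (σ + 15 / 8) * (Real.exp (-b n * (t - τ)) * |R n τ|)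
              ≤ ∑ n ∈ s, κ * (t - τ) ^ (-(15 / 16) : ℝ) * (wt n ^ σ * |R n τ|) := by
                refine Finset.sum_le_sum fun n _ => ?_
                rw [← mul_assoc, ← mul_assoc]
                exact mul_le_mul_of_nonneg_right (wt_rpow_mul_exp_le hc hτt n (hb n))
                  (abs_nonneg _)
            _ = κ * (t - τ) ^ (-(15 / 16) : ℝ) * ∑ n ∈ s, wt n ^ σ * |R n τ| := by
                rw [Finset.mul_sum]
            _ ≤ κ * (t - τ) ^ (-(15 / 16) : ℝ) * C₁ :=
                mul_le_mul_of_nonneg_left (hC₁ τ ⟨hτ.1, hτ.2.le.trans ht.2⟩ s) (by positivity)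
            _ = _ := by ring
    _ ≤ _ := by
        rw [intervalIntegral.integral_const_mul, integral_sub_rpow.2]
        have h1 : (t - t₁) ^ (1 / 16 : ℝ) ≤ |T - t₁| ^ (1 / 16 : ℝ) :=
          Real.rpow_le_rpow hst.le (by
            rw [abs_of_nonneg (by linarith [ht.2])]; linarith [ht.2]) (by norm_num)
        have h2 := mul_le_mul_of_nonneg_left h1 (show 0 ≤ κ * C₁ * 16 by positivity)
        nlinarith

/-! ### Modes of the solution and their equations -/

/-- Bounded continuous sources on `(0,l) × (0,∞)` with a continuous `x`-derivative there. -/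
structure Source (l K : ℝ) (q : ℝ → ℝ → ℝ) : Prop where
  continuousOn : ContinuousOn (Function.uncurry q) (Set.Ioo 0 l ×ˢ Set.Ioi 0)
  bound : ∀ x ∈ Set.Ioo 0 l, ∀ t, 0 < t → |q x t| ≤ K
  differentiableAt : ∀ x ∈ Set.Ioo 0 l, ∀ t, 0 < t → DifferentiableAt ℝ (fun y => q y t) x
  continuousOn_dx : ContinuousOn (Function.uncurry (dx q)) (Set.Ioo 0 l ×ˢ Set.Ioi 0)

/-- The sine coefficients of a source at time `t`. -/
def srcCoeff (l : ℝ) (q : ℝ → ℝ → ℝ) (n : ℤ) (t : ℝ) : ℝ := sinCoeff l (fun x => q x t) n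

/-- The `n`-th mode of the solution with zero initial data. -/
def modeU (α ε lam l : ℝ) (q : ℝ → ℝ → ℝ) (n : ℤ) (t : ℝ) : ℝ :=
  -duh (Gn α ε lam l n.natAbs) (srcCoeff l q n) t

/-- The time derivative of the `n`-th mode. -/
def modeV (α ε lam l : ℝ) (q : ℝ → ℝ → ℝ) (n : ℤ) (t : ℝ) : ℝ :=
  -duh (dGn α ε lam l n.natAbs) (srcCoeff l q n) t

/-- The `n`-th mode of `ε u_t + u`. -/
def modeW (α ε lam l : ℝ) (q : ℝ → ℝ → ℝ) (n : ℤ) (t : ℝ) : ℝ :=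
  ε * modeV α ε lam l q n t + modeU α ε lam l q n t

/-- The right-hand side of the heat equation satisfied by the modes of `ε u_t + u`. -/
def modeR (α ε lam l : ℝ) (q : ℝ → ℝ → ℝ) (n : ℤ) (t : ℝ) : ℝ :=
  (1 - ε * α) * modeV α ε lam l q n t - ε * srcCoeff l q n t

/-- The coefficient `b_n` for integer indices. -/
def bZ (lam l : ℝ) (n : ℤ) : ℝ := gamZ l n ^ 2 + lam ^ 2 / 4

lemma bn_natAbs (lam l : ℝ) (n : ℤ) : bn lam l n.natAbs = bZ lam l n := by
  have : ((n.natAbs : ℕ) : ℝ) ^ 2 = (n : ℝ) ^ 2 := by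
    rw [← sq_abs (n : ℝ), ← Int.cast_abs, Int.abs_eq_natAbs]; simp
  simp only [bn, bZ, gam, gamZ, div_pow, mul_pow, this]

/-- The term λ²/4 supplies the bound at n = 0, where γ_n vanishes. -/
lemma exists_le_bZ {lam l : ℝ} (hlam : 0 < lam) (hl : 0 < l) :
    ∃ c > 0, ∀ n, c * wt n ^ 2 ≤ bZ lam l n := by
  have hp := Real.pi_pos
  refine ⟨min ((Real.pi / l) ^ 2) (lam ^ 2 / 4) / 2, by positivity, fun n => ?_⟩
  set m := min ((Real.pi / l) ^ 2) (lam ^ 2 / 4)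
  have h1 : m ≤ (Real.pi / l) ^ 2 := min_le_left _ _
  have h2 : m ≤ lam ^ 2 / 4 := min_le_right _ _
  have h0 : 0 ≤ m := by positivity
  have e : gamZ l n ^ 2 = (Real.pi / l) ^ 2 * |(n : ℝ)| ^ 2 := by
    rw [sq_abs]; unfold gamZ; ring
  have h3 : wt n ^ 2 ≤ 2 * (1 + |(n : ℝ)| ^ 2) := by
    unfold wt; nlinarith [sq_nonneg (1 - |(n : ℝ)|)]
  unfold bZ
  rw [e]
  nlinarith [mul_le_mul_of_nonneg_left h3 h0, mul_le_mul_of_nonneg_right h1 (sq_nonneg |(n : ℝ)|)]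

lemma bZ_nonneg (lam l : ℝ) (n : ℤ) : 0 ≤ bZ lam l n := by unfold bZ; positivity

lemma bZ_le {lam l : ℝ} (hl : 0 < l) (n : ℤ) :
    bZ lam l n ≤ ((Real.pi / l) ^ 2 + lam ^ 2 / 4) * wt n ^ 2 := by
  have h1 := pow_le_pow_left₀ (abs_nonneg _) (abs_gamZ_le hl n) 2
  rw [sq_abs, mul_pow] at h1
  have h2 : 1 ≤ wt n ^ 2 := one_le_pow₀ (one_le_wt n)
  unfold bZ
  nlinarith [mul_le_mul_of_nonneg_left h2 (show 0 ≤ lam ^ 2 / 4 by positivity)]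

lemma continuous_dGn (α ε lam l : ℝ) (n : ℕ) : Continuous (dGn α ε lam l n) :=
  continuous_iff_continuousAt.mpr fun t => (hasDerivAt_dGn α ε lam l n t).continuousAt

lemma continuous_Gn (α ε lam l : ℝ) (n : ℕ) : Continuous (Gn α ε lam l n) :=
  continuous_iff_continuousAt.mpr fun t => (hasDerivAt_Gn α ε lam l n t).continuousAt

namespace Source

variable {l K : ℝ} {q : ℝ → ℝ → ℝ}

lemma continuousOn_left (hq : Source l K q) {t : ℝ} (ht : 0 < t) :
    ContinuousOn (fun x => q x t) (Set.Ioo 0 l) :=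
  hq.continuousOn.comp (f := fun x => (x, t)) (by fun_prop) fun _ hx => ⟨hx, ht⟩

lemma nonneg (hl : 0 < l) (hq : Source l K q) : 0 ≤ K :=
  (abs_nonneg _).trans (hq.bound (l / 2) ⟨by linarith, by linarith⟩ 1 one_pos)

lemma abs_srcCoeff_le (hl : 0 < l) (hq : Source l K q) (n : ℤ) {t : ℝ} (ht : 0 < t) :
    |srcCoeff l q n t| ≤ K * l :=
  (abs_coeff_le hl (fun x hx => hq.bound x hx t ht) n).2

lemma continuousOn_srcCoeff (hl : 0 < l) (hq : Source l K q) (n : ℤ) :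
    ContinuousOn (srcCoeff l q n) (Set.Ioi 0) := by
  intro t ht
  refine ContinuousAt.continuousWithinAt ?_
  have e : srcCoeff l q n = fun t => ∫ x in Set.Ioo 0 l, q x t * Real.sin (gamZ l n * x) := by
    funext t
    rw [srcCoeff, sinCoeff, intervalIntegral.integral_of_le hl.le,
      MeasureTheory.integral_Ioc_eq_integral_Ioo]
  rw [e]
  refine MeasureTheory.continuousAt_of_dominated (bound := fun _ => K) ?_ ?_ (by simp) ?_
  · filter_upwards [Ioi_mem_nhds ht] with s hs
    exact ((hq.continuousOn_left hs).mul (by fun_prop)).aestronglyMeasurable measurableSet_Ioo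
  · filter_upwards [Ioi_mem_nhds ht] with s hs
    refine (MeasureTheory.ae_restrict_iff' measurableSet_Ioo).mpr (Eventually.of_forall ?_)
    intro x hx
    rw [norm_mul]
    exact (mul_le_of_le_one_right (norm_nonneg _) (Real.abs_sin_le_one _)).trans
      (hq.bound x hx s hs)
  · refine (MeasureTheory.ae_restrict_iff' measurableSet_Ioo).mpr (Eventually.of_forall ?_)
    intro x hx
    have : ContinuousOn (fun s => q x s) (Set.Ioi 0) :=
      hq.continuousOn.comp (f := fun s => (x, s)) (by fun_prop) fun _ hs => ⟨hx, hs⟩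
    exact (this.continuousAt (Ioi_mem_nhds ht)).mul continuousAt_const

variable {α ε lam : ℝ}

lemma hasDerivAt_modeU (hl : 0 < l) (hq : Source l K q) (n : ℤ) {t : ℝ} (ht : 0 < t) :
    HasDerivAt (modeU α ε lam l q n) (modeV α ε lam l q n t) t := by
  have := (hasDerivAt_duh (hasDerivAt_Gn α ε lam l n.natAbs) (continuous_dGn _ _ _ _ _)
    (hq.continuousOn_srcCoeff hl n) (fun t ht => hq.abs_srcCoeff_le hl n ht) ht).neg
  rw [Gn_zero, zero_mul, zero_add] at this
  exact this

lemma hasDerivAt_modeV (hl : 0 < l) (hq : Source l K q) (n : ℤ) {t : ℝ} (ht : 0 < t) :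
    HasDerivAt (modeV α ε lam l q n) (-(srcCoeff l q n t) -
      (α + ε * bZ lam l n) * modeV α ε lam l q n t - bZ lam l n * modeU α ε lam l q n t) t := by
  have hG := continuous_Gn α ε lam l n.natAbs
  have hdG := continuous_dGn α ε lam l n.natAbs
  have := (hasDerivAt_duh (hasDerivAt_dGn α ε lam l n.natAbs) (by fun_prop)
    (hq.continuousOn_srcCoeff hl n) (fun t ht => hq.abs_srcCoeff_le hl n ht) ht).neg
  refine this.congr_deriv ?_
  have hi : IntervalIntegrable (srcCoeff l q n) MeasureTheory.volume 0 t :=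
    intervalIntegrable_of_bounded le_rfl ht.le (hq.continuousOn_srcCoeff hl n)
      (fun t ht => hq.abs_srcCoeff_le hl n ht)
  have i1 : IntervalIntegrable (fun τ => dGn α ε lam l n.natAbs (t - τ) * srcCoeff l q n τ)
      MeasureTheory.volume 0 t := hi.continuousOn_mul (by fun_prop)
  have i2 : IntervalIntegrable (fun τ => Gn α ε lam l n.natAbs (t - τ) * srcCoeff l q n τ)
      MeasureTheory.volume 0 t := hi.continuousOn_mul (by fun_prop)
  have e : duh (fun t => -(2 * gn α ε lam l n.natAbs) * dGn α ε lam l n.natAbs t -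
      bn lam l n.natAbs * Gn α ε lam l n.natAbs t) (srcCoeff l q n) t =
      -(2 * gn α ε lam l n.natAbs) * duh (dGn α ε lam l n.natAbs) (srcCoeff l q n) t -
      bn lam l n.natAbs * duh (Gn α ε lam l n.natAbs) (srcCoeff l q n) t := by
    unfold duh
    rw [← intervalIntegral.integral_const_mul, ← intervalIntegral.integral_const_mul,
      ← intervalIntegral.integral_sub (i1.const_mul _) (i2.const_mul _)]
    refine intervalIntegral.integral_congr fun τ _ => ?_
    ring
  -- G_n'(0) = 1 is what produces the source term; in the first derivative G_n(0) = 0 produced none.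
  rw [e, dGn_zero, gn, bn_natAbs, modeV, modeU]
  ring

/-- In ε(U'' + (α + εb)U' + bU) the unbounded factors b gather into εb(εU' + U). What remains,
`modeR`, involves only U' and the source, with no power of n. -/
lemma hasDerivAt_modeW (hl : 0 < l) (hq : Source l K q) (n : ℤ) {t : ℝ} (ht : 0 < t) :
    HasDerivAt (modeW α ε lam l q n)
      (-(ε * bZ lam l n) * modeW α ε lam l q n t + modeR α ε lam l q n t) t := by
  refine (((hq.hasDerivAt_modeV hl n ht).const_mul ε).add
    (hq.hasDerivAt_modeU hl n ht)).congr_deriv ?_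
  unfold modeW modeR; ring

lemma continuousOn_modeU (hl : 0 < l) (hq : Source l K q) (n : ℤ) :
    ContinuousOn (modeU α ε lam l q n) (Set.Ici 0) :=
  (continuousOn_duh (hasDerivAt_Gn α ε lam l n.natAbs) (continuous_dGn _ _ _ _ _)
    (hq.continuousOn_srcCoeff hl n) (fun _ ht => hq.abs_srcCoeff_le hl n ht)).neg

lemma continuousOn_modeV (hl : 0 < l) (hq : Source l K q) (n : ℤ) :
    ContinuousOn (modeV α ε lam l q n) (Set.Ici 0) := by
  have hG := continuous_Gn α ε lam l n.natAbs
  have hdG := continuous_dGn α ε lam l n.natAbs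
  exact (continuousOn_duh (hasDerivAt_dGn α ε lam l n.natAbs) (by fun_prop)
    (hq.continuousOn_srcCoeff hl n) (fun t ht => hq.abs_srcCoeff_le hl n ht)).neg

lemma continuousOn_modeW (hl : 0 < l) (hq : Source l K q) (n : ℤ) :
    ContinuousOn (modeW α ε lam l q n) (Set.Ici 0) :=
  (continuousOn_const.mul (hq.continuousOn_modeV hl n)).add (hq.continuousOn_modeU hl n)

lemma continuousOn_modeR (hl : 0 < l) (hq : Source l K q) (n : ℤ) :
    ContinuousOn (modeR α ε lam l q n) (Set.Ioi 0) :=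
  (continuousOn_const.mul ((hq.continuousOn_modeV hl n).mono Set.Ioi_subset_Ici_self)).sub
    (continuousOn_const.mul (hq.continuousOn_srcCoeff hl n))

end Source

/-- The decay of the modes, with a constant that depends on the coefficients only. -/
lemma exists_mode_bound {α ε lam l : ℝ} (hα : 0 < α) (hε : 0 < ε) (hlam : 0 < lam) (hl : 0 < l) :
    ∃ C > 0, ∀ (K : ℝ) (q : ℝ → ℝ → ℝ), Source l K q → ∀ (n : ℤ) (t : ℝ), 0 ≤ t →
      |modeU α ε lam l q n t| ≤ C * K * wt n ^ (-2 : ℝ) ∧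
      |modeV α ε lam l q n t| ≤ C * K * wt n ^ (-2 : ℝ) := by
  obtain ⟨C, hC, hG⟩ := exists_Gn_bounds l hα hε hlam
  obtain ⟨c, hc, hcb⟩ := exists_le_bZ (lam := lam) hlam hl
  refine ⟨2 * (C / c) * l, by positivity, fun K q hq n t ht => ?_⟩
  obtain ⟨-, h1, h2⟩ := hG n.natAbs
  rw [bn_natAbs] at h1 h2
  have hb : C / bZ lam l n ≤ C / c * wt n ^ (-2 : ℝ) := by
    have e : wt n ^ (-2 : ℝ) = (wt n ^ 2)⁻¹ := by
      rw [Real.rpow_neg (wt_pos n).le]; norm_cast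
    have hw : 0 < wt n ^ 2 := pow_pos (wt_pos n) 2
    rw [e, ← div_eq_mul_inv, div_div]
    exact div_le_div_of_nonneg_left hC.le (by positivity) (hcb n)
  have hK : 0 ≤ K := hq.nonneg hl
  have hA : 0 ≤ C / bZ lam l n := div_nonneg hC.le (bZ_nonneg _ _ _)
  have fin : 2 * (C / bZ lam l n) * (K * l) ≤ 2 * (C / c) * l * K * wt n ^ (-2 : ℝ) := by
    have := mul_le_mul_of_nonneg_right hb (show 0 ≤ 2 * (K * l) by positivity)
    linarith
  have bd : ∀ t, 0 < t → |srcCoeff l q n t| ≤ K * l := fun t ht => hq.abs_srcCoeff_le hl n ht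
  rw [modeU, modeV, abs_neg, abs_neg]
  exact ⟨(abs_duh_le hA h1 bd ht).trans fin, (abs_duh_le hA h2 bd ht).trans fin⟩

namespace Source

variable {l K : ℝ} {q : ℝ → ℝ → ℝ} {α ε lam : ℝ}

lemma weightedBdd_modeV (hα : 0 < α) (hε : 0 < ε) (hlam : 0 < lam) (hl : 0 < l)
    (hq : Source l K q) {σ : ℝ} (hσ : σ < 1) :
    WeightedBdd σ (modeV α ε lam l q) (Set.Ici 0) := by
  obtain ⟨C, hC, h⟩ := exists_mode_bound hα hε hlam hl
  exact WeightedBdd.of_decay (b := 2) (mul_nonneg hC.le (hq.nonneg hl)) (by linarith)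
    fun n t ht => (h K q hq n t ht).2

lemma weightedBdd_modeU (hα : 0 < α) (hε : 0 < ε) (hlam : 0 < lam) (hl : 0 < l)
    (hq : Source l K q) {σ : ℝ} (hσ : σ < 1) :
    WeightedBdd σ (modeU α ε lam l q) (Set.Ici 0) := by
  obtain ⟨C, hC, h⟩ := exists_mode_bound hα hε hlam hl
  exact WeightedBdd.of_decay (b := 2) (mul_nonneg hC.le (hq.nonneg hl)) (by linarith)
    fun n t ht => (h K q hq n t ht).1

/-- Bessel's inequality bounds the coefficients in ℓ² uniformly in time; any weight below -1/2 then
gives ℓ¹. -/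
lemma weightedBdd_srcCoeff (hl : 0 < l) (hq : Source l K q) :
    WeightedBdd (-(5 / 8)) (srcCoeff l q) (Set.Ioi 0) := by
  refine WeightedBdd.of_sq (τ := 0) (C := 2 * l ^ 2 * K ^ 2) (by norm_num) fun t ht s => ?_
  refine le_trans (Finset.sum_le_sum fun n _ => ?_)
    (sum_sq_coeff_le hl (hq.continuousOn_left ht) (fun x hx => hq.bound x hx t ht) s)
  rw [Real.rpow_zero, one_mul, sq_abs, srcCoeff]
  linarith [sq_nonneg (cosCoeff l (fun x => q x t) n)]

lemma weightedBdd_modeR (hα : 0 < α) (hε : 0 < ε) (hlam : 0 < lam) (hl : 0 < l)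
    (hq : Source l K q) : WeightedBdd (-(5 / 8)) (modeR α ε lam l q) (Set.Ioi 0) := by
  have h1 := ((hq.weightedBdd_modeV hα hε hlam hl (σ := -(5 / 8)) (by norm_num)).mono
    Set.Ioi_subset_Ici_self).const_mul (1 - ε * α)
  have h2 := (hq.weightedBdd_srcCoeff hl).const_mul (-ε)
  refine (h1.add h2).of_le_one id (fun _ h => h) fun n t _ => le_of_eq ?_
  unfold modeR; simp only [id]; congr 1; ring

/-- The modes of `ε u_t + u` have more than one derivative in `x` to spare. -/
lemma weightedBdd_modeW (hα : 0 < α) (hε : 0 < ε) (hlam : 0 < lam) (hl : 0 < l)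
    (hq : Source l K q) (T : ℝ) :
    WeightedBdd (5 / 4) (modeW α ε lam l q) (Set.Ioc 0 T) := by
  obtain ⟨c, hc, hcb⟩ := exists_le_bZ (lam := lam) hlam hl
  -- -5/8 + 15/8 = 5/4. Zero initial data allow C₀ = 0, which removes the term singular at t = 0.
  obtain ⟨A, B, -, hB, h⟩ := exists_smoothing (σ := -(5 / 8)) (c := ε * c) (t₁ := 0) (T := T)
    (C₀ := 0) (b := fun n => ε * bZ lam l n) (y := modeW α ε lam l q) (R := modeR α ε lam l q)
    (by positivity) (fun n => by
      rw [mul_assoc]; exact mul_le_mul_of_nonneg_left (hcb n) hε.le)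
    (fun n => (hq.continuousOn_modeW hl n).mono Set.Icc_subset_Ici_self)
    (fun n t ht => hq.hasDerivAt_modeW hl n ht.1)
    (fun n => (hq.continuousOn_modeR hl n).mono fun _ h => h.1)
    ((hq.weightedBdd_modeR hα hε hlam hl).mono fun _ h => h.1)
    (fun s => by simp [modeW, modeV, modeU, duh_zero])
  refine ⟨B, hB, fun t ht s => ?_⟩
  have := h t ht s
  norm_num at this ⊢
  exact this

end Source

/-! ### Cutoff functions and localization -/

lemma tsum_eq_zero_of_odd {p : ℤ → ℝ} (hp : ∀ n, p (-n) = -p n) : ∑' n, p n = 0 := by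
  have h1 : ∑' n, p (-n) = ∑' n, p n := (Equiv.neg ℤ).tsum_eq p
  simp_rw [hp, tsum_neg] at h1
  linarith

/-- A smooth cutoff function that equals `1` near `x₀`, with its cosine series. -/
lemma exists_cutoff {l x₀ : ℝ} (hl : 0 < l) (hx₀ : x₀ ∈ Set.Ioo 0 l) :
    ∃ (φ : ℝ → ℝ) (p : ℤ → ℝ) (C r : ℝ), 0 < r ∧ ContDiff ℝ (⊤ : ℕ∞) φ ∧ HasCompactSupport φ ∧
      tsupport φ ⊆ Set.Ioo 0 l ∧ (∀ x ∈ Metric.ball x₀ r, φ x = 1 ∧ x ∈ Set.Ioo 0 l) ∧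
      (∀ n, p (-n) = p n) ∧ 0 ≤ C ∧ (∀ n, |p n| ≤ C * wt n ^ (-4 : ℝ)) ∧
      (∀ x ∈ Set.Ioo 0 l, ∑' n, p n * Real.cos (gamZ l n * x) = φ x) ∧
      ∀ x ∈ Metric.ball x₀ r, ∑' n, gamZ l n * p n * Real.sin (gamZ l n * x) = 0 ∧
        ∑' n, gamZ l n ^ 2 * p n * Real.cos (gamZ l n * x) = 0 := by
  set d := min x₀ (l - x₀) with hd
  have hd0 : 0 < d := lt_min hx₀.1 (by linarith [hx₀.2])
  let φ : ContDiffBump x₀ := ⟨d / 4, d / 2, by linarith, by linarith⟩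
  have hball : ∀ x, dist x x₀ ≤ d / 2 → x ∈ Set.Ioo 0 l := by
    intro x hx
    rw [Real.dist_eq, abs_le] at hx
    have h1 : d ≤ x₀ := min_le_left _ _
    have h2 : d ≤ l - x₀ := min_le_right _ _
    exact ⟨by linarith, by linarith⟩
  have hs : tsupport φ ⊆ Set.Ioo 0 l := by
    rw [φ.tsupport_eq]; exact fun x hx => hball x hx
  have hsm : ContDiff ℝ (⊤ : ℕ∞) φ := φ.contDiff
  obtain ⟨C, hC0, hC⟩ := exists_cosCoeff_decay hl hsm hs
  have hz : ∀ x, x ∉ Set.Ioo 0 l → φ x = 0 := fun x hx =>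
    image_eq_zero_of_notMem_tsupport fun h => hx (hs h)
  have hsum4 := (summable_wt_rpow (b := 4) (by norm_num)).mul_left C
  have hrep := fun x (hx : x ∈ Set.Ioo 0 l) => (hasSum_half_range hl hsm.continuous hz
    (Summable.of_norm_bounded hsum4 fun n => (hC n).1)
    (Summable.of_norm_bounded hsum4 fun n => (hC n).2) hx).1
  set p : ℤ → ℝ := fun n => cosCoeff l φ n / l with hp
  have hpb : ∀ n, |p n| ≤ C / l * wt n ^ (-4 : ℝ) := by
    intro n
    rw [hp, abs_div, abs_of_pos hl, div_mul_eq_mul_div, div_le_div_iff_of_pos_right hl]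
    exact (hC n).1
  have hser : ∀ x ∈ Set.Ioo 0 l, ∑' n, p n * Real.cos (gamZ l n * x) = φ x := by
    intro x hx
    have h1 := ((hrep x hx).div_const l).tsum_eq
    rw [mul_div_cancel_left₀ _ hl.ne'] at h1
    rw [← h1]
    exact tsum_congr fun n => by rw [hp]; ring
  have hone : ∀ x ∈ Metric.ball x₀ (d / 4), φ x = 1 ∧ x ∈ Set.Ioo 0 l := fun x hx =>
    ⟨φ.one_of_mem_closedBall (Metric.ball_subset_closedBall hx),
      hball x (by have := Metric.mem_ball.mp hx; linarith)⟩
  -- After two factors γ_n a weight 1/2 remains, enough for termwise differentiation.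
  have hw4 : WeightedBdd (5 / 2) (fun n (_ : ℝ) => p n) (Set.univ : Set ℝ) :=
    WeightedBdd.of_decay (b := 4) (C := C / l) (by positivity) (by norm_num) fun n _ _ => hpb n
  have hg1 : WeightedBdd (3 / 2) (fun n x => -(gamZ l n * p n * Real.sin (gamZ l n * x)))
      (Set.univ : Set ℝ) := by
    refine WeightedBdd.of_le (Real.pi / l) 1 (by positivity [Real.pi_pos])
      (by norm_num; exact hw4) id (fun _ h => h) fun n x _ => ?_
    rw [abs_neg, abs_mul, abs_mul, Real.rpow_one]
    exact (mul_le_of_le_one_right (by positivity) (Real.abs_sin_le_one _)).trans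
      (mul_le_mul_of_nonneg_right (abs_gamZ_le hl n) (abs_nonneg _))
  have hg2 : WeightedBdd (1 / 2) (fun n x => gamZ l n ^ 2 * p n * Real.cos (gamZ l n * x))
      (Set.univ : Set ℝ) := by
    refine WeightedBdd.of_le ((Real.pi / l) ^ 2) 2 (by positivity)
      (by norm_num; exact hw4) id (fun _ h => h) fun n x _ => ?_
    have h2 := pow_le_pow_left₀ (abs_nonneg _) (abs_gamZ_le hl n) 2
    rw [mul_pow] at h2
    rw [abs_mul, abs_mul, abs_pow]
    refine (mul_le_of_le_one_right (by positivity) (Real.abs_cos_le_one _)).trans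
      (mul_le_mul_of_nonneg_right ?_ (abs_nonneg _))
    exact_mod_cast h2
  have hpa : Summable (fun n => |p n|) := by
    have := (hw4.mono_exp (show (0 : ℝ) ≤ 5 / 2 by norm_num)).summable_weighted (Set.mem_univ 0)
    simpa using this
  have D1 : ∀ x, HasDerivAt (fun y => ∑' n, p n * Real.cos (gamZ l n * y))
      (∑' n, -(gamZ l n * p n * Real.sin (gamZ l n * x))) x := fun x =>
    hg1.hasDerivAt_tsum (by norm_num) isOpen_univ (fun n y _ => by
      have := (((hasDerivAt_id y).const_mul (gamZ l n)).cos).const_mul (p n)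
      refine this.congr_deriv ?_
      simp only [id]; ring)
      (fun y _ => (summable_mul_of_abs_le_one hpa fun n => Real.abs_cos_le_one _).of_abs)
      (Set.mem_univ x)
  have D2 : ∀ x, HasDerivAt (fun y => ∑' n, gamZ l n * p n * Real.sin (gamZ l n * y))
      (∑' n, gamZ l n ^ 2 * p n * Real.cos (gamZ l n * x)) x := fun x =>
    hg2.hasDerivAt_tsum (by norm_num) isOpen_univ (fun n y _ => by
      have := (((hasDerivAt_id y).const_mul (gamZ l n)).sin).const_mul (gamZ l n * p n)
      refine this.congr_deriv ?_
      simp only [id]; ring)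
      (fun y _ => (hg1.summable (by norm_num) (Set.mem_univ y)).neg.congr fun n => neg_neg _)
      (Set.mem_univ x)
  -- The cosine series equals φ = 1 on the ball, so its first and second termwise derivatives vanish
  -- there.
  have Z1 : ∀ x ∈ Metric.ball x₀ (d / 4),
      ∑' n, gamZ l n * p n * Real.sin (gamZ l n * x) = 0 := by
    intro x hx
    have hev : (fun y => ∑' n, p n * Real.cos (gamZ l n * y)) =ᶠ[𝓝 x] fun _ => (1 : ℝ) := by
      filter_upwards [Metric.isOpen_ball.mem_nhds hx] with y hy
      rw [hser y (hone y hy).2, (hone y hy).1]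
    have h1 := (D1 x).unique ((hasDerivAt_const x (1 : ℝ)).congr_of_eventuallyEq hev)
    rw [tsum_neg] at h1
    linarith
  refine ⟨φ, p, C / l, d / 4, by linarith, hsm, φ.hasCompactSupport, hs, hone, fun n => ?_,
    by positivity, hpb, hser, fun x hx => ⟨Z1 x hx, ?_⟩⟩
  · simp only [hp, cosCoeff, gamZ_neg, neg_mul, Real.cos_neg]
  · have hev : (fun y => ∑' n, gamZ l n * p n * Real.sin (gamZ l n * y)) =ᶠ[𝓝 x]
        fun _ => (0 : ℝ) := by
      filter_upwards [Metric.isOpen_ball.mem_nhds hx] with y hy using Z1 y hy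
    exact (D2 x).unique ((hasDerivAt_const x (0 : ℝ)).congr_of_eventuallyEq hev)

/-- The sine series with time dependent coefficients `c n t`. -/
def sinSeries (l : ℝ) (c : ℤ → ℝ → ℝ) (x t : ℝ) : ℝ := ∑' n, c n t * Real.sin (gamZ l n * x)

lemma hasSum_integral_mul {ι : Type*} [Countable ι] {g : ℝ → ℝ} {e : ι → ℝ → ℝ} {B : ι → ℝ}
    {T : ℝ} (hT : 0 ≤ T) (hg : IntervalIntegrable g MeasureTheory.volume 0 T)
    (he : ∀ i, Continuous (e i)) (hB : Summable B) (hb : ∀ i, ∀ x ∈ Set.Ioc 0 T, |e i x| ≤ B i) :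
    HasSum (fun i => ∫ x in (0 : ℝ)..T, g x * e i x)
      (∫ x in (0 : ℝ)..T, g x * ∑' i, e i x) := by
  refine intervalIntegral.hasSum_integral_of_dominated_convergence (fun i x => |g x| * B i)
    (fun i => ?_) (fun i => Eventually.of_forall fun x hx => ?_)
    (Eventually.of_forall fun x _ => hB.mul_left |g x|) ?_
    (Eventually.of_forall fun x hx => ?_)
  · exact (intervalIntegrable_iff.mp (hg.mul_continuousOn (he i).continuousOn)).aestronglyMeasurable
  · rw [Set.uIoc_of_le hT] at hx
    rw [norm_mul]
    exact mul_le_mul_of_nonneg_left (hb i x hx) (norm_nonneg _)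
  · have e : (fun x => ∑' i, |g x| * B i) = fun x => |g x| * ∑' i, B i :=
      funext fun x => tsum_mul_left
    rw [e]
    exact hg.abs.mul_const _
  · rw [Set.uIoc_of_le hT] at hx
    exact (Summable.of_norm_bounded hB fun i => hb i x hx).hasSum.mul_left (g x)

namespace Source

variable {l K : ℝ} {q : ℝ → ℝ → ℝ}

lemma intervalIntegrable (hl : 0 < l) (hq : Source l K q) {t : ℝ} (ht : 0 < t) :
    IntervalIntegrable (fun x => q x t) MeasureTheory.volume 0 l := by
  rw [intervalIntegrable_iff_integrableOn_Ioo_of_le hl.le]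
  exact MeasureTheory.IntegrableOn.of_bound (by simp)
    ((hq.continuousOn_left ht).aestronglyMeasurable measurableSet_Ioo) K
    ((MeasureTheory.ae_restrict_iff' measurableSet_Ioo).mpr
      (Eventually.of_forall fun x hx => hq.bound x hx t ht))

/-- Multiplication by a cutoff function acts on the sine coefficients as a convolution. -/
lemma conv_srcCoeff (hl : 0 < l) (hq : Source l K q) {φ : ℝ → ℝ} {p : ℤ → ℝ}
    (hp : Summable (fun n => |p n|)) (hev : ∀ n, p (-n) = p n)
    (hφ : ∀ x ∈ Set.Ioo 0 l, ∑' n, p n * Real.cos (gamZ l n * x) = φ x) (n : ℤ) {t : ℝ}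
    (ht : 0 < t) :
    conv p (fun m => srcCoeff l q m t) n = sinCoeff l (fun x => φ x * q x t) n := by
  have h := hasSum_integral_mul (g := fun x => q x t)
    (e := fun m x => p (n - m) * Real.sin (gamZ l m * x)) (B := fun m => |p (n - m)|) hl.le
    (hq.intervalIntegrable hl ht) (fun m => by fun_prop) (summable_shift hp n)
    (fun m x _ => by
      rw [abs_mul]; exact mul_le_of_le_one_right (abs_nonneg _) (Real.abs_sin_le_one _))
  have e1 : conv p (fun m => srcCoeff l q m t) n =
      ∑' m, ∫ x in (0 : ℝ)..l, q x t * (p (n - m) * Real.sin (gamZ l m * x)) := by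
    refine tsum_congr fun m => ?_
    change p (n - m) * sinCoeff l (fun x => q x t) m = _
    rw [sinCoeff, ← intervalIntegral.integral_const_mul]
    refine intervalIntegral.integral_congr fun x _ => ?_
    ring
  rw [e1, h.tsum_eq, sinCoeff]
  refine intervalIntegral.integral_congr_Ioo_of_le hl.le fun x hx => ?_
  have hc := summable_mul_of_abs_le_one hp fun k => Real.abs_cos_le_one (gamZ l k * x)
  have hs := summable_mul_of_abs_le_one hp fun k => Real.abs_sin_le_one (gamZ l k * x)
  have hzero : ∑' k, p k * Real.sin (gamZ l k * x) = 0 := tsum_eq_zero_of_odd fun k => by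
    rw [hev, gamZ_neg, neg_mul, Real.sin_neg]; ring
  have e2 : ∑' m, p (n - m) * Real.sin (gamZ l m * x) =
      ∑' k, p k * Real.sin (gamZ l (n - k) * x) := by
    -- With k = n - m the subtraction formula leaves sin(γ_n x) times the cosine series of φ; the
    -- sine series of the even sequence p vanishes.
    rw [← tsum_shift (fun k => p k * Real.sin (gamZ l (n - k) * x)) n]
    exact tsum_congr fun m => by rw [sub_sub_cancel]
  have e3 : ∀ k, p k * Real.sin (gamZ l (n - k) * x) =
      Real.sin (gamZ l n * x) * (p k * Real.cos (gamZ l k * x)) -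
      Real.cos (gamZ l n * x) * (p k * Real.sin (gamZ l k * x)) := by
    intro k
    rw [gamZ_sub, sub_mul, Real.sin_sub]; ring
  simp only [e2, e3]
  rw [(hc.of_abs.mul_left _).tsum_sub (hs.of_abs.mul_left _), tsum_mul_left, tsum_mul_left,
    hφ x hx, hzero]
  ring

/-- The localized source has uniformly summable coefficients and is represented by its series. -/
lemma weightedBdd_cutoff (hl : 0 < l) (hq : Source l K q) {φ : ℝ → ℝ}
    (hφ : ContDiff ℝ (⊤ : ℕ∞) φ) (hφc : HasCompactSupport φ) (hφs : tsupport φ ⊆ Set.Ioo 0 l)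
    {t₁ T : ℝ} (ht₁ : 0 < t₁) :
    WeightedBdd (1 / 4) (fun n t => sinCoeff l (fun x => φ x * q x t) n) (Set.Icc t₁ T) ∧
    ∀ t ∈ Set.Icc t₁ T, ∀ x ∈ Set.Ioo 0 l,
      ∑' n, sinCoeff l (fun x => φ x * q x t) n * Real.sin (gamZ l n * x) =
        l * (φ x * q x t) := by
  have hdφ : Continuous (deriv φ) := (contDiff_infty_iff_deriv.mp hφ).2.continuous
  have hDφ : ∀ x, HasDerivAt φ (deriv φ x) x := fun x =>
    (hφ.differentiable (by simp)).differentiableAt.hasDerivAt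
  have hz : ∀ x, x ∉ Set.Ioo 0 l → ∀ᶠ y in 𝓝 x, φ y = 0 ∧ deriv φ y = 0 := by
    intro x hx
    have h1 : x ∉ tsupport φ := fun h => hx (hφs h)
    have h2 : (tsupport φ)ᶜ ∈ 𝓝 x := (isClosed_tsupport φ).isOpen_compl.mem_nhds h1
    filter_upwards [h2] with y hy
    exact ⟨image_eq_zero_of_notMem_tsupport hy,
      image_eq_zero_of_notMem_tsupport fun h => hy (tsupport_deriv_subset h)⟩
  obtain ⟨A, hA⟩ := hφc.exists_bound_of_continuous hφ.continuous
  obtain ⟨A', hA'⟩ := hφc.deriv.exists_bound_of_continuous hdφ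
  have hA0 : 0 ≤ A := (norm_nonneg _).trans (hA 0)
  have hA0' : 0 ≤ A' := (norm_nonneg _).trans (hA' 0)
  have hK0 : 0 ≤ K := hq.nonneg hl
  -- The x-derivative of the source is merely continuous in the open strip; compactness of the
  -- support of φ and of [t₁, T] with t₁ > 0 supplies the bound.
  obtain ⟨Q, hQ⟩ := (hφc.isCompact.prod (isCompact_Icc (a := t₁) (b := T))).exists_bound_of_continuousOn
    (hq.continuousOn_dx.mono (Set.prod_mono hφs fun t ht => lt_of_lt_of_le ht₁ ht.1))
  set M := A * K + A' * K + A * |Q| with hM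
  have pos : ∀ t ∈ Set.Icc t₁ T, 0 < t := fun t ht => lt_of_lt_of_le ht₁ ht.1
  have hg : ∀ t ∈ Set.Icc t₁ T, ∀ x, HasDerivAt (fun x => φ x * q x t)
      (deriv φ x * q x t + φ x * dx q x t) x := by
    intro t ht x
    by_cases hx : x ∈ Set.Ioo 0 l
    · exact (hDφ x).mul (hq.differentiableAt x hx t (pos t ht)).hasDerivAt
    · have h1 := hz x hx
      rw [h1.self_of_nhds.1, h1.self_of_nhds.2, zero_mul, zero_mul, add_zero]
      refine (hasDerivAt_const x (0 : ℝ)).congr_of_eventuallyEq ?_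
      filter_upwards [h1] with y hy
      rw [hy.1, zero_mul]
  have hg' : ∀ t ∈ Set.Icc t₁ T, Continuous (fun x => deriv φ x * q x t + φ x * dx q x t) := by
    intro t ht
    rw [continuous_iff_continuousAt]
    intro x
    by_cases hx : x ∈ Set.Ioo 0 l
    · have h1 := (hq.continuousOn_left (pos t ht)).continuousAt (isOpen_Ioo.mem_nhds hx)
      have h2 : ContinuousOn (fun x => dx q x t) (Set.Ioo 0 l) :=
        hq.continuousOn_dx.comp (f := fun x => (x, t)) (by fun_prop) fun _ hx => ⟨hx, pos t ht⟩
      have h2 := h2.continuousAt (isOpen_Ioo.mem_nhds hx)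
      exact (hdφ.continuousAt.mul h1).add (hφ.continuous.continuousAt.mul h2)
    · refine (continuousAt_const (y := (0 : ℝ))).congr ?_
      filter_upwards [hz x hx] with y hy
      rw [hy.1, hy.2, zero_mul, zero_mul, add_zero]
  have h0 : ∀ t, ∀ x, x ∉ Set.Ioo 0 l → φ x * q x t = 0 := fun t x hx => by
    rw [(hz x hx).self_of_nhds.1, zero_mul]
  have hb : ∀ t ∈ Set.Icc t₁ T, ∀ x ∈ Set.Ioo 0 l, |φ x * q x t| ≤ M := by
    intro t ht x hx
    rw [abs_mul]
    have := mul_le_mul (hA x) (hq.bound x hx t (pos t ht)) (abs_nonneg _) hA0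
    rw [Real.norm_eq_abs] at this
    have : 0 ≤ A' * K + A * |Q| := by positivity
    linarith
  have hb' : ∀ t ∈ Set.Icc t₁ T, ∀ x ∈ Set.Ioo 0 l,
      |deriv φ x * q x t + φ x * dx q x t| ≤ M := by
    intro t ht x hx
    have h1 := mul_le_mul (hA' x) (hq.bound x hx t (pos t ht)) (abs_nonneg _) hA0'
    have h2 : |φ x * dx q x t| ≤ A * |Q| := by
      by_cases hxs : x ∈ tsupport φ
      · rw [abs_mul]
        exact mul_le_mul (hA x) ((hQ (x, t) ⟨hxs, ht⟩).trans (le_abs_self Q)) (abs_nonneg _) hA0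
      · rw [image_eq_zero_of_notMem_tsupport hxs, zero_mul, abs_zero]; positivity
    refine (abs_add_le _ _).trans ?_
    rw [abs_mul (deriv φ x)]
    rw [Real.norm_eq_abs] at h1
    have : 0 ≤ A * K := by positivity
    linarith
  obtain ⟨w1, w2⟩ := weightedBdd_coeff (S := Set.Icc t₁ T) (g := fun t x => φ x * q x t)
    (g' := fun t x => deriv φ x * q x t + φ x * dx q x t) hl hg hg'
    (fun t _ => ⟨h0 t 0 fun h => lt_irrefl _ h.1, h0 t l fun h => lt_irrefl _ h.2⟩) hb hb'
  refine ⟨w2, fun t ht x hx => ?_⟩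
  exact (hasSum_half_range hl
    (continuous_iff_continuousAt.mpr fun x => (hg t ht x).continuousAt) (h0 t)
    (w1.summable (by norm_num) ht) (w2.summable (by norm_num) ht) hx).2.tsum_eq

end Source

lemma wt_rpow_two (n : ℤ) : wt n ^ (2 : ℝ) = wt n ^ 2 := by norm_cast

lemma abs_gamZ_sq_le {l : ℝ} (hl : 0 < l) (n : ℤ) :
    |gamZ l n ^ 2| ≤ (Real.pi / l) ^ 2 * wt n ^ (2 : ℝ) := by
  have h2 := pow_le_pow_left₀ (abs_nonneg _) (abs_gamZ_le hl n) 2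
  rw [mul_pow] at h2
  rwa [abs_pow, wt_rpow_two]

/-- Near every point of the open strip, the series of `ε u_t + u` agrees with a series whose
coefficients decay fast enough for two derivatives in `x`. -/
lemma exists_local_series {α ε lam l K : ℝ} {q : ℝ → ℝ → ℝ} (hα : 0 < α) (hε : 0 < ε)
    (hlam : 0 < lam) (hl : 0 < l) (hq : Source l K q) {x₀ t₀ : ℝ} (hx₀ : x₀ ∈ Set.Ioo 0 l)
    (ht₀ : 0 < t₀) :
    ∃ (r : ℝ) (a R : ℤ → ℝ → ℝ), 0 < r ∧
      WeightedBdd (17 / 8) a (Set.Icc (t₀ / 2) (t₀ + 1)) ∧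
      WeightedBdd (1 / 4) R (Set.Icc (t₀ / 2) (t₀ + 1)) ∧
      (∀ n, ContinuousOn (R n) (Set.Ioi 0)) ∧
      (∀ n t, 0 < t → HasDerivAt (a n) (-(ε * bZ lam l n) * a n t + R n t) t) ∧
      ∀ x ∈ Metric.ball x₀ r, x ∈ Set.Ioo 0 l ∧ ∀ t ∈ Set.Icc (t₀ / 2) (t₀ + 1),
        sinSeries l (modeW α ε lam l q) x t = sinSeries l a x t ∧
        sinSeries l R x t =
          (1 - ε * α) * sinSeries l (modeV α ε lam l q) x t - ε * (l * q x t) := by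
  obtain ⟨φ, p, Cp, r, hr, hφ, hφc, hφs, hone, hev, hCp, hpd, hser, hz⟩ := exists_cutoff hl hx₀
  obtain ⟨c, hc, hcb⟩ := exists_le_bZ (lam := lam) hlam hl
  obtain ⟨Cm, hCm, hmode⟩ := exists_mode_bound hα hε hlam hl
  set W := modeW α ε lam l q with hW
  set V := modeV α ε lam l q with hV
  set F := srcCoeff l q with hF
  have hK0 : 0 ≤ K := hq.nonneg hl
  have hpi := Real.pi_pos
  set p1 : ℤ → ℝ := fun n => gamZ l n * p n with hp1
  set p2 : ℤ → ℝ := fun n => gamZ l n ^ 2 * p n with hp2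
  have hpw : WeightedBdd (9 / 4) (fun n (_ : Unit) => p n) Set.univ :=
    WeightedBdd.of_decay hCp (by norm_num) fun n _ _ => hpd n
  have hp1w : WeightedBdd (5 / 4) (fun n (_ : Unit) => p1 n) Set.univ := by
    refine WeightedBdd.of_le (Real.pi / l) 1 (by positivity) (by norm_num; exact hpw) id
      (fun _ h => h) fun n _ _ => ?_
    rw [hp1, abs_mul, Real.rpow_one]
    exact mul_le_mul_of_nonneg_right (abs_gamZ_le hl n) (abs_nonneg _)
  have hp2w : WeightedBdd (1 / 4) (fun n (_ : Unit) => p2 n) Set.univ := by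
    refine WeightedBdd.of_le ((Real.pi / l) ^ 2) 2 (by positivity) (by norm_num; exact hpw) id
      (fun _ h => h) fun n _ _ => ?_
    rw [hp2, abs_mul]
    exact mul_le_mul_of_nonneg_right (abs_gamZ_sq_le hl n) (abs_nonneg _)
  have hp14 := (hpw.mono_exp (show (1 / 4 : ℝ) ≤ 9 / 4 by norm_num)).summable_weighted
    (Set.mem_univ ())
  have hp114 := (hp1w.mono_exp (show (1 / 4 : ℝ) ≤ 5 / 4 by norm_num)).summable_weighted
    (Set.mem_univ ())
  have hp214 := hp2w.summable_weighted (Set.mem_univ ())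
  have hpa : Summable (fun n => |p n|) :=
    (hpw.summable (by norm_num) (Set.mem_univ ())).abs
  have hp1a : Summable (fun n => |p1 n|) :=
    (hp1w.summable (by norm_num) (Set.mem_univ ())).abs
  have hp2a : Summable (fun n => |p2 n|) :=
    (hp2w.summable (by norm_num) (Set.mem_univ ())).abs
  -- uniform bounds for the modes
  have hWd : ∀ n t, 0 < t → |W n t| ≤ (ε + 1) * (Cm * K) * wt n ^ (-2 : ℝ) := by
    intro n t ht
    obtain ⟨h1, h2⟩ := hmode K q hq n t ht.le
    rw [hW]; unfold modeW
    refine (abs_add_le _ _).trans ?_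
    rw [abs_mul, abs_of_pos hε]
    nlinarith [mul_le_mul_of_nonneg_left h2 hε.le]
  have hw2 : ∀ n, wt n ^ (-2 : ℝ) * wt n ^ (2 : ℝ) = 1 := fun n => by
    rw [← Real.rpow_add (wt_pos n)]; norm_num
  have hw2' : ∀ n, wt n ^ (-2 : ℝ) ≤ 1 := fun n =>
    Real.rpow_le_one_of_one_le_of_nonpos (one_le_wt n) (by norm_num)
  set D := (ε + 1) * (Cm * K) with hD
  have hD0 : 0 ≤ D := by positivity
  have hWb : ∀ n t, 0 < t → |W n t| ≤ D := fun n t ht =>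
    (hWd n t ht).trans (mul_le_of_le_one_right hD0 (hw2' n))
  have hW1b : ∀ n t, 0 < t → |gamZ l n * W n t| ≤ Real.pi / l * D := by
    intro n t ht
    have h1 : wt n ≤ wt n ^ (2 : ℝ) := by
      rw [wt_rpow_two]; nlinarith [one_le_wt n]
    rw [abs_mul]
    calc |gamZ l n| * |W n t| ≤ (Real.pi / l * wt n ^ (2 : ℝ)) * (D * wt n ^ (-2 : ℝ)) := by
          refine mul_le_mul ((abs_gamZ_le hl n).trans ?_) (hWd n t ht) (abs_nonneg _)
            (mul_nonneg (by positivity) (wt_rpow_nonneg _ _))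
          exact mul_le_mul_of_nonneg_left h1 (by positivity)
      _ = Real.pi / l * D * (wt n ^ (-2 : ℝ) * wt n ^ (2 : ℝ)) := by ring
      _ = _ := by rw [hw2, mul_one]
  have hVb : ∀ n t, 0 < t → |V n t| ≤ Cm * K := fun n t ht =>
    ((hmode K q hq n t ht.le).2).trans (mul_le_of_le_one_right (by positivity) (hw2' n))
  have hFb : ∀ n t, 0 < t → |F n t| ≤ K * l := fun n t ht => hq.abs_srcCoeff_le hl n ht
  set DR := |1 - ε * α| * (Cm * K) + ε * (K * l) with hDR
  have hRb : ∀ n t, 0 < t → |modeR α ε lam l q n t| ≤ DR := by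
    intro n t ht
    unfold modeR
    refine (abs_sub _ _).trans ?_
    rw [abs_mul, abs_mul ε, abs_of_pos hε]
    exact add_le_add (mul_le_mul_of_nonneg_left (hVb n t ht) (abs_nonneg _))
      (mul_le_mul_of_nonneg_left (hFb n t ht) hε.le)
  set DB := ε * (((Real.pi / l) ^ 2 + lam ^ 2 / 4) * D) with hDB
  have hW'b : ∀ n t, 0 < t → |-(ε * bZ lam l n) * W n t + modeR α ε lam l q n t| ≤ DB + DR := by
    intro n t ht
    refine (abs_add_le _ _).trans (add_le_add ?_ (hRb n t ht))
    have h0 := bZ_nonneg lam l n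
    rw [abs_mul, abs_neg, abs_of_nonneg (mul_nonneg hε.le h0)]
    calc ε * bZ lam l n * |W n t|
        ≤ ε * (((Real.pi / l) ^ 2 + lam ^ 2 / 4) * wt n ^ (2 : ℝ)) * (D * wt n ^ (-2 : ℝ)) := by
          refine mul_le_mul (mul_le_mul_of_nonneg_left ?_ hε.le) (hWd n t ht) (abs_nonneg _)
            (mul_nonneg hε.le (mul_nonneg (by positivity) (wt_rpow_nonneg _ _)))
          rw [wt_rpow_two]; exact bZ_le hl n
      _ = DB * (wt n ^ (-2 : ℝ) * wt n ^ (2 : ℝ)) := by rw [hDB]; ring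
      _ = _ := by rw [hw2, mul_one]
  -- the localized coefficients
  set a : ℤ → ℝ → ℝ := fun n t => conv p (fun m => W m t) n with ha
  -- The last two terms are the coefficients of the commutator -ε(2φ'W_x + φ''W), with φ' and φ''
  -- encoded by γ_n p_n and γ_n² p_n.
  set R : ℤ → ℝ → ℝ := fun n t => conv p (fun m => modeR α ε lam l q m t) n +
    2 * ε * conv p1 (fun m => gamZ l m * W m t) n + ε * conv p2 (fun m => W m t) n with hR
  have hWc : ∀ n, ContinuousOn (W n) (Set.Ioi 0) := fun n =>
    (hq.continuousOn_modeW hl n).mono Set.Ioi_subset_Ici_self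
  have hRc : ∀ n, ContinuousOn (R n) (Set.Ioi 0) := fun n =>
    ((continuousOn_conv hpa (fun m => hq.continuousOn_modeR hl m) hRb n).add
      (continuousOn_const.mul (continuousOn_conv hp1a
        (fun m => continuousOn_const.mul (hWc m)) hW1b n))).add
      (continuousOn_const.mul (continuousOn_conv hp2a hWc hWb n))
  have had : ∀ n t, 0 < t → HasDerivAt (a n) (-(ε * bZ lam l n) * a n t + R n t) t := by
    intro n t ht
    refine (hasDerivAt_conv hpa isOpen_Ioi isPreconnected_Ioi
      (fun m s hs => hq.hasDerivAt_modeW hl m hs) hWb hW'b n ht).congr_deriv ?_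
    have s0 := summable_conv_term hpa (fun m => hWb m t ht) n
    have s1 := summable_conv_term hpa (fun m => hRb m t ht) n
    have s2 := summable_conv_term hp1a (fun m => hW1b m t ht) n
    have s3 := summable_conv_term hp2a (fun m => hWb m t ht) n
    have hs := (((s0.hasSum.mul_left (-(ε * bZ lam l n))).add s1.hasSum).add
      (s2.hasSum.mul_left (2 * ε))).add (s3.hasSum.mul_left ε)
    have e : -(ε * bZ lam l n) * a n t + R n t =
        -(ε * bZ lam l n) * (∑' m, p (n - m) * W m t) +
          (∑' m, p (n - m) * modeR α ε lam l q m t) +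
          2 * ε * (∑' m, p1 (n - m) * (gamZ l m * W m t)) +
          ε * (∑' m, p2 (n - m) * W m t) := by
      simp only [ha, hR, conv]; ring
    rw [e, ← hs.tsum_eq]
    refine tsum_congr fun m => ?_
    -- Squaring this identity is the Leibniz rule on the Fourier side: b_n - b_m = 2γ_{n-m}γ_m +
    -- γ_{n-m}².
    have eg : gamZ l n = gamZ l (n - m) + gamZ l m := by rw [gamZ_sub]; ring
    simp only [hp1, hp2, bZ, eg]
    ring
  -- weighted bounds
  have hT0 : 0 < t₀ / 4 := by linarith
  have hWw : WeightedBdd (5 / 4) W (Set.Icc (t₀ / 4) (t₀ + 1)) :=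
    (hq.weightedBdd_modeW hα hε hlam hl (t₀ + 1)).mono fun t ht => ⟨hT0.trans_le ht.1, ht.2⟩
  have hW1w : WeightedBdd (1 / 4) (fun n t => gamZ l n * W n t)
      (Set.Icc (t₀ / 4) (t₀ + 1)) := by
    refine WeightedBdd.of_le (Real.pi / l) 1 (by positivity) (by norm_num; exact hWw) id
      (fun _ h => h) fun n t _ => ?_
    rw [abs_mul, Real.rpow_one]
    exact mul_le_mul_of_nonneg_right (abs_gamZ_le hl n) (abs_nonneg _)
  have hWw' := hWw.mono_exp (show (1 / 4 : ℝ) ≤ 5 / 4 by norm_num)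
  have hVw : WeightedBdd (1 / 4) V (Set.Icc (t₀ / 4) (t₀ + 1)) :=
    (hq.weightedBdd_modeV hα hε hlam hl (by norm_num)).mono fun t ht => hT0.le.trans ht.1
  obtain ⟨hcut, hcutser⟩ := hq.weightedBdd_cutoff hl hφ hφc hφs (T := t₀ + 1) hT0
  have hconvR : ∀ n t, 0 < t → conv p (fun m => modeR α ε lam l q m t) n =
      (1 - ε * α) * conv p (fun m => V m t) n -
        ε * sinCoeff l (fun x => φ x * q x t) n := by
    intro n t ht
    rw [← hq.conv_srcCoeff hl hpa hev hser n ht]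
    have s1 := summable_conv_term hpa (fun m => hVb m t ht) n
    have s2 := summable_conv_term hpa (fun m => hFb m t ht) n
    have := ((s1.hasSum.mul_left (1 - ε * α)).sub (s2.hasSum.mul_left ε)).tsum_eq
    refine Eq.trans (tsum_congr fun m => ?_) this
    simp only [modeR]; ring
  -- The global right side has only weight -5/8. After localization its source part consists of sine
  -- coefficients of φq, which is C¹ and vanishes near the ends, and the weight rises to 1/4.
  have hR1w : WeightedBdd (1 / 4) (fun n t => conv p (fun m => modeR α ε lam l q m t) n)
      (Set.Icc (t₀ / 4) (t₀ + 1)) := by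
    refine ((((hVw.conv (by norm_num) hp14).const_mul (1 - ε * α))).add
      (hcut.const_mul (-ε))).of_le_one id (fun _ h => h) fun n t ht => le_of_eq ?_
    rw [hconvR n t (hT0.trans_le ht.1)]
    simp only [id]; congr 1; ring
  have hRw : WeightedBdd (1 / 4) R (Set.Icc (t₀ / 4) (t₀ + 1)) :=
    (hR1w.add ((hW1w.conv (by norm_num) hp114).const_mul (2 * ε))).add
      ((hWw'.conv (by norm_num) hp214).const_mul ε)
  have haw : WeightedBdd (1 / 4) a (Set.Icc (t₀ / 4) (t₀ + 1)) :=
    hWw'.conv (by norm_num) hp14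
  obtain ⟨C₀, hC₀, haC⟩ := haw
  -- Starting at t₀/4 keeps the source bounds away from t = 0, and the singular factor (t -
  -- t₀/4)^{-15/16} is bounded from t₀/2 on. The outcome 1/4 + 15/8 = 17/8 exceeds 2.
  obtain ⟨A, B, hA, hB, hsm⟩ := exists_smoothing (σ := 1 / 4) (c := ε * c) (t₁ := t₀ / 4)
    (T := t₀ + 1) (C₀ := C₀) (b := fun n => ε * bZ lam l n) (y := a) (R := R)
    (by positivity) (fun n => by
      rw [mul_assoc]; exact mul_le_mul_of_nonneg_left (hcb n) hε.le)
    (fun n t ht => (had n t (hT0.trans_le ht.1)).continuousAt.continuousWithinAt)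
    (fun n t ht => had n t (hT0.trans ht.1))
    (fun n => (hRc n).mono fun t ht => hT0.trans ht.1)
    (hRw.mono Set.Ioc_subset_Icc_self)
    (haC _ ⟨le_rfl, by linarith⟩)
  have hsub : Set.Icc (t₀ / 2) (t₀ + 1) ⊆ Set.Icc (t₀ / 4) (t₀ + 1) :=
    Set.Icc_subset_Icc_left (by linarith)
  have hafin : WeightedBdd (17 / 8) a (Set.Icc (t₀ / 2) (t₀ + 1)) := by
    refine ⟨A * C₀ * (t₀ / 4) ^ (-(15 / 16) : ℝ) + B, by positivity, fun t ht s => ?_⟩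
    have h1 := hsm t ⟨by linarith [ht.1], ht.2⟩ s
    have h2 : (t - t₀ / 4) ^ (-(15 / 16) : ℝ) ≤ (t₀ / 4) ^ (-(15 / 16) : ℝ) :=
      Real.rpow_le_rpow_of_nonpos hT0 (by linarith [ht.1]) (by norm_num)
    have h3 := mul_le_mul_of_nonneg_left h2 (mul_nonneg hA hC₀)
    norm_num at h1 h3 ⊢
    linarith
  refine ⟨r, a, R, hr, hafin, hRw.mono hsub, hRc, had, fun x hx => ⟨(hone x hx).2, fun t ht => ?_⟩⟩
  have ht0 : 0 < t := by linarith [ht.1]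
  -- Of the six multiplier series, three vanish by parity and two because φ is locally constant;
  -- this one remains. Hence on the ball localization changes neither the series of w nor the right
  -- side, and the commutator sums to zero.
  have hcos : ∑' k, p k * Real.cos (gamZ l k * x) = 1 := by
    rw [hser x (hone x hx).2, (hone x hx).1]
  have hsin : ∑' k, p k * Real.sin (gamZ l k * x) = 0 := tsum_eq_zero_of_odd fun k => by
    rw [hev, gamZ_neg, neg_mul, Real.sin_neg]; ring
  have hcos1 : ∑' k, p1 k * Real.cos (gamZ l k * x) = 0 := tsum_eq_zero_of_odd fun k => by
    simp only [hp1, hev, gamZ_neg, neg_mul, Real.cos_neg]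
  have hsin2 : ∑' k, p2 k * Real.sin (gamZ l k * x) = 0 := tsum_eq_zero_of_odd fun k => by
    simp only [hp2]; rw [hev, gamZ_neg, neg_mul, Real.sin_neg]; ring
  have hsin1 : ∑' k, p1 k * Real.sin (gamZ l k * x) = 0 := (hz x hx).1
  have hcos2 : ∑' k, p2 k * Real.cos (gamZ l k * x) = 0 := (hz x hx).2
  have ht4 := hsub ht
  have qW := (hWw.summable (by norm_num) ht4).abs
  have qV := (hVw.summable (by norm_num) ht4).abs
  have qW1 := (hW1w.summable (by norm_num) ht4).abs
  have k0 := hasSum_conv_mul_sin l x hpa qW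
  have k1 := hasSum_conv_mul_sin l x hp1a qW1
  have k2 := hasSum_conv_mul_sin l x hp2a qW
  have kV := hasSum_conv_mul_sin l x hpa qV
  rw [hcos, hsin, one_mul, zero_mul, add_zero] at k0 kV
  rw [hcos1, hsin1, zero_mul, zero_mul, add_zero] at k1
  rw [hcos2, hsin2, zero_mul, zero_mul, add_zero] at k2
  refine ⟨k0.tsum_eq.symm, ?_⟩
  have kF : HasSum (fun n => sinCoeff l (fun x => φ x * q x t) n * Real.sin (gamZ l n * x))
      (l * (φ x * q x t)) := by
    rw [← hcutser t ht4 x (hone x hx).2]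
    exact (summable_mul_of_abs_le_one (hcut.summable (by norm_num) ht4).abs
      fun n => Real.abs_sin_le_one _).of_abs.hasSum
  rw [(hone x hx).1, one_mul] at kF
  have kk := (((kV.mul_left (1 - ε * α)).sub (kF.mul_left ε)).add (k1.mul_left (2 * ε))).add
    (k2.mul_left ε)
  rw [mul_zero, mul_zero, add_zero, add_zero] at kk
  refine Eq.trans (tsum_congr fun n => ?_) kk.tsum_eq
  simp only [hR]
  rw [hconvR n t ht0]
  ring

/-! ### Interior regularity of the sine series -/

namespace Source

variable {α ε lam l K : ℝ} {q : ℝ → ℝ → ℝ}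

/-- Interior regularity of the series of `ε u_t + u`, and the heat equation that it satisfies. -/
lemma interior_regularity (hα : 0 < α) (hε : 0 < ε) (hlam : 0 < lam) (hl : 0 < l)
    (hq : Source l K q) {x₀ t₀ : ℝ} (hx₀ : x₀ ∈ Set.Ioo 0 l) (ht₀ : 0 < t₀) :
    let W := sinSeries l (modeW α ε lam l q)
    DifferentiableAt ℝ (fun y => W y t₀) x₀ ∧
    ContinuousAt (Function.uncurry (dx W)) (x₀, t₀) ∧
    DifferentiableAt ℝ (fun y => dx W y t₀) x₀ ∧
    ContinuousAt (Function.uncurry (dx (dx W))) (x₀, t₀) ∧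
    HasDerivAt (W x₀) (ε * (dx (dx W) x₀ t₀ - lam ^ 2 / 4 * W x₀ t₀) +
      ((1 - ε * α) * sinSeries l (modeV α ε lam l q) x₀ t₀ - ε * (l * q x₀ t₀))) t₀ := by
  intro W
  obtain ⟨r, a, R, hr, ha, hR, hRc, had, hloc⟩ := exists_local_series hα hε hlam hl hq hx₀ ht₀
  -- An open window around t₀ is available at every positive time because a `Source` lives on all of
  -- (0, ∞).
  set J := Set.Ioo (t₀ / 2) (t₀ + 1) with hJ
  have hJs : J ⊆ Set.Icc (t₀ / 2) (t₀ + 1) := Set.Ioo_subset_Icc_self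
  have hJ0 : ∀ t ∈ J, 0 < t := fun t ht => by linarith [ht.1]
  have hJt : t₀ ∈ J := ⟨by linarith, by linarith⟩
  have hball : Metric.ball x₀ r ∈ 𝓝 x₀ := Metric.ball_mem_nhds x₀ hr
  have hN : Metric.ball x₀ r ×ˢ J ∈ 𝓝 (x₀, t₀) :=
    prod_mem_nhds hball (isOpen_Ioo.mem_nhds hJt)
  have hac : ∀ n, ContinuousOn (a n) J := fun n t ht =>
    (had n t (hJ0 t ht)).continuousAt.continuousWithinAt
  set A1 : ℝ → ℝ → ℝ := fun x t => ∑' n, gamZ l n * a n t * Real.cos (gamZ l n * x) with hA1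
  set A2 : ℝ → ℝ → ℝ := fun x t => ∑' n, -(gamZ l n ^ 2 * a n t * Real.sin (gamZ l n * x)) with hA2
  have hpi := Real.pi_pos
  have w0 : WeightedBdd (17 / 8) (fun n (z : ℝ × ℝ) => a n z.2 * Real.sin (gamZ l n * z.1))
      (Set.univ ×ˢ J) := ha.of_le_one (fun z => z.2) (fun z hz => hJs hz.2) fun n z _ => by
    rw [abs_mul]; exact mul_le_of_le_one_right (abs_nonneg _) (Real.abs_sin_le_one _)
  have w1 : WeightedBdd (9 / 8)
      (fun n (z : ℝ × ℝ) => gamZ l n * a n z.2 * Real.cos (gamZ l n * z.1)) (Set.univ ×ˢ J) := by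
    refine WeightedBdd.of_le (Real.pi / l) 1 (by positivity) (by norm_num; exact ha)
      (fun z => z.2) (fun z hz => hJs hz.2) fun n z _ => ?_
    rw [abs_mul, abs_mul, Real.rpow_one]
    exact (mul_le_of_le_one_right (by positivity) (Real.abs_cos_le_one _)).trans
      (mul_le_mul_of_nonneg_right (abs_gamZ_le hl n) (abs_nonneg _))
  have w2 : WeightedBdd (1 / 8)
      (fun n (z : ℝ × ℝ) => -(gamZ l n ^ 2 * a n z.2 * Real.sin (gamZ l n * z.1)))
      (Set.univ ×ˢ J) := by
    refine WeightedBdd.of_le ((Real.pi / l) ^ 2) 2 (by positivity) (by norm_num; exact ha)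
      (fun z => z.2) (fun z hz => hJs hz.2) fun n z _ => ?_
    rw [abs_neg, abs_mul, abs_mul]
    exact (mul_le_of_le_one_right (by positivity) (Real.abs_sin_le_one _)).trans
      (mul_le_mul_of_nonneg_right (abs_gamZ_sq_le hl n) (abs_nonneg _))
  have w3 : WeightedBdd (1 / 8)
      (fun n t => (-(ε * bZ lam l n) * a n t + R n t) * Real.sin (gamZ l n * x₀)) J := by
    have h1 : WeightedBdd (1 / 8) (fun n t => -(ε * bZ lam l n) * a n t) J := by
      refine WeightedBdd.of_le (ε * ((Real.pi / l) ^ 2 + lam ^ 2 / 4)) 2 (by positivity)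
        (by norm_num; exact ha) id (fun t ht => hJs ht) fun n t _ => ?_
      rw [abs_mul, abs_neg, abs_of_nonneg (mul_nonneg hε.le (bZ_nonneg _ _ _)), wt_rpow_two,
        mul_assoc ε _ (wt n ^ 2)]
      exact mul_le_mul_of_nonneg_right (mul_le_mul_of_nonneg_left (bZ_le hl n) hε.le)
        (abs_nonneg _)
    have h2 : WeightedBdd (1 / 8) R J := (hR.mono hJs).mono_exp (by norm_num)
    refine (h1.add h2).of_le_one id (fun _ h => h) fun n t _ => ?_
    rw [abs_mul]; exact mul_le_of_le_one_right (abs_nonneg _) (Real.abs_sin_le_one _)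
  have D1 : ∀ t ∈ J, ∀ x, HasDerivAt (fun y => sinSeries l a y t) (A1 x t) x := by
    intro t ht x
    have w1' : WeightedBdd (9 / 8) (fun n x => gamZ l n * a n t * Real.cos (gamZ l n * x))
        (Set.univ : Set ℝ) :=
      w1.of_le_one (fun x => (x, t)) (fun _ _ => ⟨Set.mem_univ _, ht⟩) fun n x _ => le_rfl
    refine w1'.hasDerivAt_tsum (by norm_num) isOpen_univ (fun n y _ => ?_) (fun y _ => ?_)
      (Set.mem_univ x)
    · refine ((((hasDerivAt_id y).const_mul (gamZ l n)).sin).const_mul (a n t)).congr_deriv ?_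
      simp only [id]; ring
    · exact w0.summable (p := (y, t)) (by norm_num) ⟨Set.mem_univ _, ht⟩
  have D2 : ∀ t ∈ J, ∀ x, HasDerivAt (fun y => A1 y t) (A2 x t) x := by
    intro t ht x
    have w2' : WeightedBdd (1 / 8) (fun n x => -(gamZ l n ^ 2 * a n t * Real.sin (gamZ l n * x)))
        (Set.univ : Set ℝ) :=
      w2.of_le_one (fun x => (x, t)) (fun _ _ => ⟨Set.mem_univ _, ht⟩) fun n x _ => le_rfl
    refine w2'.hasDerivAt_tsum (by norm_num) isOpen_univ (fun n y _ => ?_) (fun y _ => ?_)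
      (Set.mem_univ x)
    · refine ((((hasDerivAt_id y).const_mul (gamZ l n)).cos).const_mul
        (gamZ l n * a n t)).congr_deriv ?_
      simp only [id]; ring
    · exact w1.summable (p := (y, t)) (by norm_num) ⟨Set.mem_univ _, ht⟩
  have cA1 : ContinuousOn (Function.uncurry A1) (Set.univ ×ˢ J) := by
    refine w1.continuousOn_tsum (by norm_num) fun n => ?_
    have : ContinuousOn (fun z : ℝ × ℝ => a n z.2) (Set.univ ×ˢ J) :=
      (hac n).comp continuousOn_snd fun z hz => hz.2
    exact (continuousOn_const.mul this).mul (by fun_prop)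
  have cA2 : ContinuousOn (Function.uncurry A2) (Set.univ ×ˢ J) := by
    refine w2.continuousOn_tsum (by norm_num) fun n => ?_
    have : ContinuousOn (fun z : ℝ × ℝ => a n z.2) (Set.univ ×ˢ J) :=
      (hac n).comp continuousOn_snd fun z hz => hz.2
    exact ((continuousOn_const.mul this).mul (by fun_prop)).neg
  have hNu : (Set.univ : Set ℝ) ×ˢ J ∈ 𝓝 (x₀, t₀) :=
    prod_mem_nhds univ_mem (isOpen_Ioo.mem_nhds hJt)
  have eW : ∀ x ∈ Metric.ball x₀ r, ∀ t ∈ J, W x t = sinSeries l a x t := fun x hx t ht =>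
    ((hloc x hx).2 t (hJs ht)).1
  have DW : ∀ x ∈ Metric.ball x₀ r, ∀ t ∈ J, HasDerivAt (fun y => W y t) (A1 x t) x := by
    intro x hx t ht
    refine (D1 t ht x).congr_of_eventuallyEq ?_
    filter_upwards [Metric.isOpen_ball.mem_nhds hx] with y hy using eW y hy t ht
  have edx : ∀ x ∈ Metric.ball x₀ r, ∀ t ∈ J, dx W x t = A1 x t := fun x hx t ht =>
    (DW x hx t ht).deriv
  have DW2 : ∀ x ∈ Metric.ball x₀ r, ∀ t ∈ J, HasDerivAt (fun y => dx W y t) (A2 x t) x := by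
    intro x hx t ht
    refine (D2 t ht x).congr_of_eventuallyEq ?_
    filter_upwards [Metric.isOpen_ball.mem_nhds hx] with y hy using edx y hy t ht
  have edx2 : ∀ x ∈ Metric.ball x₀ r, ∀ t ∈ J, dx (dx W) x t = A2 x t := fun x hx t ht =>
    (DW2 x hx t ht).deriv
  have hx0 := Metric.mem_ball_self (x := x₀) hr
  refine ⟨(DW x₀ hx0 t₀ hJt).differentiableAt, ?_, (DW2 x₀ hx0 t₀ hJt).differentiableAt, ?_, ?_⟩
  · refine (cA1.continuousAt hNu).congr ?_
    filter_upwards [hN] with z hz using (edx z.1 hz.1 z.2 hz.2).symm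
  · refine (cA2.continuousAt hNu).congr ?_
    filter_upwards [hN] with z hz using (edx2 z.1 hz.1 z.2 hz.2).symm
  -- In time the local series is differentiated through its mode equation: b_n costs two of the 17/8
  -- powers and leaves 1/8. Regrouping the result gives the heat equation.
  · have D3 : HasDerivAt (fun s => sinSeries l a x₀ s)
        (∑' n, (-(ε * bZ lam l n) * a n t₀ + R n t₀) * Real.sin (gamZ l n * x₀)) t₀ :=
      w3.hasDerivAt_tsum (by norm_num) isOpen_Ioo
        (fun n s hs => (had n s (hJ0 s hs)).mul_const _)
        (fun s hs => w0.summable (p := (x₀, s)) (by norm_num) ⟨Set.mem_univ _, hs⟩) hJt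
    have D4 := D3.congr_of_eventuallyEq (f₁ := W x₀) (by
      filter_upwards [isOpen_Ioo.mem_nhds hJt] with s hs using eW x₀ hx0 s hs)
    refine D4.congr_deriv ?_
    rw [edx2 x₀ hx0 t₀ hJt, eW x₀ hx0 t₀ hJt, ← ((hloc x₀ hx0).2 t₀ (hJs hJt)).2]
    have s0 := w0.summable (p := (x₀, t₀)) (by norm_num) ⟨Set.mem_univ _, hJt⟩
    have s2 := w2.summable (p := (x₀, t₀)) (by norm_num) ⟨Set.mem_univ _, hJt⟩
    have sR : Summable (fun n => R n t₀ * Real.sin (gamZ l n * x₀)) :=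
      (summable_mul_of_abs_le_one (hR.summable (by norm_num) (hJs hJt)).abs
        fun n => Real.abs_sin_le_one _).of_abs
    have hs := (((s2.hasSum.sub (s0.hasSum.mul_left (lam ^ 2 / 4))).mul_left ε).add
      sR.hasSum).tsum_eq
    refine Eq.trans (tsum_congr fun n => ?_) hs
    simp only [bZ]; ring

lemma weightedBdd_sin {c : ℤ → ℝ → ℝ} {S : Set ℝ} {σ : ℝ} (hc : WeightedBdd σ c S) :
    WeightedBdd σ (fun n (z : ℝ × ℝ) => c n z.2 * Real.sin (gamZ l n * z.1))
      (Set.univ ×ˢ S) :=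
  hc.of_le_one (fun z => z.2) (fun z hz => hz.2) fun n z _ => by
    rw [abs_mul]; exact mul_le_of_le_one_right (abs_nonneg _) (Real.abs_sin_le_one _)

lemma continuousOn_sinSeries {c : ℤ → ℝ → ℝ} {S : Set ℝ} {σ : ℝ} (hσ : 0 < σ)
    (hc : WeightedBdd σ c S) (hcc : ∀ n, ContinuousOn (c n) S) :
    ContinuousOn (Function.uncurry (sinSeries l c)) (Set.univ ×ˢ S) := by
  refine (weightedBdd_sin hc).continuousOn_tsum hσ fun n => ?_
  have : ContinuousOn (fun z : ℝ × ℝ => c n z.2) (Set.univ ×ˢ S) :=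
    (hcc n).comp continuousOn_snd fun z hz => hz.2
  fun_prop

lemma hasDerivAt_sinSeries_modeU (hα : 0 < α) (hε : 0 < ε) (hlam : 0 < lam) (hl : 0 < l)
    (hq : Source l K q) (x : ℝ) {t : ℝ} (ht : 0 < t) :
    HasDerivAt (sinSeries l (modeU α ε lam l q) x) (sinSeries l (modeV α ε lam l q) x t) t := by
  have hV := weightedBdd_sin (l := l) (hq.weightedBdd_modeV hα hε hlam hl (σ := 1 / 2)
    (by norm_num))
  have hU := weightedBdd_sin (l := l) (hq.weightedBdd_modeU hα hε hlam hl (σ := 1 / 2)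
    (by norm_num))
  have hV' : WeightedBdd (1 / 2) (fun n t => modeV α ε lam l q n t * Real.sin (gamZ l n * x))
      (Set.Ioi 0) :=
    hV.of_le_one (fun t => (x, t)) (fun t ht => ⟨Set.mem_univ _, Set.Ioi_subset_Ici_self ht⟩)
      fun n t _ => le_rfl
  exact hV'.hasDerivAt_tsum (by norm_num) isOpen_Ioi
    (fun n s hs => (hq.hasDerivAt_modeU hl n hs).mul_const _)
    (fun s hs => hU.summable (p := (x, s)) (by norm_num)
      ⟨Set.mem_univ _, Set.Ioi_subset_Ici_self hs⟩) ht

lemma sinSeries_modeW (hα : 0 < α) (hε : 0 < ε) (hlam : 0 < lam) (hl : 0 < l)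
    (hq : Source l K q) (x : ℝ) {t : ℝ} (ht : 0 ≤ t) :
    sinSeries l (modeW α ε lam l q) x t =
      ε * sinSeries l (modeV α ε lam l q) x t + sinSeries l (modeU α ε lam l q) x t := by
  have hV := (weightedBdd_sin (l := l) (hq.weightedBdd_modeV hα hε hlam hl (σ := 1 / 2)
    (by norm_num))).summable (p := (x, t)) (by norm_num) ⟨Set.mem_univ _, ht⟩
  have hU := (weightedBdd_sin (l := l) (hq.weightedBdd_modeU hα hε hlam hl (σ := 1 / 2)
    (by norm_num))).summable (p := (x, t)) (by norm_num) ⟨Set.mem_univ _, ht⟩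
  refine Eq.trans (tsum_congr fun n => ?_) ((hV.hasSum.mul_left ε).add hU.hasSum).tsum_eq
  simp only [modeW]; ring

end Source

/-! ### The series solution: regularity and uniform bounds -/

/-- The solution with zero initial data, as a series. -/
def solU (α ε lam l : ℝ) (q : ℝ → ℝ → ℝ) (x t : ℝ) : ℝ :=
  Real.exp (lam / 2 * x) / l * sinSeries l (modeU α ε lam l q) x t

/-- The time derivative of `solU`. -/
def solV (α ε lam l : ℝ) (q : ℝ → ℝ → ℝ) (x t : ℝ) : ℝ :=
  Real.exp (lam / 2 * x) / l * sinSeries l (modeV α ε lam l q) x t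

namespace Source

variable {α ε lam l K : ℝ} {q : ℝ → ℝ → ℝ}

lemma continuousOn_solU (hα : 0 < α) (hε : 0 < ε) (hlam : 0 < lam) (hl : 0 < l)
    (hq : Source l K q) :
    ContinuousOn (Function.uncurry (solU α ε lam l q)) (Set.univ ×ˢ Set.Ici 0) :=
  ContinuousOn.mul (f := fun z : ℝ × ℝ => Real.exp (lam / 2 * z.1) / l) (by fun_prop)
    (continuousOn_sinSeries (σ := 1 / 2) (by norm_num)
      (hq.weightedBdd_modeU hα hε hlam hl (by norm_num)) fun n => hq.continuousOn_modeU hl n)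

lemma continuousOn_solV (hα : 0 < α) (hε : 0 < ε) (hlam : 0 < lam) (hl : 0 < l)
    (hq : Source l K q) :
    ContinuousOn (Function.uncurry (solV α ε lam l q)) (Set.univ ×ˢ Set.Ici 0) :=
  ContinuousOn.mul (f := fun z : ℝ × ℝ => Real.exp (lam / 2 * z.1) / l) (by fun_prop)
    (continuousOn_sinSeries (σ := 1 / 2) (by norm_num)
      (hq.weightedBdd_modeV hα hε hlam hl (by norm_num)) fun n => hq.continuousOn_modeV hl n)

lemma hasDerivAt_solU (hα : 0 < α) (hε : 0 < ε) (hlam : 0 < lam) (hl : 0 < l)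
    (hq : Source l K q) (x : ℝ) {t : ℝ} (ht : 0 < t) :
    HasDerivAt (solU α ε lam l q x) (solV α ε lam l q x t) t :=
  (hq.hasDerivAt_sinSeries_modeU hα hε hlam hl x ht).const_mul _

lemma solU_zero (x : ℝ) : solU α ε lam l q x 0 = 0 := by
  simp [solU, sinSeries, modeU, duh_zero]

lemma solV_zero (x : ℝ) : solV α ε lam l q x 0 = 0 := by
  simp [solV, sinSeries, modeV, duh_zero]

/-- For t > 0 the series is differentiated termwise; at t = 0 the one-sided derivative is the limit
of the derivatives, by continuity of the differentiated series up to t = 0. -/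
lemma hasDerivWithinAt_solU (hα : 0 < α) (hε : 0 < ε) (hlam : 0 < lam) (hl : 0 < l)
    (hq : Source l K q) (x : ℝ) {t : ℝ} (ht : 0 ≤ t) :
    HasDerivWithinAt (solU α ε lam l q x) (solV α ε lam l q x t) (Set.Ici 0) t := by
  rcases eq_or_lt_of_le ht with h | h
  · subst h
    have sl : ∀ {g : ℝ → ℝ → ℝ}, ContinuousOn (Function.uncurry g) (Set.univ ×ˢ Set.Ici 0) →
        ContinuousWithinAt (g x) (Set.Ioi 0) 0 := fun {g} hg =>
      ((hg.comp (f := fun s : ℝ => (x, s)) (by fun_prop)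
        fun s hs => ⟨Set.mem_univ _, hs⟩) 0 Set.self_mem_Ici).mono Set.Ioi_subset_Ici_self
    refine hasDerivWithinAt_Ici_of_tendsto_deriv (s := Set.Ioi 0)
      (fun s hs => (hq.hasDerivAt_solU hα hε hlam hl x hs).differentiableAt.differentiableWithinAt)
      (sl (hq.continuousOn_solU hα hε hlam hl)) self_mem_nhdsWithin ?_
    refine (sl (hq.continuousOn_solV hα hε hlam hl)).tendsto.congr' ?_
    filter_upwards [self_mem_nhdsWithin] with s hs
    exact (hq.hasDerivAt_solU hα hε hlam hl x hs).deriv.symm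
  · exact (hq.hasDerivAt_solU hα hε hlam hl x h).hasDerivWithinAt

/-- Interior regularity of the solution, and the equation, written as a heat equation for
`w = ε u_t + u`. -/
lemma interior_regularity_sol (hα : 0 < α) (hε : 0 < ε) (hlam : 0 < lam) (hl : 0 < l)
    (hq : Source l K q) {x t : ℝ} (hx : x ∈ Set.Ioo 0 l) (ht : 0 < t) :
    let w : ℝ → ℝ → ℝ := fun y s => ε * solV α ε lam l q y s + solU α ε lam l q y s
    DifferentiableAt ℝ (fun y => w y t) x ∧
    ContinuousAt (Function.uncurry (dx w)) (x, t) ∧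
    DifferentiableAt ℝ (fun y => dx w y t) x ∧
    ContinuousAt (Function.uncurry (dx (dx w))) (x, t) ∧
    HasDerivAt (w x) (ε * (dx (dx w) x t - lam * dx w x t) +
      ((1 - ε * α) * solV α ε lam l q x t - ε * (Real.exp (lam / 2 * x) * q x t))) t := by
  intro w
  set W := sinSeries l (modeW α ε lam l q) with hW
  have reg := fun y (hy : y ∈ Set.Ioo 0 l) s (hs : 0 < s) =>
    hq.interior_regularity hα hε hlam hl hy hs
  have ew : ∀ y s, 0 ≤ s → w y s = Real.exp (lam / 2 * y) / l * W y s := by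
    intro y s hs
    rw [hW, hq.sinSeries_modeW hα hε hlam hl y hs]
    simp only [w, solU, solV]; ring
  have hE : ∀ y, HasDerivAt (fun y => Real.exp (lam / 2 * y) / l)
      (lam / 2 * (Real.exp (lam / 2 * y) / l)) y := by
    intro y
    refine ((hasDerivAt_exp_mul (lam / 2) y).div_const l).congr_deriv ?_
    ring
  have d1 : ∀ y ∈ Set.Ioo 0 l, ∀ s, 0 < s → HasDerivAt (fun y => w y s)
      (Real.exp (lam / 2 * y) / l * (lam / 2 * W y s + dx W y s)) y := by
    intro y hy s hs
    have h1 := (hE y).mul (reg y hy s hs).1.hasDerivAt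
    have e : (fun y => w y s) = fun y => Real.exp (lam / 2 * y) / l * W y s :=
      funext fun y => ew y s hs.le
    rw [e]
    refine h1.congr_deriv ?_
    simp only [dx]; ring
  have e1 : ∀ y ∈ Set.Ioo 0 l, ∀ s, 0 < s → dx w y s =
      Real.exp (lam / 2 * y) / l * (lam / 2 * W y s + dx W y s) := fun y hy s hs =>
    (d1 y hy s hs).deriv
  -- With E = e^{λx/2}/l and w = EW, one gets w_xx - λw_x = E(W_xx - λ²W/4): the drift returns in
  -- exchange for the constant in b_n.
  have d2 : ∀ y ∈ Set.Ioo 0 l, ∀ s, 0 < s → HasDerivAt (fun y => dx w y s)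
      (Real.exp (lam / 2 * y) / l * (lam ^ 2 / 4 * W y s + lam * dx W y s + dx (dx W) y s)) y := by
    intro y hy s hs
    have h2 := ((reg y hy s hs).1.hasDerivAt.const_mul (lam / 2)).add
      (reg y hy s hs).2.2.1.hasDerivAt
    have h1 := (hE y).mul h2
    have e : (fun y => dx w y s) =ᶠ[𝓝 y]
        fun y => Real.exp (lam / 2 * y) / l * (lam / 2 * W y s + dx W y s) := by
      filter_upwards [isOpen_Ioo.mem_nhds hy] with z hz using e1 z hz s hs
    refine HasDerivAt.congr_of_eventuallyEq (h1.congr_deriv ?_) e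
    simp only [dx, Pi.add_apply]; ring
  have e2 : ∀ y ∈ Set.Ioo 0 l, ∀ s, 0 < s → dx (dx w) y s =
      Real.exp (lam / 2 * y) / l * (lam ^ 2 / 4 * W y s + lam * dx W y s + dx (dx W) y s) :=
    fun y hy s hs => (d2 y hy s hs).deriv
  have hN : Set.Ioo 0 l ×ˢ Set.Ioi 0 ∈ 𝓝 (x, t) :=
    prod_mem_nhds (isOpen_Ioo.mem_nhds hx) (Ioi_mem_nhds ht)
  have cW : ContinuousAt (Function.uncurry W) (x, t) := by
    have h1 : WeightedBdd (1 / 2) (modeW α ε lam l q) (Set.Ici 0) :=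
      ((hq.weightedBdd_modeV hα hε hlam hl (by norm_num)).const_mul ε).add
        (hq.weightedBdd_modeU hα hε hlam hl (by norm_num))
    exact (continuousOn_sinSeries (by norm_num) h1 fun n =>
      hq.continuousOn_modeW hl n).continuousAt (prod_mem_nhds univ_mem (Ici_mem_nhds ht))
  obtain ⟨-, r2, -, r4, r5⟩ := reg x hx t ht
  refine ⟨(d1 x hx t ht).differentiableAt, ?_, (d2 x hx t ht).differentiableAt, ?_, ?_⟩
  · have : ContinuousAt (fun z : ℝ × ℝ => Real.exp (lam / 2 * z.1) / l *
        (lam / 2 * Function.uncurry W z + Function.uncurry (dx W) z)) (x, t) := by fun_prop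
    refine this.congr ?_
    filter_upwards [hN] with z hz using (e1 z.1 hz.1 z.2 hz.2).symm
  · have : ContinuousAt (fun z : ℝ × ℝ => Real.exp (lam / 2 * z.1) / l *
        (lam ^ 2 / 4 * Function.uncurry W z + lam * Function.uncurry (dx W) z +
          Function.uncurry (dx (dx W)) z)) (x, t) := by fun_prop
    refine this.congr ?_
    filter_upwards [hN] with z hz using (e2 z.1 hz.1 z.2 hz.2).symm
  · have h1 := (r5.const_mul (Real.exp (lam / 2 * x) / l)).congr_of_eventuallyEq
      (f₁ := w x) (by
        filter_upwards [Ioi_mem_nhds ht] with s hs using ew x s (le_of_lt hs))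
    refine h1.congr_deriv ?_
    rw [e1 x hx t ht, e2 x hx t ht]
    simp only [solV]
    have := hl.ne'
    field_simp
    ring

/-- The mode bounds are O(K (1 + |n|)⁻²), which is summable; e^{λx/2} is at most e^{λl/2} on [0, l].
-/
lemma exists_sol_bound (hα : 0 < α) (hε : 0 < ε) (hlam : 0 < lam) (hl : 0 < l) :
    ∃ C > 0, ∀ (K : ℝ) (q : ℝ → ℝ → ℝ), Source l K q → ∀ x ∈ Set.Icc 0 l, ∀ t, 0 ≤ t →
      |solU α ε lam l q x t| ≤ C * K ∧ |solV α ε lam l q x t| ≤ C * K := by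
  obtain ⟨C, hC, h⟩ := exists_mode_bound hα hε hlam hl
  have hs := summable_wt_rpow (b := 2) (by norm_num)
  set S := ∑' n, wt n ^ (-2 : ℝ) with hS
  have hS0 : 0 ≤ S := tsum_nonneg fun n => wt_rpow_nonneg _ _
  refine ⟨Real.exp (lam / 2 * l) / l * (C * (S + 1)), by positivity,
    fun K q hq x hx t ht => ?_⟩
  have hK : 0 ≤ K := hq.nonneg hl
  have key : ∀ c : ℤ → ℝ → ℝ, (∀ n, |c n t| ≤ C * K * wt n ^ (-2 : ℝ)) →
      |Real.exp (lam / 2 * x) / l * sinSeries l c x t| ≤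
        Real.exp (lam / 2 * l) / l * (C * (S + 1)) * K := by
    intro c hc
    have h1 : |sinSeries l c x t| ≤ C * K * S := by
      rw [hS, ← tsum_mul_left]
      refine tsum_of_norm_bounded (f := fun n => c n t * Real.sin (gamZ l n * x))
        (hs.mul_left (C * K)).hasSum fun n => ?_
      rw [norm_mul]
      exact (mul_le_of_le_one_right (norm_nonneg _) (Real.abs_sin_le_one _)).trans (hc n)
    have h2 : Real.exp (lam / 2 * x) / l ≤ Real.exp (lam / 2 * l) / l := by
      rw [div_le_div_iff_of_pos_right hl]
      exact Real.exp_le_exp.mpr (mul_le_mul_of_nonneg_left hx.2 (by positivity))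
    rw [abs_mul, abs_of_pos (by positivity)]
    refine (mul_le_mul h2 h1 (abs_nonneg _) (by positivity)).trans ?_
    have h3 : C * K * S ≤ C * (S + 1) * K := by nlinarith [mul_nonneg hC.le hK]
    calc _ ≤ Real.exp (lam / 2 * l) / l * (C * (S + 1) * K) :=
          mul_le_mul_of_nonneg_left h3 (by positivity)
      _ = _ := by ring
  exact ⟨key _ fun n => (h K q hq n t ht).1, key _ fun n => (h K q hq n t ht).2⟩

lemma sol_boundary (hl : 0 < l) (q : ℝ → ℝ → ℝ) (t : ℝ) :
    solU α ε lam l q 0 t = 0 ∧ solU α ε lam l q l t = 0 ∧ solV α ε lam l q 0 t = 0 ∧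
      solV α ε lam l q l t = 0 := by
  have hs : ∀ n, Real.sin (gamZ l n * l) = 0 := fun n => by
    rw [gamZ, div_mul_cancel₀ _ hl.ne', Real.sin_int_mul_pi]
  simp [solU, solV, sinSeries, hs]

end Source

/-! ### Maximum principle and behaviour for small times -/

/-- A positive second derivative would make x a local minimum as well, so f would be locally
constant and its second derivative zero. -/
lemma deriv_deriv_nonpos_of_isLocalMax {f : ℝ → ℝ} {x : ℝ} (h : IsLocalMax f x)
    (hc : ContinuousAt f x) : deriv (deriv f) x ≤ 0 := by
  by_contra hpos
  push Not at hpos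
  have hmin := isLocalMin_of_deriv_deriv_pos hpos h.deriv_eq_zero hc
  have hconst : f =ᶠ[𝓝 x] fun _ => f x := by
    filter_upwards [h, hmin] with y h1 h2 using le_antisymm h1 h2
  have h3 : deriv f =ᶠ[𝓝 x] fun _ => (0 : ℝ) := by
    filter_upwards [hconst.eventuallyEq_nhds] with y hy
    rw [hy.deriv_eq, deriv_const]
  rw [h3.deriv_eq, deriv_const] at hpos
  exact lt_irrefl _ hpos

/-- Left difference quotients suffice, so a maximum attained at the final time is covered. -/
lemma HasDerivAt.nonneg_of_le_left {f : ℝ → ℝ} {d t : ℝ} (ht : 0 < t) (hd : HasDerivAt f d t)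
    (hle : ∀ s ∈ Set.Icc 0 t, f s ≤ f t) : 0 ≤ d := by
  have h1 : Tendsto (slope f t) (𝓝[<] t) (𝓝 d) :=
    (hasDerivAt_iff_tendsto_slope.mp hd).mono_left
      (nhdsWithin_mono t fun s hs => (ne_of_lt hs))
  refine ge_of_tendsto h1 ?_
  filter_upwards [Ioo_mem_nhdsLT ht] with s hs
  rw [slope_def_field]
  exact div_nonneg_of_nonpos (by linarith [hle s ⟨hs.1.le, hs.2.le⟩]) (by linarith [hs.2])

/-- The maximum principle for `w_t = ε (w_xx - λ w_x) + g` with `g ≤ M`. -/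
lemma le_mul_of_heat {ε lam l T M : ℝ} (hε : 0 ≤ ε) (hM : 0 ≤ M) {w g : ℝ → ℝ → ℝ}
    (hc : ContinuousOn (Function.uncurry w) (Set.Icc 0 l ×ˢ Set.Icc 0 T))
    (h0 : ∀ x ∈ Set.Icc 0 l, w x 0 ≤ 0)
    (hb : ∀ t ∈ Set.Icc 0 T, w 0 t ≤ 0 ∧ w l t ≤ 0)
    (hd : ∀ x ∈ Set.Ioo 0 l, ∀ t ∈ Set.Ioc 0 T,
      HasDerivAt (w x) (ε * (dx (dx w) x t - lam * dx w x t) + g x t) t)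
    (hg : ∀ x ∈ Set.Ioo 0 l, ∀ t ∈ Set.Ioc 0 T, g x t ≤ M) {x t : ℝ} (hx : x ∈ Set.Icc 0 l)
    (ht : t ∈ Set.Icc 0 T) : w x t ≤ M * t := by
  have key : ∀ η > 0, w x t ≤ (M + η) * t := by
    intro η hη
    -- The slack η makes the contradiction strict: a positive maximum of w - (M + η)t must be
    -- interior in x with s > 0, where w_t ≥ M + η, while w_x = 0, w_xx ≤ 0 and the equation force
    -- w_t ≤ M.
    have hzc : ContinuousOn (fun z : ℝ × ℝ => Function.uncurry w z - (M + η) * z.2)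
        (Set.Icc 0 l ×ˢ Set.Icc 0 T) := hc.sub (by fun_prop)
    obtain ⟨⟨y, s⟩, ⟨hy, hs⟩, hmax⟩ := (isCompact_Icc.prod isCompact_Icc).exists_isMaxOn
      ⟨(x, t), hx, ht⟩ hzc
    have hmax' : ∀ a ∈ Set.Icc 0 l, ∀ b ∈ Set.Icc 0 T,
        w a b - (M + η) * b ≤ w y s - (M + η) * s := fun a ha b hb =>
      isMaxOn_iff.mp hmax (a, b) ⟨ha, hb⟩
    have hnp : w y s - (M + η) * s ≤ 0 := by
      by_contra hpos
      push Not at hpos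
      simp only at hy hs
      have hMs : 0 ≤ (M + η) * s := mul_nonneg (by linarith) hs.1
      have hwpos : 0 < w y s := by linarith
      have hs0 : 0 < s := by
        rcases eq_or_lt_of_le hs.1 with h | h
        · rw [← h] at hwpos; linarith [h0 y hy]
        · exact h
      have hy0 : 0 < y := by
        rcases eq_or_lt_of_le hy.1 with h | h
        · rw [← h] at hwpos; linarith [(hb s hs).1]
        · exact h
      have hyl : y < l := by
        rcases eq_or_lt_of_le hy.2 with h | h
        · rw [h] at hwpos; linarith [(hb s hs).2]
        · exact h
      have hyI : y ∈ Set.Ioo 0 l := ⟨hy0, hyl⟩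
      have hsI : s ∈ Set.Ioc 0 T := ⟨hs0, hs.2⟩
      have hloc : IsLocalMax (fun a => w a s) y := by
        filter_upwards [isOpen_Ioo.mem_nhds hyI] with a ha
        have := hmax' a (Set.Ioo_subset_Icc_self ha) s hs
        linarith
      have hcy : ContinuousAt (fun a => w a s) y := by
        have : ContinuousOn (fun a => w a s) (Set.Ioo 0 l) :=
          hc.comp (f := fun a => (a, s)) (by fun_prop)
            fun a ha => ⟨Set.Ioo_subset_Icc_self ha, hs⟩
        exact this.continuousAt (isOpen_Ioo.mem_nhds hyI)
      have h1 : dx w y s = 0 := hloc.deriv_eq_zero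
      have h2 : dx (dx w) y s ≤ 0 := deriv_deriv_nonpos_of_isLocalMax hloc hcy
      have h3 := ((hd y hyI s hsI).sub ((hasDerivAt_id s).const_mul (M + η)))
      have h4 := HasDerivAt.nonneg_of_le_left hs0 h3 fun b hb =>
        hmax' y hy b ⟨hb.1, hb.2.trans hs.2⟩
      rw [h1] at h4
      have h5 := mul_nonpos_of_nonneg_of_nonpos hε h2
      have h6 := hg y hyI s hsI
      linarith
    have := hmax' x hx t ht
    linarith
  refine le_of_forall_pos_le_add fun η hη => ?_
  have h1 := key (η / (1 + t)) (div_pos hη (by linarith [ht.1]))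
  have h2 : η / (1 + t) * t ≤ η := by
    have : 0 < 1 + t := by linarith [ht.1]
    rw [div_mul_eq_mul_div, div_le_iff₀ this]
    nlinarith [ht.1]
  linarith

lemma abs_le_mul_of_heat {ε lam l T M : ℝ} (hε : 0 ≤ ε) (hM : 0 ≤ M) {w g : ℝ → ℝ → ℝ}
    (hc : ContinuousOn (Function.uncurry w) (Set.Icc 0 l ×ˢ Set.Icc 0 T))
    (h0 : ∀ x ∈ Set.Icc 0 l, w x 0 = 0)
    (hb : ∀ t ∈ Set.Icc 0 T, w 0 t = 0 ∧ w l t = 0)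
    (hd : ∀ x ∈ Set.Ioo 0 l, ∀ t ∈ Set.Ioc 0 T,
      HasDerivAt (w x) (ε * (dx (dx w) x t - lam * dx w x t) + g x t) t)
    (hg : ∀ x ∈ Set.Ioo 0 l, ∀ t ∈ Set.Ioc 0 T, |g x t| ≤ M) {x t : ℝ} (hx : x ∈ Set.Icc 0 l)
    (ht : t ∈ Set.Icc 0 T) : |w x t| ≤ M * t := by
  refine abs_le'.mpr ⟨?_, ?_⟩
  · exact le_mul_of_heat hε hM hc (fun x hx => (h0 x hx).le)
      (fun t ht => ⟨(hb t ht).1.le, (hb t ht).2.le⟩) hd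
      (fun x hx t ht => (le_abs_self _).trans (hg x hx t ht)) hx ht
  · have e1 : ∀ v : ℝ → ℝ → ℝ, dx (fun y s => -v y s) = fun y s => -dx v y s := fun v => by
      funext y s; exact deriv.fun_neg
    refine le_mul_of_heat (w := fun y s => -w y s) (g := fun y s => -g y s) (lam := lam) hε hM
      hc.neg (fun x hx => by simp [h0 x hx])
      (fun t ht => by simp [(hb t ht).1, (hb t ht).2]) (fun x hx t ht => ?_)
      (fun x hx t ht => (neg_le_abs _).trans (hg x hx t ht)) hx ht
    refine (hd x hx t ht).neg.congr_deriv ?_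
    rw [e1, e1]; ring

/-- The solution and its time derivative are `O(K min(t, 1))`. -/
lemma Source.exists_sol_bound_min {α ε lam l : ℝ} (hα : 0 < α) (hε : 0 < ε) (hlam : 0 < lam)
    (hl : 0 < l) :
    ∃ C > 0, ∀ (K : ℝ) (q : ℝ → ℝ → ℝ), Source l K q → ∀ x ∈ Set.Icc 0 l, ∀ t, 0 ≤ t →
      |solU α ε lam l q x t| ≤ C * K * min t 1 ∧ |solV α ε lam l q x t| ≤ C * K * min t 1 := by
  obtain ⟨C, hC, hb⟩ := Source.exists_sol_bound hα hε hlam hl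
  set C₁ := |1 - ε * α| * C + ε * Real.exp (lam / 2 * l) with hC₁
  have hC₁0 : 0 < C₁ := by positivity
  refine ⟨C + (C₁ + C) / ε, by positivity, fun K q hq x hx t ht => ?_⟩
  have hK : 0 ≤ K := hq.nonneg hl
  have hle : C * K ≤ (C + (C₁ + C) / ε) * K := by
    have : 0 ≤ (C₁ + C) / ε * K := by positivity
    linarith
  rcases le_total 1 t with h1 | h1
  · rw [min_eq_right h1, mul_one]
    exact ⟨(hb K q hq x hx t ht).1.trans hle, (hb K q hq x hx t ht).2.trans hle⟩
  · rw [min_eq_left h1]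
    have hu : |solU α ε lam l q x t| ≤ C * K * t := by
      have := norm_image_sub_le_of_norm_deriv_le_segment' (f := solU α ε lam l q x)
        (f' := solV α ε lam l q x) (a := 0) (b := t) (C := C * K)
        (fun s hs => (hq.hasDerivWithinAt_solU hα hε hlam hl x hs.1).mono Set.Icc_subset_Ici_self)
        (fun s hs => (hb K q hq x hx s hs.1).2) t ⟨ht, le_rfl⟩
      rwa [Source.solU_zero, sub_zero, sub_zero] at this
    have hw : |ε * solV α ε lam l q x t + solU α ε lam l q x t| ≤ C₁ * K * t := by
      -- The uniform bound on u_t, already known, makes the whole right side of the heat equation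
      -- for w bounded by C₁K.
      refine abs_le_mul_of_heat (T := 1) (lam := lam) hε.le (by positivity)
        (w := fun x t => ε * solV α ε lam l q x t + solU α ε lam l q x t)
        (g := fun x t => (1 - ε * α) * solV α ε lam l q x t -
          ε * (Real.exp (lam / 2 * x) * q x t)) ?_
        (fun x _ => by simp [Source.solU_zero, Source.solV_zero]) (fun t _ => ?_)
        (fun x hx t ht => (hq.interior_regularity_sol hα hε hlam hl hx ht.1).2.2.2.2)
        (fun x hx t ht => ?_) hx ⟨ht, h1⟩
      · exact ((continuousOn_const.mul (hq.continuousOn_solV hα hε hlam hl)).add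
          (hq.continuousOn_solU hα hε hlam hl)).mono
          (Set.prod_mono (Set.subset_univ _) Set.Icc_subset_Ici_self)
      · obtain ⟨a, b, c, d⟩ := Source.sol_boundary (α := α) (ε := ε) (lam := lam) hl q t
        simp [a, b, c, d]
      · refine (abs_sub _ _).trans ?_
        rw [abs_mul, abs_mul ε, abs_mul (Real.exp _), abs_of_pos hε, abs_of_pos (Real.exp_pos _)]
        have a1 := mul_le_mul_of_nonneg_left
          (hb K q hq x (Set.Ioo_subset_Icc_self hx) t ht.1.le).2 (abs_nonneg (1 - ε * α))
        have a2 : Real.exp (lam / 2 * x) * |q x t| ≤ Real.exp (lam / 2 * l) * K :=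
          mul_le_mul (Real.exp_le_exp.mpr (mul_le_mul_of_nonneg_left hx.2.le (by positivity)))
            (hq.bound x hx t ht.1) (abs_nonneg _) (Real.exp_pos _).le
        have a3 := mul_le_mul_of_nonneg_left a2 hε.le
        rw [hC₁]; linarith
    have hKt : 0 ≤ K * t := mul_nonneg hK ht
    constructor
    · have : 0 ≤ (C₁ + C) / ε * (K * t) := by positivity
      linarith
    -- Since u and w are both O(Kt), so is u_t = (w - u)/ε.
    · have e : solV α ε lam l q x t =
          ((ε * solV α ε lam l q x t + solU α ε lam l q x t) - solU α ε lam l q x t) / ε := by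
        field_simp; ring
      rw [e, abs_div, abs_of_pos hε, div_le_iff₀ hε]
      refine (abs_sub _ _).trans ((add_le_add hw hu).trans ?_)
      have e2 : (C + (C₁ + C) / ε) * K * t * ε = C * (K * t) * ε + (C₁ + C) * (K * t) := by
        field_simp
      rw [e2]
      have : 0 ≤ C * (K * t) * ε := by positivity
      linarith

/-- For t ≤ 1 the chord of the convex function e^{-δt} over [0, 1] lies above it; for t ≥ 1
monotonicity suffices. -/
lemma mul_min_le_one_sub_exp {δ t : ℝ} (hδ : 0 < δ) (ht : 0 ≤ t) :
    (1 - Real.exp (-δ)) * min t 1 ≤ 1 - Real.exp (-δ * t) := by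
  rcases le_total 1 t with h1 | h1
  · rw [min_eq_right h1, mul_one]
    have : Real.exp (-δ * t) ≤ Real.exp (-δ) := Real.exp_le_exp.mpr (by nlinarith)
    linarith
  · rw [min_eq_left h1]
    have := convexOn_exp.2 (Set.mem_univ 0) (Set.mem_univ (-δ)) (sub_nonneg.mpr h1) ht
      (by ring)
    simp only [smul_eq_mul, mul_zero, zero_add, Real.exp_zero, mul_one] at this
    rw [mul_comm t] at this
    linarith

lemma rate_pos {α ε lam l : ℝ} (hα : 0 < α) (hε : 0 < ε) (hl : 0 < l) : 0 < rate α ε lam l := by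
  have := Real.pi_pos
  unfold rate pRate qRate
  positivity

/-! ### The Green function and the series form of the Duhamel integral -/

lemma gam_succ (l : ℝ) (n : ℕ) : gam l (n + 1) = gamZ l ((n + 1 : ℕ) : ℤ) := by
  simp [gam, gamZ]

lemma exists_summable_Gn_bound {α ε lam l : ℝ} (hα : 0 < α) (hε : 0 < ε) (hlam : 0 < lam)
    (hl : 0 < l) :
    ∃ B : ℕ → ℝ, Summable B ∧ ∀ n t, 0 ≤ t → |Gn α ε lam l (n + 1) t| ≤ B n := by
  obtain ⟨C, hC, hG⟩ := exists_Gn_bounds l hα hε hlam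
  obtain ⟨c, hc, hcb⟩ := exists_le_bZ (lam := lam) hlam hl
  have hs := (summable_wt_rpow (b := 2) (by norm_num)).comp_injective
    (i := fun n : ℕ => ((n + 1 : ℕ) : ℤ)) (fun a b h => by simpa using h)
  refine ⟨_, hs.mul_left (C / c), fun n t ht => ((hG (n + 1)).1 t ht).trans ?_⟩
  have e0 : bn lam l (n + 1) = bZ lam l ((n + 1 : ℕ) : ℤ) := by
    rw [← bn_natAbs, Int.natAbs_natCast]
  have e : wt ((n + 1 : ℕ) : ℤ) ^ (-2 : ℝ) = (wt ((n + 1 : ℕ) : ℤ) ^ 2)⁻¹ := by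
    rw [Real.rpow_neg (wt_pos _).le]; norm_cast
  have hw : 0 < wt ((n + 1 : ℕ) : ℤ) ^ 2 := pow_pos (wt_pos _) 2
  rw [e0]
  simp only [Function.comp]
  rw [e, ← div_eq_mul_inv, div_div]
  exact div_le_div_of_nonneg_left hC.le (by positivity) (hcb _)

lemma abs_greenTerm_le {α ε lam l : ℝ} {B : ℕ → ℝ}
    (hB : ∀ n t, 0 ≤ t → |Gn α ε lam l (n + 1) t| ≤ B n) (x ξ : ℝ) {t : ℝ} (ht : 0 ≤ t) (n : ℕ) :
    |greenTerm α ε lam l x ξ t (n + 1)| ≤ B n := by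
  unfold greenTerm
  rw [abs_mul, abs_mul, mul_assoc]
  refine (mul_le_of_le_one_right (abs_nonneg _) ?_).trans (hB n t ht)
  exact mul_le_one₀ (Real.abs_sin_le_one _) (abs_nonneg _) (Real.abs_sin_le_one _)

lemma summable_greenTerm {α ε lam l : ℝ} (hα : 0 < α) (hε : 0 < ε) (hlam : 0 < lam)
    (hl : 0 < l) (x ξ : ℝ) {t : ℝ} (ht : 0 ≤ t) :
    Summable (fun n : ℕ => greenTerm α ε lam l x ξ t (n + 1)) := by
  obtain ⟨B, hB, h⟩ := exists_summable_Gn_bound hα hε hlam hl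
  exact Summable.of_norm_bounded hB fun n => abs_greenTerm_le h x ξ ht n

lemma continuousOn_green {α ε lam l : ℝ} (hα : 0 < α) (hε : 0 < ε) (hlam : 0 < lam)
    (hl : 0 < l) (x t : ℝ) :
    ContinuousOn (fun p : ℝ × ℝ => green α ε lam l x p.1 (t - p.2)) (Set.univ ×ˢ Set.Iic t) := by
  obtain ⟨B, hB, h⟩ := exists_summable_Gn_bound hα hε hlam hl
  unfold green
  refine ContinuousOn.mul (by fun_prop) ?_
  refine continuousOn_tsum (fun n => ?_) hB fun n p hp =>
    abs_greenTerm_le h x p.1 (sub_nonneg.mpr hp.2) n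
  unfold greenTerm
  have := continuous_Gn α ε lam l (n + 1)
  fun_prop

lemma integrableOn_green {α ε lam l T K : ℝ} (hα : 0 < α) (hε : 0 < ε) (hlam : 0 < lam)
    (hl : 0 < l) {f : ℝ → ℝ → ℝ} (hf : ContinuousOn (Function.uncurry f) (Omega l T))
    (hK : ∀ x ∈ Set.Ioo 0 l, ∀ t ∈ Set.Ioc 0 T, |f x t| ≤ K) (x : ℝ) {t : ℝ}
    (ht : t ∈ Set.Icc 0 T) :
    MeasureTheory.IntegrableOn
      (fun p : ℝ × ℝ => f p.1 p.2 * green α ε lam l x p.1 (t - p.2)) (Omega l t)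
      MeasureTheory.volume := by
  have hsub : Omega l t ⊆ Omega l T := Set.prod_mono le_rfl (Set.Ioc_subset_Ioc_right ht.2)
  have hmeas : MeasurableSet (Omega l t) := measurableSet_Ioo.prod measurableSet_Ioc
  have hgc := continuousOn_green hα hε hlam hl x t
  have hcomp : IsCompact (Set.Icc 0 l ×ˢ Set.Icc 0 t : Set (ℝ × ℝ)) :=
    isCompact_Icc.prod isCompact_Icc
  have hsubc : Omega l t ⊆ (Set.Icc 0 l ×ˢ Set.Icc 0 t : Set (ℝ × ℝ)) :=
    Set.prod_mono Set.Ioo_subset_Icc_self Set.Ioc_subset_Icc_self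
  have hsubu : (Set.Icc 0 l ×ˢ Set.Icc 0 t : Set (ℝ × ℝ)) ⊆ Set.univ ×ˢ Set.Iic t :=
    Set.prod_mono (Set.subset_univ _) fun s hs => hs.2
  obtain ⟨M, hM⟩ := hcomp.exists_bound_of_continuousOn (hgc.mono hsubu)
  refine MeasureTheory.IntegrableOn.of_bound
    ((MeasureTheory.measure_mono hsubc).trans_lt hcomp.measure_lt_top)
    (((hf.mono hsub).mul (hgc.mono (hsubc.trans hsubu))).aestronglyMeasurable hmeas) (|K| * M)
    ((MeasureTheory.ae_restrict_iff' hmeas).mpr (Eventually.of_forall fun p hp => ?_))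
  rw [norm_mul]
  exact mul_le_mul ((hK p.1 hp.1 p.2 (hsub hp).2).trans (le_abs_self K)) (hM p (hsubc hp))
    (norm_nonneg _) (abs_nonneg _)

/-- The source, extended past the final time as a constant and freed of the drift. -/
def extSource (lam T : ℝ) (f : ℝ → ℝ → ℝ) (x t : ℝ) : ℝ :=
  f x (min t T) * Real.exp (-(lam / 2) * x)

lemma source_extSource {lam l T K : ℝ} (hlam : 0 < lam) (hT : 0 < T) {f : ℝ → ℝ → ℝ}
    (hf : ContinuousOn (Function.uncurry f) (Omega l T))
    (hfd : ∀ x ∈ Set.Ioo 0 l, ∀ t ∈ Set.Ioc 0 T, DifferentiableAt ℝ (fun y => f y t) x)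
    (hfdc : ContinuousOn (Function.uncurry (dx f)) (Omega l T))
    (hK : ∀ x ∈ Set.Ioo 0 l, ∀ t ∈ Set.Ioc 0 T, |f x t| ≤ K) :
    Source l K (extSource lam T f) := by
  have hm : ∀ t : ℝ, 0 < t → min t T ∈ Set.Ioc 0 T := fun t ht => ⟨lt_min ht hT, min_le_right _ _⟩
  have hmaps : Set.MapsTo (fun z : ℝ × ℝ => (z.1, min z.2 T)) (Set.Ioo 0 l ×ˢ Set.Ioi 0)
      (Omega l T) := fun z hz => ⟨hz.1, hm z.2 hz.2⟩
  have c1 : ContinuousOn (fun z : ℝ × ℝ => f z.1 (min z.2 T)) (Set.Ioo 0 l ×ˢ Set.Ioi 0) :=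
    hf.comp (f := fun z : ℝ × ℝ => (z.1, min z.2 T)) (by fun_prop) hmaps
  have c2 : ContinuousOn (fun z : ℝ × ℝ => dx f z.1 (min z.2 T)) (Set.Ioo 0 l ×ˢ Set.Ioi 0) :=
    hfdc.comp (f := fun z : ℝ × ℝ => (z.1, min z.2 T)) (by fun_prop) hmaps
  have hD : ∀ x ∈ Set.Ioo 0 l, ∀ t, 0 < t → HasDerivAt (fun y => extSource lam T f y t)
      (dx f x (min t T) * Real.exp (-(lam / 2) * x) +
        f x (min t T) * (-(lam / 2) * Real.exp (-(lam / 2) * x))) x := fun x hx t ht =>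
    (hfd x hx _ (hm t ht)).hasDerivAt.mul (hasDerivAt_exp_mul (-(lam / 2)) x)
  refine ⟨c1.mul (by fun_prop), fun x hx t ht => ?_,
    fun x hx t ht => (hD x hx t ht).differentiableAt, ?_⟩
  · rw [extSource, abs_mul, abs_of_pos (Real.exp_pos _)]
    refine (mul_le_of_le_one_right (abs_nonneg _) ?_).trans (hK x hx _ (hm t ht))
    -- For λ > 0 and x > 0 the factor e^{-λx/2} is at most 1, so the bound K passes unchanged to the
    -- transformed source.
    exact Real.exp_le_one_iff.mpr (by nlinarith [hx.1])
  · have c3 : ContinuousOn (fun z : ℝ × ℝ => dx f z.1 (min z.2 T) *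
        Real.exp (-(lam / 2) * z.1) + f z.1 (min z.2 T) *
        (-(lam / 2) * Real.exp (-(lam / 2) * z.1))) (Set.Ioo 0 l ×ˢ Set.Ioi 0) :=
      (c2.mul (by fun_prop)).add (c1.mul (by fun_prop))
    exact c3.congr fun z hz => (hD z.1 hz.1 z.2 hz.2).deriv

lemma srcCoeff_neg (l : ℝ) (q : ℝ → ℝ → ℝ) (n : ℤ) (t : ℝ) :
    srcCoeff l q (-n) t = -srcCoeff l q n t := by
  simp only [srcCoeff, sinCoeff, gamZ_neg, neg_mul, Real.sin_neg, mul_neg,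
    intervalIntegral.integral_neg]

lemma modeU_neg (α ε lam l : ℝ) (q : ℝ → ℝ → ℝ) (n : ℤ) (t : ℝ) :
    modeU α ε lam l q (-n) t = -modeU α ε lam l q n t := by
  simp only [modeU, duh, srcCoeff_neg, Int.natAbs_neg, mul_neg, intervalIntegral.integral_neg]

lemma tsum_int_of_even {h : ℤ → ℝ} (hs : Summable h) (h0 : h 0 = 0) (hev : ∀ n, h (-n) = h n) :
    ∑' n, h n = 2 * ∑' n : ℕ, h ((n + 1 : ℕ) : ℤ) := by
  have hinj : Function.Injective (fun n : ℕ => (n : ℤ)) := fun a b h => by simpa using h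
  have h1 : Summable (fun n : ℕ => h n) := hs.comp_injective hinj
  have e : ∀ n : ℕ, h (-((n : ℤ) + 1)) = h ((n + 1 : ℕ) : ℤ) := fun n => by
    rw [hev]; push_cast; rfl
  have h2 : Summable (fun n : ℕ => h (-((n : ℤ) + 1))) := by
    simp_rw [e]; exact (summable_nat_add_iff 1).mpr h1
  rw [tsum_of_nat_of_neg_add_one h1 h2, h1.tsum_eq_zero_add]
  simp_rw [e]
  simp only [Nat.cast_zero, h0]
  ring

/-- The Duhamel integral is the sum of its sine series. -/
lemma duhamel_eq_solU {α ε lam l T K : ℝ} (hα : 0 < α) (hε : 0 < ε) (hlam : 0 < lam)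
    (hl : 0 < l) {f : ℝ → ℝ → ℝ} (hq : Source l K (extSource lam T f)) (x : ℝ) {t : ℝ}
    (ht : t ∈ Set.Icc 0 T) :
    duhamel α ε lam l f x t = solU α ε lam l (extSource lam T f) x t := by
  obtain ⟨B, hB, hG⟩ := exists_summable_Gn_bound hα hε hlam hl
  set q := extSource lam T f with hqdef
  have hK : 0 ≤ K := hq.nonneg hl
  set N : ℕ → ℤ := fun n => ((n + 1 : ℕ) : ℤ) with hN
  have hNabs : ∀ n, (N n).natAbs = n + 1 := fun n => Int.natAbs_natCast _
  -- Only 0 < τ < t is needed under the outer integral; there τ ≤ T, so the extended source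
  -- coincides with e^{-λξ/2}f, the exponential coming from the Green function.
  have inner : ∀ τ ∈ Set.Ioo 0 t, ∫ ξ in (0 : ℝ)..l, f ξ τ * green α ε lam l x ξ (t - τ) =
      2 / l * Real.exp (lam / 2 * x) * ∑' n, Real.sin (gamZ l (N n) * x) *
        (Gn α ε lam l (N n).natAbs (t - τ) * srcCoeff l q (N n) τ) := by
    intro τ hτ
    have htτ : 0 ≤ t - τ := by linarith [hτ.2]
    have h1 := hasSum_integral_mul (g := fun ξ => q ξ τ)
      (e := fun n ξ => greenTerm α ε lam l x ξ (t - τ) (n + 1)) hl.le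
      (hq.intervalIntegrable hl hτ.1) (fun n => by unfold greenTerm; fun_prop) hB
      (fun n ξ _ => abs_greenTerm_le hG x ξ htτ n)
    have e1 : ∀ ξ, f ξ τ * green α ε lam l x ξ (t - τ) = 2 / l * Real.exp (lam / 2 * x) *
        (q ξ τ * ∑' n, greenTerm α ε lam l x ξ (t - τ) (n + 1)) := by
      intro ξ
      rw [hqdef, extSource, min_eq_left (hτ.2.le.trans ht.2), green]
      have : Real.exp (lam / 2 * (x - ξ)) =
          Real.exp (lam / 2 * x) * Real.exp (-(lam / 2) * ξ) := by
        rw [← Real.exp_add]; congr 1; ring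
      rw [this]; ring
    simp_rw [e1]
    rw [intervalIntegral.integral_const_mul, ← h1.tsum_eq]
    congr 1
    refine tsum_congr fun n => ?_
    rw [srcCoeff, sinCoeff, ← intervalIntegral.integral_const_mul,
      ← intervalIntegral.integral_const_mul]
    refine intervalIntegral.integral_congr fun ξ _ => ?_
    simp only [greenTerm, gam_succ, hNabs]
    ring
  have outer : HasSum (fun n => ∫ τ in (0 : ℝ)..t, Real.sin (gamZ l (N n) * x) *
        (Gn α ε lam l (N n).natAbs (t - τ) * srcCoeff l q (N n) τ))
      (∫ τ in (0 : ℝ)..t, ∑' n, Real.sin (gamZ l (N n) * x) *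
        (Gn α ε lam l (N n).natAbs (t - τ) * srcCoeff l q (N n) τ)) := by
    have hb : ∀ n, ∀ τ ∈ Set.uIoc 0 t, ‖Real.sin (gamZ l (N n) * x) *
        (Gn α ε lam l (N n).natAbs (t - τ) * srcCoeff l q (N n) τ)‖ ≤ B n * (K * l) := by
      intro n τ hτ
      rw [Set.uIoc_of_le ht.1] at hτ
      rw [norm_mul, norm_mul]
      refine (mul_le_of_le_one_left (by positivity) (Real.abs_sin_le_one _)).trans ?_
      rw [hNabs]
      have := hG n (t - τ) (by linarith [hτ.2])
      exact mul_le_mul this (hq.abs_srcCoeff_le hl _ hτ.1) (norm_nonneg _)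
        ((abs_nonneg _).trans this)
    refine intervalIntegral.hasSum_integral_of_dominated_convergence (fun n _ => B n * (K * l))
      (fun n => ?_) (fun n => Eventually.of_forall fun τ hτ => hb n τ hτ)
      (Eventually.of_forall fun τ _ => hB.mul_right _) intervalIntegrable_const
      (Eventually.of_forall fun τ hτ => ?_)
    · have hGc := continuous_Gn α ε lam l (N n).natAbs
      have : ContinuousOn (fun τ => Real.sin (gamZ l (N n) * x) *
          (Gn α ε lam l (N n).natAbs (t - τ) * srcCoeff l q (N n) τ)) (Set.uIoc 0 t) :=
        continuousOn_const.mul (ContinuousOn.mul (by fun_prop)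
          ((hq.continuousOn_srcCoeff hl (N n)).mono fun τ hτ => by
            rw [Set.uIoc_of_le ht.1] at hτ; exact hτ.1))
      exact this.aestronglyMeasurable measurableSet_uIoc
    · exact (Summable.of_norm_bounded (hB.mul_right (K * l)) fun n => hb n τ hτ).hasSum
  have e2 : duhamel α ε lam l f x t = -(2 / l * Real.exp (lam / 2 * x) *
      ∫ τ in (0 : ℝ)..t, ∑' n, Real.sin (gamZ l (N n) * x) *
        (Gn α ε lam l (N n).natAbs (t - τ) * srcCoeff l q (N n) τ)) := by
    rw [duhamel, ← intervalIntegral.integral_const_mul]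
    congr 1
    exact intervalIntegral.integral_congr_Ioo_of_le ht.1 inner
  have hs : Summable (fun n => modeU α ε lam l q n t * Real.sin (gamZ l n * x)) :=
    (Source.weightedBdd_sin (hq.weightedBdd_modeU hα hε hlam hl (σ := 1 / 2)
      (by norm_num))).summable (p := (x, t)) (by norm_num) ⟨Set.mem_univ _, ht.1⟩
  -- Coefficients and sines are both odd in n, so the sum over ℤ is twice the sum over n ≥ 1; this
  -- accounts for 1/l in `solU` against 2/l in `green`.
  have h3 := tsum_int_of_even hs (by simp [gamZ]) fun n => by
    rw [modeU_neg, gamZ_neg, neg_mul, neg_mul, Real.sin_neg]; ring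
  rw [e2, ← outer.tsum_eq, solU, sinSeries, h3]
  have e4 : ∀ n : ℕ, modeU α ε lam l q (N n) t * Real.sin (gamZ l (N n) * x) =
      -∫ τ in (0 : ℝ)..t, Real.sin (gamZ l (N n) * x) *
        (Gn α ε lam l (N n).natAbs (t - τ) * srcCoeff l q (N n) τ) := by
    intro n
    rw [intervalIntegral.integral_const_mul, modeU, duh]; ring
  rw [tsum_congr e4, tsum_neg]
  ring

end Strip

end

/-! ### Assembly of the theorem -/

open Strip

theorem theorem4p2 (α ε lam l : ℝ) (hα : 0 < α) (hε : 0 < ε) (hlam : 0 < lam) (hl : 0 < l) :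
    -- the Fourier series of the Green function converges absolutely
    (∀ x ξ t : ℝ, 0 ≤ t → Summable (fun n : ℕ => Strip.greenTerm α ε lam l x ξ t (n + 1))) ∧
    -- `C` depends on `α`, `ε`, `λ`, `l` only
    ∃ C : ℝ, 0 < C ∧ ∀ (T : ℝ) (f : ℝ → ℝ → ℝ) (K : ℝ), 0 < T →
      ContinuousOn (Function.uncurry f) (Strip.Omega l T) →
      (∀ x ∈ Set.Ioo 0 l, ∀ t ∈ Set.Ioc 0 T, DifferentiableAt ℝ (fun y => f y t) x) →
      ContinuousOn (Function.uncurry (Strip.dx f)) (Strip.Omega l T) →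
      (∀ x ∈ Set.Ioo 0 l, ∀ t ∈ Set.Ioc 0 T, |f x t| ≤ K) →
      -- the Duhamel integral converges absolutely
      (∀ x ∈ Set.Icc 0 l, ∀ t ∈ Set.Icc 0 T,
        MeasureTheory.IntegrableOn
          (fun p : ℝ × ℝ => f p.1 p.2 * Strip.green α ε lam l x p.1 (t - p.2))
          (Strip.Omega l t) MeasureTheory.volume) ∧
      Strip.IsSolution α ε lam l T f (fun _ => 0) (fun _ => 0) (Strip.duhamel α ε lam l f) ∧
      ∀ x ∈ Set.Icc 0 l, ∀ t ∈ Set.Icc 0 T,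
        |Strip.duhamel α ε lam l f x t| ≤ C * K * (1 - Real.exp (-(Strip.rate α ε lam l) * t)) ∧
        |Strip.dt T (Strip.duhamel α ε lam l f) x t| ≤
          C * K * (1 - Real.exp (-(Strip.rate α ε lam l) * t)) := by
  refine ⟨fun x ξ t ht => summable_greenTerm hα hε hlam hl x ξ ht, ?_⟩
  obtain ⟨C, hC, hbd⟩ := Source.exists_sol_bound_min hα hε hlam hl
  have hδ : 0 < rate α ε lam l := rate_pos hα hε hl
  have hκ : 0 < 1 - Real.exp (-(rate α ε lam l)) := by
    have : Real.exp (-(rate α ε lam l)) < 1 := Real.exp_lt_one_iff.mpr (by linarith)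
    linarith
  -- Dividing by 1 - e^{-δ} converts the min(t, 1) bound into the required form; the constant still
  -- depends only on the coefficients and l.
  refine ⟨C / (1 - Real.exp (-(rate α ε lam l))), by positivity, ?_⟩
  intro T f K hT hf hfd hfdc hK
  have hq := source_extSource (K := K) hlam hT hf hfd hfdc hK
  have hK0 : 0 ≤ K := hq.nonneg hl
  set q := extSource lam T f with hqdef
  have eu : ∀ x, ∀ t ∈ Set.Icc 0 T, duhamel α ε lam l f x t = solU α ε lam l q x t :=
    fun x t ht => duhamel_eq_solU hα hε hlam hl hq x ht
  have hdu : ∀ x, ∀ t ∈ Set.Icc 0 T,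
      HasDerivWithinAt (duhamel α ε lam l f x) (solV α ε lam l q x t) (Set.Icc 0 T) t :=
    fun x t ht => ((hq.hasDerivWithinAt_solU hα hε hlam hl x ht.1).mono
      Set.Icc_subset_Ici_self).congr (fun s hs => eu x s hs) (eu x t ht)
  have hud : ∀ t ∈ Set.Icc 0 T, UniqueDiffWithinAt ℝ (Set.Icc 0 T) t := uniqueDiffOn_Icc hT
  have ev : ∀ x, ∀ t ∈ Set.Icc 0 T, dt T (duhamel α ε lam l f) x t = solV α ε lam l q x t :=
    fun x t ht => (hdu x t ht).derivWithin (hud t ht)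
  have hsub : closedOmega l T ⊆ Set.univ ×ˢ Set.Ici 0 :=
    Set.prod_mono (Set.subset_univ _) Set.Icc_subset_Ici_self
  set w : ℝ → ℝ → ℝ := fun y s => ε * solV α ε lam l q y s + solU α ε lam l q y s with hw
  set w' : ℝ → ℝ → ℝ := fun y s => ε * dt T (duhamel α ε lam l f) y s + duhamel α ε lam l f y s
    with hw'
  have ew : ∀ t ∈ Set.Icc 0 T, (fun y => w' y t) = fun y => w y t := fun t ht => funext fun y => by
    simp only [hw, hw', eu y t ht, ev y t ht]
  have edx : ∀ x, ∀ t ∈ Set.Icc 0 T, dx w' x t = dx w x t := fun x t ht => by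
    unfold dx; rw [ew t ht]
  have edx2 : ∀ x, ∀ t ∈ Set.Icc 0 T, dx (dx w') x t = dx (dx w) x t := fun x t ht => by
    have : (fun y => dx w' y t) = fun y => dx w y t := funext fun y => edx y t ht
    change deriv (fun y => dx w' y t) x = deriv (fun y => dx w y t) x
    rw [this]
  have sub01 : Set.Ioc 0 T ⊆ Set.Icc 0 T := Set.Ioc_subset_Icc_self
  have reg := fun x (hx : x ∈ Set.Ioo 0 l) t (ht : t ∈ Set.Ioc 0 T) =>
    hq.interior_regularity_sol hα hε hlam hl hx ht.1
  have hqf : ∀ x, ∀ t ∈ Set.Ioc 0 T, Real.exp (lam / 2 * x) * q x t = f x t := by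
    intro x t ht
    rw [hqdef, extSource, min_eq_left ht.2, mul_left_comm, ← Real.exp_add]
    simp
  -- The value of u_tt dictated by the equation. That it is the derivative of u_t comes from u_t =
  -- (w - u)/ε and the heat equation for w, so the equation afterwards holds by rearrangement.
  set utt : ℝ → ℝ → ℝ := fun x t =>
    dx (dx w) x t - lam * dx w x t - α * solV α ε lam l q x t - f x t with hutt
  have hvt : ∀ x ∈ Set.Ioo 0 l, ∀ t ∈ Set.Ioc 0 T,
      HasDerivAt (solV α ε lam l q x) (utt x t) t := by
    intro x hx t ht
    have h1 := ((reg x hx t ht).2.2.2.2.sub (hq.hasDerivAt_solU hα hε hlam hl x ht.1)).div_const ε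
    have e : solV α ε lam l q x = fun s => (w x s - solU α ε lam l q x s) / ε := by
      funext s; simp only [hw]; field_simp; ring
    rw [e]
    refine h1.congr_deriv ?_
    rw [hqf x t ht]
    simp only [hutt]
    field_simp
    ring
  have hdvt : ∀ x ∈ Set.Ioo 0 l, ∀ t ∈ Set.Ioc 0 T,
      HasDerivWithinAt (dt T (duhamel α ε lam l f) x) (utt x t) (Set.Icc 0 T) t :=
    fun x hx t ht => (hvt x hx t ht).hasDerivWithinAt.congr (fun s hs => ev x s hs)
      (ev x t (sub01 ht))
  have edtt : ∀ x ∈ Set.Ioo 0 l, ∀ t ∈ Set.Ioc 0 T,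
      dt T (dt T (duhamel α ε lam l f)) x t = utt x t := fun x hx t ht =>
    (hdvt x hx t ht).derivWithin (hud t (sub01 ht))
  have cwx : ContinuousOn (Function.uncurry (dx w)) (Omega l T) := fun z hz =>
    (reg z.1 hz.1 z.2 hz.2).2.1.continuousWithinAt
  have cwxx : ContinuousOn (Function.uncurry (dx (dx w))) (Omega l T) := fun z hz =>
    (reg z.1 hz.1 z.2 hz.2).2.2.2.1.continuousWithinAt
  have hsubO : Omega l T ⊆ Set.univ ×ˢ Set.Ici 0 :=
    Set.prod_mono (Set.subset_univ _) fun t ht => ht.1.le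
  have cV : ContinuousOn (Function.uncurry (solV α ε lam l q)) (Omega l T) :=
    (hq.continuousOn_solV hα hε hlam hl).mono hsubO
  refine ⟨fun x _ t ht => integrableOn_green hα hε hlam hl hf hK x ht, ?_, ?_⟩
  · refine
      { continuous_u := ((hq.continuousOn_solU hα hε hlam hl).mono hsub).congr
          fun z hz => eu z.1 z.2 hz.2
        exists_ut := fun x _ t ht => (hdu x t ht).differentiableWithinAt
        continuous_ut := ((hq.continuousOn_solV hα hε hlam hl).mono hsub).congr
          fun z hz => ev z.1 z.2 hz.2
        exists_utt := fun x hx t ht => (hdvt x hx t ht).differentiableWithinAt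
        continuous_utt := ?_
        exists_wx := fun x hx t ht => ?_
        continuous_wx := cwx.congr fun z hz => edx z.1 z.2 (sub01 hz.2)
        exists_wxx := fun x hx t ht => ?_
        continuous_wxx := cwxx.congr fun z hz => edx2 z.1 z.2 (sub01 hz.2)
        equation := fun x hx t ht => ?_
        initial_u := fun x _ => (eu x 0 ⟨le_rfl, hT.le⟩).trans (Source.solU_zero x)
        initial_ut := fun x _ => (ev x 0 ⟨le_rfl, hT.le⟩).trans (Source.solV_zero x)
        boundary := fun t ht => ?_ }
    · have : ContinuousOn (fun z : ℝ × ℝ => Function.uncurry (dx (dx w)) z -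
          lam * Function.uncurry (dx w) z - α * Function.uncurry (solV α ε lam l q) z -
          Function.uncurry f z) (Omega l T) := by fun_prop
      exact this.congr fun z hz => edtt z.1 hz.1 z.2 hz.2
    · change DifferentiableAt ℝ (fun y => w' y t) x
      rw [ew t (sub01 ht)]
      exact (reg x hx t ht).1
    · have : (fun y => dx w' y t) = fun y => dx w y t := funext fun y => edx y t (sub01 ht)
      change DifferentiableAt ℝ (fun y => dx w' y t) x
      rw [this]
      exact (reg x hx t ht).2.2.1
    · change dx (dx w') x t - lam * dx w' x t - dt T (fun y s =>
        dt T (duhamel α ε lam l f) y s + α * duhamel α ε lam l f y s) x t = f x t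
      have h1 : dt T (fun y s => dt T (duhamel α ε lam l f) y s +
          α * duhamel α ε lam l f y s) x t = utt x t + α * solV α ε lam l q x t :=
        ((hdvt x hx t ht).add ((hdu x t (sub01 ht)).const_mul α)).derivWithin
          (hud t (sub01 ht))
      rw [h1, edx x t (sub01 ht), edx2 x t (sub01 ht)]
      simp only [hutt]; ring
    · obtain ⟨a, b, -, -⟩ := Source.sol_boundary (α := α) (ε := ε) (lam := lam) hl q t
      rw [eu 0 t (sub01 ht), eu l t (sub01 ht)]
      exact ⟨a, b⟩
  · intro x hx t ht
    have h1 := hbd K q hq x hx t ht.1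
    have h2 := mul_min_le_one_sub_exp hδ ht.1
    have h3 : C * K * min t 1 ≤ C / (1 - Real.exp (-(rate α ε lam l))) * K *
        (1 - Real.exp (-(rate α ε lam l) * t)) := by
      have h4 := mul_le_mul_of_nonneg_left h2
        (show 0 ≤ C / (1 - Real.exp (-(rate α ε lam l))) * K by positivity)
      refine le_trans (le_of_eq ?_) h4
      field_simp
    rw [eu x t ht, ev x t ht]
    exact ⟨h1.1.trans h3, h1.2.trans h3⟩
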